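/- Let $F$ be a surface. An *immersed curve* in $F$ is the image $C=f(S^1)$ of a generic immersion $f:S^1\to F$ in the topological sense: $f$ is continuous and every point $p\in C$ has a chart of $F$ centred at $p$ in which $C$ is either one straight strand through $p$ (and $p$ is the image of exactly one point of $S^1$) or two crossing lines (and $p$ is the image of exactly two points of $S^1$, near which $f$ runs along the one and the other line respectively; $p$ is then called a double point). The following moves change an immersed curve only inside an open disk $U\subset F$, and there only inside a closed disk contained in $U$. * *Move 1a*: if $C\cap U$ is a single strand with one kink (one double point, bounding an empty one-sided polygon), the kink is removed. * *Move 1b*: the inverse of move 1a; a kink is inserted into a strand. * *Move 3*: if $C\cap U$ consists of three simple strands, any two of them crossing in exactly one point and the three crossings spanning an empty triangle, one strand is pushed across the crossing of the other two. An immersed curve is *$(1,3)$-simplifiable* in $F$ if some finite sequence of immersed curves leads from it to an embedded circle, each curve being obtained from the preceding one by a move 1a, 1b or 3, or by an ambient isotopy of $F$. On the unit sphere $S^2\subset\mathbb R^3$ let $C_0$ be the closed curve which at time $u\in\mathbb R/8\mathbb Z$ has longitude $\frac{\pi}{4}\bigl(u+\sin(2\pi u)\bigr)$ and latitude $\cos(\pi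 u)$ (in radians). (It is a cyclic chain of eight three-strand tangles, each of which has exactly two double points, between a cap entering from the left and a cap entering from the right, while the third strand passes alternately north and south of them; it has 16 double points, and its complementary regions are 8 bigons, 8 pentagons and 2 quadrilaterals.) **Theorem.** $C_0$ is an immersed curve in $S^2$, and it is not $(1,3)$-simplifiable in $S^2$. Consequently Östlund's conjecture is false: not every immersed curve in $\mathbb R^2$ is $(1,3)$-simplifiable in $\mathbb R^2$. -/

import Mathlib

open Set Filter Topology

noncomputable section

namespace ImmersedCurve

section Curves

variable {F : Type*} [TopologicalSpace F]

/-- `f : S¹ → F` is a generic immersion (in the topological category): near every point `p` of its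
image there is a chart `e` of `F`, centred at `p`, in which the image is
* either a single straight strand (the horizontal axis), and `p` is taken exactly once by `f`;
* or two strands crossing at `p` (the two coordinate axes), and `p` is taken exactly twice by `f`,
  once by each of the two strands: near one preimage `f` runs along the horizontal axis, near the
  other one it runs along the vertical axis.
Points off the image need no condition: the image is compact, so they have a neighbourhood that
misses it. -/
def IsGenericImmersion (f : C(Circle, F)) : Prop :=
  ∀ p ∈ range f,
    (∃ s : Circle, f ⁻¹' {p} = {s} ∧
      ∃ e : OpenPartialHomeomorph F (ℝ × ℝ), p ∈ e.source ∧ e p = (0, 0) ∧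
        ∀ q ∈ e.source, (q ∈ range f ↔ (e q).2 = 0)) ∨
    (∃ s t : Circle, s ≠ t ∧ f ⁻¹' {p} = {s, t} ∧
      ∃ e : OpenPartialHomeomorph F (ℝ × ℝ), p ∈ e.source ∧ e p = (0, 0) ∧
        (∀ q ∈ e.source, (q ∈ range f ↔ ((e q).1 = 0 ∨ (e q).2 = 0))) ∧
        (∀ᶠ u in 𝓝 s, (e (f u)).2 = 0) ∧ (∀ᶠ u in 𝓝 t, (e (f u)).1 = 0))

/-- An immersed curve in the surface `F`: the image of a generic immersion of the circle. -/
def IsImmersedCurve (C : Set F) : Prop :=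
  ∃ f : C(Circle, F), IsGenericImmersion f ∧ range f = C

/-- An embedded circle in `F`: an immersed curve without double points. -/
def IsEmbeddedCircle (C : Set F) : Prop :=
  ∃ f : C(Circle, F), IsEmbedding f ∧ range f = C

/-- `C'` is obtained from `C` by finding an open disk of `F` (the image of `φ`) in which the curve
is a homeomorphic copy of the picture `L`, and replacing the content of that disk by the
corresponding copy of the picture `R`.  It is used for pictures `L`, `R` in the plane that agree
outside a compact square, so that everything near the frontier of the disk stays fixed. -/
def Replaces (L R : Set (ℝ × ℝ)) (C C' : Set F) : Prop :=
  ∃ φ : ℝ × ℝ → F, IsOpenEmbedding φ ∧ φ ⁻¹' C = L ∧ φ ⁻¹' C' = R ∧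
    C \ range φ = C' \ range φ

/-- `C'` is obtained from `C` by an ambient isotopy of `F`. -/
def AmbientIsotopic (C C' : Set F) : Prop :=
  ∃ H : unitInterval → F ≃ₜ F,
    Continuous (fun x : unitInterval × F => H x.1 x.2) ∧
    Continuous (fun x : unitInterval × F => (H x.1).symm x.2) ∧
    H 0 = Homeomorph.refl F ∧ H 1 '' C = C'

end Curves

/-! The pictures of the moves. -/

/-- A single strand: the horizontal axis. -/
def strand : Set (ℝ × ℝ) := {z | z.2 = 0}

/-- A single strand with a kink: it comes in along the horizontal axis up to `(-1, 0)`, runs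
through `(0, 1)` to `(1, 2)`, then to `(-1, 2)`, back through `(0, 1)` to `(1, 0)`, and leaves along
the horizontal axis.  Its only double point is `(0, 1)`. -/
def kink : Set (ℝ × ℝ) :=
  {z | (1 ≤ |z.1| ∧ z.2 = 0) ∨ (|z.1| ≤ 1 ∧ (z.2 = 2 ∨ |z.2 - 1| = |z.1|))}

/-- Two strands crossing at the origin (the diagonals), and a third strand that follows the
horizontal axis but passes below their crossing. -/
def triangleBelow : Set (ℝ × ℝ) :=
  {z | z.2 = z.1 ∨ z.2 = -z.1 ∨ z.2 = -max 0 (1 - |z.1|)}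

/-- The same three strands, the third one now passing above the crossing of the other two. -/
def triangleAbove : Set (ℝ × ℝ) :=
  {z | z.2 = z.1 ∨ z.2 = -z.1 ∨ z.2 = max 0 (1 - |z.1|)}

section Moves

variable {F : Type*} [TopologicalSpace F]

/-- Reidemeister move 1a: a kink (with empty monogon) is removed. -/
def Move1a (C C' : Set F) : Prop := Replaces kink strand C C'

/-- Reidemeister move 1b: a kink is created. -/
def Move1b (C C' : Set F) : Prop := Replaces strand kink C C'

/-- Reidemeister move 3: a strand is pushed across a double point, through an empty triangle.
(The inverse move is again of this form, by reflecting the plane in the horizontal axis.) -/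
def Move3 (C C' : Set F) : Prop := Replaces triangleBelow triangleAbove C C'

/-- `C` is (1,3)-simplifiable: a finite sequence of immersed curves leads from `C` to an embedded
circle, each obtained from the previous one by a move 1a, 1b or 3, or by an isotopy. -/
def IsOneThreeSimplifiable (C : Set F) : Prop :=
  ∃ (N : ℕ) (c : ℕ → Set F), c 0 = C ∧
    (∀ i ≤ N, IsImmersedCurve (c i)) ∧
    (∀ i < N, Move1a (c i) (c (i + 1)) ∨ Move1b (c i) (c (i + 1)) ∨ Move3 (c i) (c (i + 1)) ∨
      AmbientIsotopic (c i) (c (i + 1))) ∧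
    IsEmbeddedCircle (c N)

end Moves

/-- The sphere `S²`. -/
abbrev Sphere2 : Type := Metric.sphere (0 : EuclideanSpace ℝ (Fin 3)) 1

/-- The point of `S²` with the given longitude and latitude. -/
def spherePoint (lon lat : ℝ) : Sphere2 :=
  ⟨!₂[Real.cos lat * Real.cos lon, Real.cos lat * Real.sin lon, Real.sin lat], by
    have h1 := Real.sin_sq_add_cos_sq lon
    have h2 := Real.sin_sq_add_cos_sq lat
    rw [mem_sphere_zero_iff_norm, EuclideanSpace.norm_eq, Real.sqrt_eq_one]
    simp only [Fin.sum_univ_three, Real.norm_eq_abs, sq_abs]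
    simp
    linear_combination (Real.cos lat) ^ 2 * h1 + h2⟩

/-- The closed curve on `S²`, of period `8` in `u`, whose image is the curve of the theorem.
Cut the sphere (minus the poles) by meridians into eight boxes, the `k`-th one centred at longitude
`k * π / 4`.  The curve runs forward in the north over a bit more than two boxes, back in the middle
(near the equator) over a bit more than one box, forward in the south over a bit more than two
boxes, back in the middle over a bit more than one box, and so on, eight times forward and eight
times back.  So each box contains two caps, one from either side, clasping in exactly two double
points, and one strand passing through, north and south of the clasp alternately; the through
strand continues on either side into a cap of the next box.  There are 16 double points, and the
complementary regions are 8 bigons, 8 pentagons, and two quadrilaterals around the poles. -/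
def clasp8 (u : ℝ) : Sphere2 :=
  spherePoint (Real.pi / 4 * (u + Real.sin (2 * Real.pi * u))) (Real.cos (Real.pi * u))

/-- The image of `clasp8`, a subset of `S²`. -/
def clasp8Curve : Set Sphere2 := range clasp8

end ImmersedCurve

end

set_option linter.unusedSectionVars false

namespace ImmersedCurve

/-! The curve is traversed by a loop `g` of period `1`. A double point `g s = g t` cuts the circle
of times into two arcs. The invariant is an arc system (`ArcSystem`): a choice of one arc at each
double point such that the chosen arcs cover the circle, but no six of them do. A curve without
double points offers no arcs, hence no cover (`HasArcSystem.not_isEmbeddedCircle`). So it suffices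
that arc systems survive every move and that the given curve has one.

Kinks. One of the two arcs at a kink lies inside the kink. When a kink is created, this short arc is
chosen. It adds nothing to a cover, because it lies in an old arc that contains the whole strand
(`ArcSystem.insert_kink`). When a kink is removed, the long arc cannot have been the chosen one:
together with an arc containing the monogon it would be a cover by two. So the short arc was chosen,
and it can be dropped (`ArcSystem.remove_kink`).

Triangles. Let A, B, C be the three strands in cyclic order on the circle, with crossings p = AB, q
= BC, r = CA. The chosen arcs at p, q, r cannot cover all three gaps between the strands: outside
the arcs at p, q, r each strand is taken care of by one further arc, and three plus three arcs would
be a cover by six (`ArcSystem.exists_gap`). This is where the number six comes from. So some gap is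
free, say CA, and this determines the three choices: p spans the gap AB, q spans BC, and r spans AB
and BC. The corresponding arcs are chosen after the move. A cover on one side of the move can be
turned into a cover of the same size on the other side (`TriOrder.transfer`), so both conditions
persist (`ArcSystem.triangle`).

The curve. In the time `u` modulo `8`, its double points are the pairs `n - δ`, `n + δ`, where `n`
is an integer and `δ` a nonzero solution of `δ + sin (2πδ) = 0`; all solutions have `|δ| < 1`. The
arcs `[n - δ, n + δ]` with `δ > 0` form an arc system: some `δ` exceeds `1/2`, so they cover, and
each contains only one of the eight integer times, so six do not cover (`LonLatCoord.arcSystem`).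
Nothing here uses more of the surface than an annulus, so the plane without the origin carries a
counterexample as well.

The moves are about sets, the invariant is about loops. The remaining work is topological: a loop
whose double points are crossings must go straight through every crossing of a picture (`straight`),
hence traverse each strand of it exactly once (`Line.follow`, `Strand.exists_translate`). Therefore
the move can be carried out on the loop by changing it during one interval of times
(`exists_replace`). -/

variable {F : Type*}

/-! ### Loops and their double points -/

/-- The time `t` of the loop `g` (of period `1`) is a passage through a double point. -/
def DoubleTime (g : ℝ → F) (t : ℝ) : Prop := ∃ s, g s = g t ∧ ∀ k : ℤ, s ≠ t + k

theorem add_int_of_periodic {g : ℝ → F} (hg : Function.Periodic g 1) (t : ℝ) (k : ℤ) :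
    g (t + k) = g t := by
  simpa using hg.int_mul k t

theorem doubleTime_of_eq {g : ℝ → F} {s t : ℝ} (h : g s = g t) (h' : ∀ k : ℤ, s ≠ t + k) :
    DoubleTime g t ∧ DoubleTime g s := by
  refine ⟨⟨s, h, h'⟩, ⟨t, h.symm, fun k hk => h' (-k) ?_⟩⟩
  rw [hk]; push_cast; ring

theorem not_int_of_abs_lt {s t : ℝ} (hne : s ≠ t) (h : |s - t| < 1) (k : ℤ) : s ≠ t + k := by
  intro hk
  have h1 : s - t = k := by linarith
  rw [h1] at h
  have h2 : |k| < 1 := by exact_mod_cast h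
  have h3 : k = 0 := by simpa [Int.abs_lt_one_iff] using h2
  apply hne; rw [hk, h3]; simp

/-- Near the time `u`, the loop `g` runs on `ℓ`. -/
def RunsOn (g : ℝ → F) (ℓ : Set F) (u : ℝ) : Prop := ∀ᶠ w in 𝓝 u, g w ∈ ℓ

theorem RunsOn.self {g : ℝ → F} {ℓ : Set F} {u : ℝ} (h : RunsOn g ℓ u) : g u ∈ ℓ := h.self_of_nhds

variable [TopologicalSpace F]

/-- Close to `g t`, the complement of the loop splits into two open pieces, one of which contains
the strand of `g` before time `t`, and the other one the strand after time `t`. -/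
def Transverse (g : ℝ → F) (t : ℝ) : Prop :=
  ∃ O₁ O₂ : Set F, IsOpen O₁ ∧ IsOpen O₂ ∧ Disjoint O₁ O₂ ∧ (∀ᶠ w in 𝓝[<] t, g w ∈ O₁) ∧
    (∀ᶠ w in 𝓝[>] t, g w ∈ O₂) ∧ ∀ᶠ q in 𝓝 (g t), q ∉ range g → q ∈ O₁ ∪ O₂

/-- A loop of period `1` with finitely many double points, all of them crossings. -/
structure GenericLoop (g : ℝ → F) : Prop where
  continuous : Continuous g
  periodic : Function.Periodic g 1
  finite : {t ∈ Icc (0 : ℝ) 1 | DoubleTime g t}.Finite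
  transverse : ∀ t, DoubleTime g t → Transverse g t

namespace GenericLoop

variable {g : ℝ → F} (hg : GenericLoop g)
include hg

theorem add_int (t : ℝ) (k : ℤ) : g (t + k) = g t := add_int_of_periodic hg.periodic t k

theorem doubleTime_add_int {t : ℝ} (k : ℤ) (h : DoubleTime g t) : DoubleTime g (t + k) := by
  obtain ⟨s, hs, hk⟩ := h
  refine ⟨s, by rw [hg.add_int, hs], fun m hm => hk (k + m) ?_⟩
  rw [hm]; push_cast; ring

theorem finite_Icc (a b : ℝ) : {t ∈ Icc a b | DoubleTime g t}.Finite := by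
  have h : (⋃ k ∈ Icc ⌊a⌋ ⌊b⌋, (fun t : ℝ => t + (k : ℝ)) '' {t ∈ Icc (0 : ℝ) 1 | DoubleTime g t}).Finite :=
    (Set.finite_Icc _ _).biUnion fun k _ => hg.finite.image _
  refine h.subset ?_
  rintro t ⟨ht, hd⟩
  simp only [mem_iUnion]
  refine ⟨⌊t⌋, ⟨Int.floor_mono ht.1, Int.floor_mono ht.2⟩, Int.fract t, ⟨⟨Int.fract_nonneg t, (Int.fract_lt_one t).le⟩, ?_⟩, ?_⟩
  · have := hg.doubleTime_add_int (-⌊t⌋) hd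
    simpa [Int.fract, sub_eq_add_neg] using this
  · exact Int.fract_add_floor t

theorem eventually_not_doubleTime (u : ℝ) : ∀ᶠ w in 𝓝 u, w ≠ u → ¬ DoubleTime g w := by
  have hf : ({t ∈ Icc (u - 1) (u + 1) | DoubleTime g t} \ {u}).Finite := (hg.finite_Icc _ _).sdiff
  have h1 := hf.isClosed.compl_mem_nhds (x := u) (by simp)
  have h2 : Icc (u - 1) (u + 1) ∈ 𝓝 u := Icc_mem_nhds (by linarith) (by linarith)
  filter_upwards [h1, h2] with w hw hw' hne hd
  exact hw ⟨⟨hw', hd⟩, hne⟩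

/-- Two distinct nearby times with the same value are both double times, but at most one double
time, `u` itself, is close to `u`. -/
theorem exists_injOn (u : ℝ) : ∃ ε > 0, ε ≤ 1 / 2 ∧ InjOn g (Ioo (u - ε) (u + ε)) := by
  obtain ⟨ε, hε, h⟩ := Metric.eventually_nhds_iff.1 (hg.eventually_not_doubleTime u)
  refine ⟨min ε (1 / 2), by positivity, min_le_right _ _, ?_⟩
  intro x hx y hy hxy
  by_contra hne
  have h1 := min_le_left ε (1 / 2)
  have h2 := min_le_right ε (1 / 2)
  obtain ⟨dy, dx⟩ := doubleTime_of_eq hxy (not_int_of_abs_lt hne (by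
    rw [abs_lt]; constructor <;> linarith [hx.1, hx.2, hy.1, hy.2]))
  have key : ∀ w ∈ Ioo (u - min ε (1 / 2)) (u + min ε (1 / 2)), DoubleTime g w → w = u := by
    intro w hw hd
    by_contra hwu
    refine h ?_ hwu hd
    rw [Real.dist_eq, abs_lt]; constructor <;> linarith [hw.1, hw.2]
  exact hne ((key x hx dx).trans (key y hy dy).symm)

theorem eventually_ne (u : ℝ) : ∀ᶠ w in 𝓝 u, w ≠ u → g w ≠ g u := by
  obtain ⟨ε, hε, -, h⟩ := hg.exists_injOn u
  filter_upwards [Ioo_mem_nhds (show u - ε < u by linarith) (show u < u + ε by linarith)] with w hw hne he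
  exact hne (h hw ⟨by linarith, by linarith⟩ he)

end GenericLoop

/-! ### Following a loop along an open arc -/

/-- `ℓ` is an arc without end points, closed in the open set `V`, with the coordinate `X`, whose
inverse is `κ`, and whose values form the open interval `J`. -/
structure Line (V ℓ : Set F) (X : F → ℝ) (κ : ℝ → F) (J : Set ℝ) : Prop where
  subset : ℓ ⊆ V
  closed : ∀ q ∈ V, q ∈ closure ℓ → q ∈ ℓ
  contX : ContinuousOn X ℓ
  openJ : IsOpen J
  ordJ : OrdConnected J
  contκ : ContinuousOn κ J
  mapsκ : MapsTo κ J ℓ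
  mapsX : MapsTo X ℓ J
  left_inv : ∀ x ∈ J, X (κ x) = x
  right_inv : ∀ q ∈ ℓ, κ (X q) = q

/-- The loop `g` runs once along the line `ℓ` during the time interval `(α, β)`, which is maximal
among the intervals in which `g` stays in `V`. -/
structure Strand (g : ℝ → F) (V ℓ : Set F) (X : F → ℝ) (J : Set ℝ) (α β : ℝ) : Prop where
  le : β ≤ α + 1
  notMem_left : g α ∉ V
  notMem_right : g β ∉ V
  mem : ∀ u ∈ Ioo α β, g u ∈ ℓ
  mono : StrictMonoOn (X ∘ g) (Ioo α β) ∨ StrictAntiOn (X ∘ g) (Ioo α β)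
  image : (X ∘ g) '' Ioo α β = J

/-- To be applied to the times `N` that a loop spends outside an open set. The component of the
complement around `u` is bounded by a supremum and an infimum in `N`; by periodicity its length is
at most `1`. -/
theorem exists_component {N : Set ℝ} (hN : IsClosed N) (hper : ∀ t ∈ N, ∀ k : ℤ, t + k ∈ N)
    (hne : N.Nonempty) {u : ℝ} (hu : u ∉ N) :
    ∃ α β, u ∈ Ioo α β ∧ β ≤ α + 1 ∧ α ∈ N ∧ β ∈ N ∧ ∀ w ∈ Ioo α β, w ∉ N := by
  obtain ⟨t, ht⟩ := hne
  have hA : (N ∩ Iic u).Nonempty := by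
    refine ⟨t + ((⌊u - t⌋ : ℤ) : ℝ), hper t ht _, ?_⟩
    have := Int.floor_le (u - t)
    simp only [mem_Iic]; linarith
  have hB : (N ∩ Ici u).Nonempty := by
    refine ⟨t + ((⌈u - t⌉ : ℤ) : ℝ), hper t ht _, ?_⟩
    have := Int.le_ceil (u - t)
    simp only [mem_Ici]; linarith
  have ha := (hN.inter isClosed_Iic).csSup_mem hA ⟨u, fun x hx => hx.2⟩
  have hb := (hN.inter isClosed_Ici).csInf_mem hB ⟨u, fun x hx => hx.2⟩
  set α := sSup (N ∩ Iic u)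
  set β := sInf (N ∩ Ici u)
  have hau : α < u := lt_of_le_of_ne ha.2 fun h => hu (h ▸ ha.1)
  have hub : u < β := lt_of_le_of_ne hb.2 fun h => hu (h ▸ hb.1)
  have h3 : ∀ w ∈ Ioo α β, w ∉ N := by
    intro w hw hwN
    rcases le_total w u with h | h
    · exact absurd (le_csSup (s := N ∩ Iic u) ⟨u, fun x hx => hx.2⟩ ⟨hwN, h⟩) (not_le.2 hw.1)
    · exact absurd (csInf_le (s := N ∩ Ici u) ⟨u, fun x hx => hx.2⟩ ⟨hwN, h⟩) (not_le.2 hw.2)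
  refine ⟨α, β, ⟨hau, hub⟩, ?_, ha.1, hb.1, h3⟩
  by_contra hlt
  have := hper α ha.1 1
  push_cast at this
  exact h3 (α + 1) ⟨by linarith, by linarith⟩ this

/-- A locally injective continuous function on an open interval is strictly monotone. -/
theorem strictMonoOn_or_strictAntiOn_of_locally_injOn {h : ℝ → ℝ} {α β : ℝ}
    (hc : ContinuousOn h (Ioo α β))
    (hi : ∀ u ∈ Ioo α β, ∃ ε > 0, InjOn h (Ioo (u - ε) (u + ε) ∩ Ioo α β)) :
    StrictMonoOn h (Ioo α β) ∨ StrictAntiOn h (Ioo α β) := by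
  rcases le_or_gt β α with hab | hab
  · left; intro x hx; exact absurd (hx.1.trans hx.2) (not_lt.2 hab)
  have inj : InjOn h (Ioo α β) := by
    suffices H : ∀ x ∈ Ioo α β, ∀ y ∈ Ioo α β, x < y → h x ≠ h y by
      intro x hx y hy hxy
      rcases lt_trichotomy x y with hlt | heq | hlt
      · exact absurd hxy (H x hx y hy hlt)
      · exact heq
      · exact absurd hxy.symm (H y hy x hx hlt)
    intro x hx y hy hlt hxy
    have hsub : Icc x y ⊆ Ioo α β := fun w hw => ⟨hx.1.trans_le hw.1, hw.2.trans_lt hy.2⟩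
    -- Equal values at `x < y` would produce an interior local extremum, where the function cannot
    -- be locally injective.
    obtain ⟨c, hc', hext⟩ := exists_isLocalExtr_Ioo hlt (hc.mono hsub) hxy
    have hcI := hsub ⟨hc'.1.le, hc'.2.le⟩
    obtain ⟨ε, hε, hinj⟩ := hi c hcI
    have key : ∃ δ > 0, Icc (c - δ) (c + δ) ⊆ Ioo (c - ε) (c + ε) ∩ Ioo α β ∧
        ((∀ w ∈ Icc (c - δ) (c + δ), h w ≤ h c) ∨ (∀ w ∈ Icc (c - δ) (c + δ), h c ≤ h w)) := by
      have hn : Ioo (c - ε) (c + ε) ∩ Ioo α β ∈ 𝓝 c :=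
        inter_mem (Ioo_mem_nhds (by linarith) (by linarith)) (Ioo_mem_nhds hcI.1 hcI.2)
      rcases hext with hm | hm
      · obtain ⟨δ, hδ, H⟩ := (Metric.nhds_basis_closedBall.mem_iff).1 (inter_mem hn hm)
        rw [Real.closedBall_eq_Icc] at H
        exact ⟨δ, hδ, fun w hw => (H hw).1, Or.inr fun w hw => (H hw).2⟩
      · obtain ⟨δ, hδ, H⟩ := (Metric.nhds_basis_closedBall.mem_iff).1 (inter_mem hn hm)
        rw [Real.closedBall_eq_Icc] at H
        exact ⟨δ, hδ, fun w hw => (H hw).1, Or.inl fun w hw => (H hw).2⟩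
    obtain ⟨δ, hδ, hs, H⟩ := key
    have hs' : Icc (c - δ) (c + δ) ⊆ Ioo α β := fun w hw => (hs hw).2
    have hl : c - δ ∈ Icc (c - δ) (c + δ) := ⟨le_rfl, by linarith⟩
    have hr : c + δ ∈ Icc (c - δ) (c + δ) := ⟨by linarith, le_rfl⟩
    have hm : c ∈ Icc (c - δ) (c + δ) := ⟨by linarith, by linarith⟩
    have inj' : InjOn h (Icc (c - δ) (c + δ)) := hinj.mono hs
    rcases (hc.mono hs').strictMonoOn_of_injOn_Icc' (by linarith) inj' with hmon | hmon
    · have h1 := hmon hl hm (by linarith)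
      have h2 := hmon hm hr (by linarith)
      rcases H with H | H
      · linarith [H _ hr]
      · linarith [H _ hl]
    · have h1 := hmon hl hm (by linarith)
      have h2 := hmon hm hr (by linarith)
      rcases H with H | H
      · linarith [H _ hl]
      · linarith [H _ hr]
  exact ContinuousOn.strictMonoOn_of_injOn_Ioo hab hc inj

variable [T2Space F]

/-- The hypothesis `hstr` says that at a point of the line the loop either runs on the line or only
crosses it at an isolated time. Since the line is closed in `V`, a loop that runs on it cannot stop
doing so before it leaves `V`; and it cannot turn back, as it is locally injective. -/
theorem Line.follow {g : ℝ → F} (hg : GenericLoop g) {V ℓ : Set F} {X : F → ℝ} {κ : ℝ → F}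
    {J : Set ℝ} (hL : Line V ℓ X κ J) (hV : IsOpen V) (hout : ∃ u, g u ∉ V)
    (hstr : ∀ u, g u ∈ ℓ → RunsOn g ℓ u ∨ ∀ᶠ w in 𝓝[≠] u, g w ∉ ℓ)
    {u₀ : ℝ} (h₀ : RunsOn g ℓ u₀) :
    ∃ α β, u₀ ∈ Ioo α β ∧ Strand g V ℓ X J α β := by
  have hN : IsClosed (g ⁻¹' Vᶜ) := hV.isClosed_compl.preimage hg.continuous
  obtain ⟨α, β, hu, hle, hα, hβ, hI⟩ := exists_component hN
    (fun t ht k => by simpa [hg.add_int] using ht) hout (u := u₀) (fun h => h (hL.subset h₀.self))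
  have hIV : ∀ w ∈ Ioo α β, g w ∈ V := fun w hw => not_not.1 (hI w hw)
  -- The set of times running on the line is open; it is also closed in the interval, because at a
  -- limit time the alternative of an isolated crossing is excluded by the times converging to it.
  have hmem : Ioo α β ⊆ interior (g ⁻¹' ℓ) := by
    refine isPreconnected_Ioo.subset_of_closure_inter_subset isOpen_interior
      ⟨u₀, hu, mem_interior_iff_mem_nhds.2 h₀⟩ ?_
    rintro w ⟨hw, hwI⟩
    have hwℓ : g w ∈ ℓ := by
      refine hL.closed _ (hIV w hwI) ?_
      have : w ∈ closure (g ⁻¹' ℓ) := closure_mono interior_subset hw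
      exact closure_mono (image_preimage_subset _ _)
        (image_closure_subset_closure_image hg.continuous ⟨w, this, rfl⟩)
    rcases hstr w hwℓ with h | h
    · exact mem_interior_iff_mem_nhds.2 h
    · by_contra hwi
      rw [mem_closure_iff_frequently] at hw
      rw [eventually_nhdsWithin_iff] at h
      obtain ⟨v, hv, hv'⟩ := (hw.and_eventually h).exists
      by_cases hvw : v = w
      · exact hwi (hvw ▸ hv)
      · exact hv' hvw (interior_subset hv : v ∈ g ⁻¹' ℓ)
  have hmem' : ∀ w ∈ Ioo α β, g w ∈ ℓ := fun w hw => (interior_subset (hmem hw) : w ∈ g ⁻¹' ℓ)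
  have hξ : ContinuousOn (X ∘ g) (Ioo α β) := hL.contX.comp hg.continuous.continuousOn hmem'
  have hmono : StrictMonoOn (X ∘ g) (Ioo α β) ∨ StrictAntiOn (X ∘ g) (Ioo α β) := by
    refine strictMonoOn_or_strictAntiOn_of_locally_injOn hξ fun u hu => ?_
    obtain ⟨ε, hε, -, hinj⟩ := hg.exists_injOn u
    refine ⟨ε, hε, fun x hx y hy hxy => hinj hx.1 hy.1 ?_⟩
    rw [← hL.right_inv _ (hmem' x hx.2), ← hL.right_inv _ (hmem' y hy.2)]
    exact congrArg κ hxy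
  refine ⟨α, β, hu, hle, hα, hβ, hmem', hmono, ?_⟩
  have hsub : (X ∘ g) '' Ioo α β ⊆ J := by
    rintro _ ⟨w, hw, rfl⟩; exact hL.mapsX (hmem' w hw)
  refine hsub.antisymm ?_
  -- The set of attained coordinates is open by monotonicity, and closed in the connected set `J`,
  -- so it is all of `J`.
  refine hL.ordJ.isPreconnected.subset_of_closure_inter_subset ?_
    ⟨(X ∘ g) u₀, hsub ⟨u₀, hu, rfl⟩, u₀, hu, rfl⟩ ?_
  · rw [isOpen_iff_mem_nhds]
    rintro _ ⟨w, hw, rfl⟩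
    have hs : Icc ((α + w) / 2) ((w + β) / 2) ⊆ Ioo α β := fun v hv =>
      ⟨by linarith [hv.1, hw.1], by linarith [hv.2, hw.2]⟩
    have hab : (α + w) / 2 ≤ (w + β) / 2 := by linarith [hw.1, hw.2]
    have hl := hs (left_mem_Icc.2 hab)
    have hr := hs (right_mem_Icc.2 hab)
    rcases hmono with hm | hm
    · refine mem_of_superset (Icc_mem_nhds (hm hl hw (by linarith [hw.1])) (hm hw hr (by linarith [hw.2])))
        ((intermediate_value_Icc hab (hξ.mono hs)).trans (image_mono hs))
    · refine mem_of_superset (Icc_mem_nhds (hm hw hr (by linarith [hw.2])) (hm hl hw (by linarith [hw.1])))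
        ((intermediate_value_Icc' hab (hξ.mono hs)).trans (image_mono hs))
  · rintro x ⟨hx, hxJ⟩
    have hne : (comap (X ∘ g) (𝓝 x) ⊓ 𝓟 (Ioo α β)).NeBot := by
      rw [mem_closure_iff_nhds] at hx
      refine ((comap_hasBasis (X ∘ g) (𝓝 x)).inf_principal _).neBot_iff.2 ?_
      intro S hS
      obtain ⟨_, h1, w, hw, rfl⟩ := hx S hS
      exact ⟨w, h1, hw⟩
    -- Times whose coordinates tend to `x` accumulate at some `e` in `[α, β]`. There `g e = κ x`
    -- lies in `V`, so `e` is not an end of the interval.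
    obtain ⟨U, hU⟩ := Ultrafilter.exists_le (comap (X ∘ g) (𝓝 x) ⊓ 𝓟 (Ioo α β))
    have hUI : Ioo α β ∈ (U : Filter ℝ) := hU (mem_inf_of_right (mem_principal_self _))
    obtain ⟨e, he, hUe⟩ := (isCompact_Icc (a := α) (b := β)).ultrafilter_le_nhds' U
      (mem_of_superset hUI Ioo_subset_Icc_self)
    have hUx : Tendsto (X ∘ g) (U : Filter ℝ) (𝓝 x) := tendsto_iff_comap.2 (hU.trans inf_le_left)
    have h1 : Tendsto (fun w => κ (X (g w))) (U : Filter ℝ) (𝓝 (κ x)) :=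
      ((hL.contκ.continuousAt (hL.openJ.mem_nhds hxJ)).tendsto).comp hUx
    have h2 : Tendsto g (U : Filter ℝ) (𝓝 (κ x)) :=
      h1.congr' (eventually_of_mem hUI fun w hw => hL.right_inv _ (hmem' w hw))
    have h4 : Tendsto g (U : Filter ℝ) (𝓝 (g e)) := hg.continuous.continuousAt.tendsto.mono_left hUe
    have heq : g e = κ x := tendsto_nhds_unique h4 h2
    have heV : g e ∈ V := heq ▸ hL.subset (hL.mapsκ hxJ)
    have heI : e ∈ Ioo α β :=
      ⟨lt_of_le_of_ne he.1 fun h => hα (h ▸ heV), lt_of_le_of_ne he.2 fun h => hβ (h ▸ heV)⟩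
    exact ⟨e, heI, by simp only [Function.comp, heq, hL.left_inv x hxJ]⟩

theorem Strand.injOn {g : ℝ → F} {V ℓ : Set F} {X : F → ℝ} {J : Set ℝ} {α β : ℝ}
    (hS : Strand g V ℓ X J α β) : InjOn (X ∘ g) (Ioo α β) :=
  hS.mono.elim (fun h => h.injOn) fun h => h.injOn

/-- Two strands along the same line are translates of each other. -/
theorem Strand.exists_translate {g : ℝ → F} (hg : GenericLoop g) {V ℓ : Set F} {X : F → ℝ}
    {κ : ℝ → F} {J : Set ℝ} (hL : Line V ℓ X κ J) {α β α' β' : ℝ}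
    (hS : Strand g V ℓ X J α β) (hS' : Strand g V ℓ X J α' β') (hne : α < β) :
    ∃ k : ℤ, α' = α + k ∧ β' = β + k := by
  -- Among the infinitely many times of the strand, some `w` is not a double time. The other strand
  -- takes the value `g w` too, at a time that can only be an integer translate of `w`.
  have hfin := hg.finite_Icc α β
  have hinf : (Ioo α β).Infinite := Ioo_infinite hne
  obtain ⟨w, hw, hwd⟩ : ∃ w ∈ Ioo α β, ¬ DoubleTime g w := by
    by_contra! H
    exact hinf (hfin.subset fun w hw => ⟨Ioo_subset_Icc_self hw, H w hw⟩)
  have h1 : (X ∘ g) w ∈ (X ∘ g) '' Ioo α' β' := by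
    rw [hS'.image, ← hS.image]; exact mem_image_of_mem _ hw
  obtain ⟨v, hv, hvw⟩ := h1
  have h2 : g v = g w := by
    rw [← hL.right_inv _ (hS.mem w hw), ← hL.right_inv _ (hS'.mem v hv)]
    exact congrArg κ hvw
  obtain ⟨k, hk⟩ : ∃ k : ℤ, v = w + k := by
    by_contra! H; exact hwd ⟨v, h2, H⟩
  subst hk
  have e1 : ∀ t ∈ Ioo α β, g t ∈ V := fun t ht => hL.subset (hS.mem t ht)
  have e2 : ∀ t ∈ Ioo α' β', g t ∈ V := fun t ht => hL.subset (hS'.mem t ht)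
  have n1 := hS.notMem_left
  have n2 := hS.notMem_right
  have n3 := hS'.notMem_left
  have n4 := hS'.notMem_right
  have hsub : ∀ t, g (t - k) = g t := fun t => by
    have := hg.add_int (t - k) k; rw [sub_add_cancel] at this; exact this.symm
  refine ⟨k, ?_, ?_⟩
  · rcases lt_trichotomy α' (α + k) with h | h | h
    · exact absurd (e2 (α + k) ⟨h, by linarith [hw.1, hv.2]⟩) (by rwa [hg.add_int])
    · exact h
    · exact absurd (e1 (α' - k) ⟨by linarith, by linarith [hw.2, hv.1]⟩) (by rwa [hsub])
  · rcases lt_trichotomy β' (β + k) with h | h | h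
    · exact absurd (e1 (β' - k) ⟨by linarith [hw.1, hv.2], by linarith⟩) (by rwa [hsub])
    · exact h
    · exact absurd (e2 (β + k) ⟨by linarith [hw.2, hv.1], h⟩) (by rwa [hg.add_int])

/-- Every time at which the loop runs on the line lies in a translate of the strand. -/
theorem Strand.exists_mem {g : ℝ → F} (hg : GenericLoop g) {V ℓ : Set F} {X : F → ℝ}
    {κ : ℝ → F} {J : Set ℝ} (hL : Line V ℓ X κ J) (hV : IsOpen V)
    (hstr : ∀ u, g u ∈ ℓ → RunsOn g ℓ u ∨ ∀ᶠ w in 𝓝[≠] u, g w ∉ ℓ) {α β : ℝ}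
    (hS : Strand g V ℓ X J α β) (hne : α < β) {u : ℝ} (hu : RunsOn g ℓ u) :
    ∃ k : ℤ, u + k ∈ Ioo α β := by
  obtain ⟨α', β', hu', hS'⟩ := hL.follow hg hV ⟨α, hS.notMem_left⟩ hstr hu
  obtain ⟨k, rfl, rfl⟩ := hS.exists_translate hg hL hS' hne
  refine ⟨-k, ?_, ?_⟩ <;> push_cast <;> linarith [hu'.1, hu'.2]

/-- A loop runs along a line only once. -/
theorem Line.eq_add_int {g : ℝ → F} (hg : GenericLoop g) {V ℓ : Set F} {X : F → ℝ}
    {κ : ℝ → F} {J : Set ℝ} (hL : Line V ℓ X κ J) (hV : IsOpen V) (hout : ∃ u, g u ∉ V)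
    (hstr : ∀ u, g u ∈ ℓ → RunsOn g ℓ u ∨ ∀ᶠ w in 𝓝[≠] u, g w ∉ ℓ) {u v : ℝ}
    (hu : RunsOn g ℓ u) (hv : RunsOn g ℓ v) (h : g u = g v) : ∃ k : ℤ, v = u + k := by
  obtain ⟨α, β, huI, hS⟩ := hL.follow hg hV hout hstr hu
  obtain ⟨k, hk⟩ := hS.exists_mem hg hL hV hstr (huI.1.trans huI.2) hv
  have : u = v + k := hS.injOn huI hk (by simp only [Function.comp, hg.add_int, h])
  exact ⟨-k, by rw [this]; push_cast; ring⟩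

/-! ### A loop at a crossing goes straight -/

variable {F : Type*} [TopologicalSpace F] [T2Space F]

theorem exists_sign {f : ℝ → ℝ} {c d : ℝ} (hf : ContinuousOn f (Ioo c d))
    (h0 : ∀ w ∈ Ioo c d, f w ≠ 0) : ∃ σ : ℝ, (σ = 1 ∨ σ = -1) ∧ ∀ w ∈ Ioo c d, 0 < σ * f w := by
  by_cases H : ∃ w ∈ Ioo c d, f w < 0
  · obtain ⟨w, hw, hlt⟩ := H
    refine ⟨-1, Or.inr rfl, fun v hv => ?_⟩
    by_contra hneg
    have : (0 : ℝ) ∈ f '' Ioo c d :=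
      isPreconnected_Ioo.intermediate_value hw hv hf ⟨hlt.le, by linarith⟩
    obtain ⟨x, hx, hx0⟩ := this
    exact h0 x hx hx0
  · push Not at H
    exact ⟨1, Or.inl rfl, fun v hv => by
      have := lt_of_le_of_ne (H v hv) (h0 v hv).symm
      linarith⟩

/-- A path in the union of the coordinate axes that avoids the origin stays on a half-axis. -/
theorem exists_branch {ζ : ℝ → ℝ × ℝ} {c d : ℝ} (hζ : ContinuousOn ζ (Ioo c d))
    (hax : ∀ w ∈ Ioo c d, (ζ w).2 = 0 ∨ (ζ w).1 = 0) (h0 : ∀ w ∈ Ioo c d, ζ w ≠ 0) :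
    ∃ σ : ℝ, (σ = 1 ∨ σ = -1) ∧ ((∀ w ∈ Ioo c d, 0 < σ * (ζ w).1 ∧ (ζ w).2 = 0) ∨
      ∀ w ∈ Ioo c d, 0 < σ * (ζ w).2 ∧ (ζ w).1 = 0) := by
  have c1 : ContinuousOn (fun w => (ζ w).1) (Ioo c d) := continuous_fst.comp_continuousOn hζ
  have c2 : ContinuousOn (fun w => (ζ w).2) (Ioo c d) := continuous_snd.comp_continuousOn hζ
  -- On the axes without the origin, the sign of `x ^ 2 - y ^ 2` tells which axis the point is on.
  obtain ⟨τ, hτ, H⟩ := exists_sign (f := fun w => (ζ w).1 ^ 2 - (ζ w).2 ^ 2)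
    ((c1.pow 2).sub (c2.pow 2)) (by
      intro w hw h
      rcases hax w hw with h' | h'
      · refine h0 w hw (Prod.ext ?_ h')
        simpa [h'] using h
      · refine h0 w hw (Prod.ext h' ?_)
        simpa [h'] using h)
  rcases hτ with rfl | rfl
  · have H2 : ∀ w ∈ Ioo c d, (ζ w).2 = 0 := fun w hw => by
      rcases hax w hw with h | h
      · exact h
      · have := H w hw; simp only [h] at this; nlinarith [sq_nonneg (ζ w).2]
    have H1 : ∀ w ∈ Ioo c d, (ζ w).1 ≠ 0 := fun w hw h => h0 w hw (Prod.ext h (H2 w hw))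
    obtain ⟨σ, hσ, h⟩ := exists_sign c1 H1
    exact ⟨σ, hσ, Or.inl fun w hw => ⟨h w hw, H2 w hw⟩⟩
  · have H2 : ∀ w ∈ Ioo c d, (ζ w).1 = 0 := fun w hw => by
      rcases hax w hw with h | h
      · have := H w hw; simp only [h] at this; nlinarith [sq_nonneg (ζ w).1]
      · exact h
    have H1 : ∀ w ∈ Ioo c d, (ζ w).2 ≠ 0 := fun w hw h => h0 w hw (Prod.ext (H2 w hw) h)
    obtain ⟨σ, hσ, h⟩ := exists_sign c2 H1
    exact ⟨σ, hσ, Or.inr fun w hw => ⟨h w hw, H2 w hw⟩⟩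

theorem sign_mul_self {σ : ℝ} (hσ : σ = 1 ∨ σ = -1) : σ * σ = 1 := by
  rcases hσ with rfl | rfl <;> norm_num

/-- If the loop has a picture that is a cross, with one strand coming in along a half-axis and going
out along a perpendicular one, then it is not transverse. -/
theorem not_turn {χ : ℝ × ℝ → F} (hχ : IsOpenEmbedding χ) {g : ℝ → F} {u : ℝ} (hu : g u = χ 0)
    (hcross : ∀ᶠ z in 𝓝 (0 : ℝ × ℝ), χ z ∈ range g ↔ z.2 = 0 ∨ z.1 = 0)
    (hcont : Continuous g)
    {l₁ l₂ : Filter ℝ} [l₁.NeBot] [l₂.NeBot] (hl₁ : l₁ ≤ 𝓝 u) (hl₂ : l₂ ≤ 𝓝 u) {σ τ : ℝ}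
    (hσ : σ = 1 ∨ σ = -1) (hτ : τ = 1 ∨ τ = -1)
    (h₁ : ∀ᶠ w in l₁, ∃ a, 0 < σ * a ∧ g w = χ (a, 0))
    (h₂ : ∀ᶠ w in l₂, ∃ b, 0 < τ * b ∧ g w = χ (0, b))
    {O₁ O₂ : Set F} (ho₁ : IsOpen O₁) (ho₂ : IsOpen O₂) (hd : Disjoint O₁ O₂)
    (hO₁ : ∀ᶠ w in l₁, g w ∈ O₁) (hO₂ : ∀ᶠ w in l₂, g w ∈ O₂)
    (hO : ∀ᶠ q in 𝓝 (g u), q ∉ range g → q ∈ O₁ ∪ O₂) : False := by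
  rw [hu] at hO
  obtain ⟨r, hr, H⟩ := Metric.eventually_nhds_iff.1
    (hcross.and (hχ.continuous.continuousAt.eventually hO))
  have hdist : ∀ a b : ℝ, |a| < r → |b| < r → dist ((a, b) : ℝ × ℝ) 0 < r := fun a b ha hb => by
    rw [dist_zero_right, Prod.norm_def]
    exact max_lt (by simpa using ha) (by simpa using hb)
  -- `Q` is the open quadrant between the two half-axes. It is connected and misses the loop, so it
  -- lies in `O₁ ∪ O₂`; being adjacent to both half-axes, it meets both of these disjoint open sets.
  let m : ℝ × ℝ → F := fun z => χ (σ * z.1, τ * z.2)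
  have hm : Continuous m := hχ.continuous.comp (by fun_prop)
  let Q : Set F := m '' (Ioo 0 r ×ˢ Ioo 0 r)
  have hQ : IsPreconnected Q := (isPreconnected_Ioo.prod isPreconnected_Ioo).image _ hm.continuousOn
  have hσ0 : σ ≠ 0 := by rcases hσ with rfl | rfl <;> norm_num
  have hτ0 : τ ≠ 0 := by rcases hτ with rfl | rfl <;> norm_num
  have hσa : |σ| = 1 := by rcases hσ with rfl | rfl <;> norm_num
  have hτa : |τ| = 1 := by rcases hτ with rfl | rfl <;> norm_num
  have hQO : Q ⊆ O₁ ∪ O₂ := by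
    rintro _ ⟨⟨a, b⟩, ⟨ha, hb⟩, rfl⟩
    have := H (hdist (σ * a) (τ * b) (by simpa [abs_mul, hσa, abs_of_pos ha.1] using ha.2)
      (by simpa [abs_mul, hτa, abs_of_pos hb.1] using hb.2))
    refine this.2 fun hin => ?_
    rcases this.1.1 hin with h | h
    · exact mul_ne_zero hτ0 hb.1.ne' h
    · exact mul_ne_zero hσ0 ha.1.ne' h
  have hball : ∀ᶠ w in 𝓝 u, g w ∈ χ '' {z | |z.1| < r ∧ |z.2| < r} := by
    refine hcont.continuousAt.eventually ?_
    refine (hχ.isOpenMap _ ?_).mem_nhds ⟨0, by simpa using hr, hu.symm⟩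
    exact (isOpen_lt (continuous_abs.comp continuous_fst) continuous_const).inter
      (isOpen_lt (continuous_abs.comp continuous_snd) continuous_const)
  have hpos : ∀ᶠ b in 𝓝[>] (0 : ℝ), b ∈ Ioo 0 r := Ioo_mem_nhdsGT hr
  have hQ₁ : (Q ∩ O₁).Nonempty := by
    obtain ⟨w, ⟨a, ha, hga⟩, hwO, z, hz, hzw⟩ := (h₁.and (hO₁.and (hball.filter_mono hl₁))).exists
    have hza : z = (a, 0) := hχ.injective (hzw.trans hga)
    subst hza
    have haa : σ * (σ * a) = a := by rw [← mul_assoc, sign_mul_self hσ, one_mul]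
    have hc : ∀ᶠ b in 𝓝[>] (0 : ℝ), m (σ * a, b) ∈ O₁ := by
      refine Filter.Eventually.filter_mono nhdsWithin_le_nhds ?_
      have hcm : Continuous fun b => m (σ * a, b) := hm.comp (by fun_prop)
      refine (hcm.tendsto 0).eventually (ho₁.mem_nhds ?_)
      simpa [m, haa, ← hga] using hwO
    obtain ⟨b, hb, hb'⟩ := (hc.and hpos).exists
    refine ⟨_, ⟨(σ * a, b), ⟨⟨ha, ?_⟩, hb'⟩, rfl⟩, hb⟩
    rw [← abs_of_pos ha, abs_mul, hσa, one_mul]; exact hz.1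
  have hQ₂ : (Q ∩ O₂).Nonempty := by
    obtain ⟨w, ⟨a, ha, hga⟩, hwO, z, hz, hzw⟩ := (h₂.and (hO₂.and (hball.filter_mono hl₂))).exists
    have hza : z = (0, a) := hχ.injective (hzw.trans hga)
    subst hza
    have haa : τ * (τ * a) = a := by rw [← mul_assoc, sign_mul_self hτ, one_mul]
    have hc : ∀ᶠ b in 𝓝[>] (0 : ℝ), m (b, τ * a) ∈ O₂ := by
      refine Filter.Eventually.filter_mono nhdsWithin_le_nhds ?_
      have hcm : Continuous fun b => m (b, τ * a) := hm.comp (by fun_prop)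
      refine (hcm.tendsto 0).eventually (ho₂.mem_nhds ?_)
      simpa [m, haa, ← hga] using hwO
    obtain ⟨b, hb, hb'⟩ := (hc.and hpos).exists
    refine ⟨_, ⟨(b, τ * a), ⟨hb', ha, ?_⟩, rfl⟩, hb⟩
    rw [← abs_of_pos ha, abs_mul, hτa, one_mul]; exact hz.2
  obtain ⟨q, -, hq₁, hq₂⟩ := hQ O₁ O₂ ho₁ ho₂ hQO hQ₁ hQ₂
  exact hd.le_bot ⟨hq₁, hq₂⟩

theorem invFun_apply {χ : ℝ × ℝ → F} (hχ : IsOpenEmbedding χ) (z : ℝ × ℝ) :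
    Function.invFun χ (χ z) = z := Function.leftInverse_invFun hχ.injective z

theorem continuousAt_invFun {χ : ℝ × ℝ → F} (hχ : IsOpenEmbedding χ) (z : ℝ × ℝ) :
    ContinuousAt (Function.invFun χ) (χ z) := by
  rw [← hχ.continuousAt_iff]
  have : Function.invFun χ ∘ χ = id := funext (invFun_apply hχ)
  rw [this]; exact continuousAt_id

theorem continuousOn_invFun {χ : ℝ × ℝ → F} (hχ : IsOpenEmbedding χ) :
    ContinuousOn (Function.invFun χ) (range χ) := by
  rintro _ ⟨z, rfl⟩; exact (continuousAt_invFun hχ z).continuousWithinAt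

/-- If the picture of the loop is a cross but only one strand passes, in two perpendicular
half-axes, then there is a second passage. -/
theorem doubleTime_of_cross {χ : ℝ × ℝ → F} (hχ : IsOpenEmbedding χ) {g : ℝ → F}
    (hg : GenericLoop g) {u : ℝ} (hu : g u = χ 0)
    (hcross : ∀ᶠ z in 𝓝 (0 : ℝ × ℝ), χ z ∈ range g ↔ z.2 = 0 ∨ z.1 = 0)
    {ε : ℝ} (hε : 0 < ε) {e : ℝ × ℝ} (hax : e.2 = 0 ∨ e.1 = 0)
    (hmiss : ∀ w ∈ Ioo (u - ε) (u + ε), ∀ a : ℝ, 0 < a → g w ≠ χ (a • e)) : DoubleTime g u := by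
  by_contra hnd
  -- The points of the missed half-axis are taken at times outside the `ε`-neighbourhood of `u`. By
  -- compactness such times would also avoid a neighbourhood of `χ 0`, unless `χ 0` itself is taken
  -- once more.
  have hK : IsCompact (Icc (u - 1 / 2) (u + 1 / 2) \ Ioo (u - ε) (u + ε)) :=
    isCompact_Icc.diff isOpen_Ioo
  have hgu : g u ∉ g '' (Icc (u - 1 / 2) (u + 1 / 2) \ Ioo (u - ε) (u + ε)) := by
    rintro ⟨w, ⟨hw, hw'⟩, hgw⟩
    have hwu : w ≠ u := by rintro rfl; exact hw' ⟨by linarith, by linarith⟩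
    refine hnd ⟨w, hgw, not_int_of_abs_lt hwu ?_⟩
    rw [abs_lt]; constructor <;> linarith [hw.1, hw.2]
  have hcl := (hK.image hg.continuous).isClosed
  have h1 : ∀ᶠ z in 𝓝 (0 : ℝ × ℝ), χ z ∉ g '' (Icc (u - 1 / 2) (u + 1 / 2) \ Ioo (u - ε) (u + ε)) :=
    hχ.continuous.continuousAt.eventually (hcl.compl_mem_nhds (hu ▸ hgu))
  have h2 : Tendsto (fun a : ℝ => a • e) (𝓝[>] 0) (𝓝 0) := by
    refine Tendsto.mono_left ?_ nhdsWithin_le_nhds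
    have : Continuous (fun a : ℝ => a • e) := by fun_prop
    simpa using this.tendsto 0
  obtain ⟨a, ⟨ha1, ha2⟩, ha⟩ := ((h2.eventually (hcross.and h1)).and self_mem_nhdsWithin).exists
  have hr : χ (a • e) ∈ range g := ha1.2 (hax.imp (fun h => by simp [h]) fun h => by simp [h])
  obtain ⟨w₀, hw₀⟩ := hr
  have hround := abs_le.1 (abs_sub_round (w₀ - u))
  have hw : g (w₀ - round (w₀ - u)) = χ (a • e) := by
    have := hg.add_int w₀ (-round (w₀ - u))
    rw [← hw₀, ← this]; push_cast; ring_nf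
  by_cases hin : w₀ - round (w₀ - u) ∈ Ioo (u - ε) (u + ε)
  · exact hmiss _ hin a ha hw
  · exact ha2 ⟨_, ⟨⟨by linarith [hround.1], by linarith [hround.2]⟩, hin⟩, hw⟩

/-- At a crossing of two lines, the loop runs on one or the other of them. -/
theorem straight {χ : ℝ × ℝ → F} (hχ : IsOpenEmbedding χ) {g : ℝ → F} (hg : GenericLoop g)
    {u : ℝ} (hu : g u = χ 0)
    (hcross : ∀ᶠ z in 𝓝 (0 : ℝ × ℝ), χ z ∈ range g ↔ z.2 = 0 ∨ z.1 = 0) :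
    (∀ᶠ w in 𝓝 u, ∃ a, g w = χ (a, 0)) ∨ ∀ᶠ w in 𝓝 u, ∃ b, g w = χ (0, b) := by
  have h1 : ∀ᶠ w in 𝓝 u, g w ∈ χ '' {z | χ z ∈ range g ↔ z.2 = 0 ∨ z.1 = 0} :=
    hg.continuous.continuousAt.eventually (hu ▸ hχ.isOpenMap.image_mem_nhds hcross)
  obtain ⟨ε, hε, H⟩ := Metric.eventually_nhds_iff.1 (h1.and (hg.eventually_ne u))
  have hI : ∀ w ∈ Ioo (u - ε) (u + ε), g w ∈ χ '' {z | χ z ∈ range g ↔ z.2 = 0 ∨ z.1 = 0} ∧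
      (w ≠ u → g w ≠ g u) := fun w hw => H (by
    rw [Real.dist_eq, abs_lt]; constructor <;> linarith [hw.1, hw.2])
  let ζ : ℝ → ℝ × ℝ := fun w => Function.invFun χ (g w)
  have hζ : ∀ w ∈ Ioo (u - ε) (u + ε), g w = χ (ζ w) ∧ ((ζ w).2 = 0 ∨ (ζ w).1 = 0) ∧
      (w ≠ u → ζ w ≠ 0) := by
    intro w hw
    obtain ⟨⟨z, hz, hzw⟩, hne⟩ := hI w hw
    have hzeta : ζ w = z := by simp only [ζ, ← hzw, invFun_apply hχ]
    rw [hzeta]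
    refine ⟨hzw.symm, Iff.mp hz ⟨w, hzw.symm⟩, fun h h0 => hne h ?_⟩
    rw [← hzw, h0, hu]
  have hcont : ContinuousOn ζ (Ioo (u - ε) (u + ε)) :=
    (continuousOn_invFun hχ).comp hg.continuous.continuousOn fun w hw => ⟨ζ w, (hζ w hw).1.symm⟩
  have sl : Ioo (u - ε) u ⊆ Ioo (u - ε) (u + ε) := Ioo_subset_Ioo_right (by linarith)
  have sr : Ioo u (u + ε) ⊆ Ioo (u - ε) (u + ε) := Ioo_subset_Ioo_left (by linarith)
  obtain ⟨σ, hσ, hl⟩ := exists_branch (hcont.mono sl) (fun w hw => (hζ w (sl hw)).2.1)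
    fun w hw => (hζ w (sl hw)).2.2 hw.2.ne
  obtain ⟨τ, hτ, hr⟩ := exists_branch (hcont.mono sr) (fun w hw => (hζ w (sr hw)).2.1)
    fun w hw => (hζ w (sr hw)).2.2 hw.1.ne'
  have hmem : Ioo (u - ε) (u + ε) ∈ 𝓝 u := Ioo_mem_nhds (by linarith) (by linarith)
  have hmemL : ∀ᶠ w in 𝓝[<] u, w ∈ Ioo (u - ε) u := Ioo_mem_nhdsLT (by linarith)
  have hmemR : ∀ᶠ w in 𝓝[>] u, w ∈ Ioo u (u + ε) := Ioo_mem_nhdsGT (by linarith)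
  have hu0 : ζ u = 0 := by simp only [ζ, hu, invFun_apply hχ]
  have tri : ∀ w ∈ Ioo (u - ε) (u + ε), w ∈ Ioo (u - ε) u ∨ w = u ∨ w ∈ Ioo u (u + ε) := by
    intro w hw
    rcases lt_trichotomy w u with h | h | h
    · exact Or.inl ⟨hw.1, h⟩
    · exact Or.inr (Or.inl h)
    · exact Or.inr (Or.inr ⟨h, hw.2⟩)
  have pos1 : ∀ {σ : ℝ}, (σ = 1 ∨ σ = -1) → ∀ {a : ℝ}, 0 < a → ¬ 0 < σ * (a * -σ) := by
    rintro σ (rfl | rfl) a ha h <;> linarith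
  rcases hl with hl | hl <;> rcases hr with hr | hr
  · left
    filter_upwards [hmem] with w hw
    refine ⟨(ζ w).1, (hζ w hw).1.trans (congrArg χ (Prod.ext rfl ?_))⟩
    rcases tri w hw with h | rfl | h
    · exact (hl w h).2
    · rw [hu0]; rfl
    · exact (hr w h).2
  · exfalso
    -- If the loop turns from one axis to the other, it misses the half-axis opposite to the one it
    -- comes in along. So `u` is a double time, transversality is available, and `not_turn` applies.
    have hd : DoubleTime g u := by
      refine doubleTime_of_cross hχ hg hu hcross hε (e := (-σ, 0))
        (Or.inl rfl) fun w hw a ha hgw => ?_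
      have hz : ζ w = (a * -σ, 0) := by simp [ζ, hgw, invFun_apply hχ]
      rcases tri w hw with h | rfl | h
      · have := (hl w h).1; rw [hz] at this; exact pos1 hσ ha this
      · rw [hu0] at hz
        have := congrArg Prod.fst hz
        rcases hσ with rfl | rfl <;> simp at this <;> linarith
      · have := (hr w h).1; rw [hz] at this; simp at this
    obtain ⟨O₁, O₂, o1, o2, hdis, hO1, hO2, hO⟩ := hg.transverse u hd
    exact not_turn hχ hu hcross hg.continuous nhdsWithin_le_nhds nhdsWithin_le_nhds hσ hτ
      (hmemL.mono fun w hw => ⟨_, (hl w hw).1, (hζ w (sl hw)).1.trans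
        (congrArg χ (Prod.ext rfl (hl w hw).2))⟩)
      (hmemR.mono fun w hw => ⟨_, (hr w hw).1, (hζ w (sr hw)).1.trans
        (congrArg χ (Prod.ext (hr w hw).2 rfl))⟩) o1 o2 hdis hO1 hO2 hO
  · exfalso
    have hd : DoubleTime g u := by
      refine doubleTime_of_cross hχ hg hu hcross hε (e := (0, -σ))
        (Or.inr rfl) fun w hw a ha hgw => ?_
      have hz : ζ w = (0, a * -σ) := by simp [ζ, hgw, invFun_apply hχ]
      rcases tri w hw with h | rfl | h
      · have := (hl w h).1; rw [hz] at this; exact pos1 hσ ha this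
      · rw [hu0] at hz
        have := congrArg Prod.snd hz
        rcases hσ with rfl | rfl <;> simp at this <;> linarith
      · have := (hr w h).1; rw [hz] at this; simp at this
    obtain ⟨O₁, O₂, o1, o2, hdis, hO1, hO2, hO⟩ := hg.transverse u hd
    exact not_turn hχ hu hcross hg.continuous nhdsWithin_le_nhds nhdsWithin_le_nhds hτ hσ
      (hmemR.mono fun w hw => ⟨_, (hr w hw).1, (hζ w (sr hw)).1.trans
        (congrArg χ (Prod.ext rfl (hr w hw).2))⟩)
      (hmemL.mono fun w hw => ⟨_, (hl w hw).1, (hζ w (sl hw)).1.trans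
        (congrArg χ (Prod.ext (hl w hw).2 rfl))⟩) o2 o1 hdis.symm hO2 hO1
        (hO.mono fun q hq h => (hq h).symm)
  · right
    filter_upwards [hmem] with w hw
    refine ⟨(ζ w).2, (hζ w hw).1.trans (congrArg χ (Prod.ext ?_ rfl))⟩
    rcases tri w hw with h | rfl | h
    · exact (hl w h).2
    · rw [hu0]; rfl
    · exact (hr w h).2

/-- A loop that passes an axis of a cross in one direction is transverse there. -/
theorem transverse_of_cross {χ : ℝ × ℝ → F} (hχ : IsOpenEmbedding χ) {g : ℝ → F} {u : ℝ}
    (hu : g u = χ 0) (hcross : ∀ᶠ z in 𝓝 (0 : ℝ × ℝ), z.1 = 0 → χ z ∈ range g) {σ : ℝ}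
    (hl : ∀ᶠ w in 𝓝[<] u, ∃ a, 0 < σ * a ∧ g w = χ (a, 0))
    (hr : ∀ᶠ w in 𝓝[>] u, ∃ a, σ * a < 0 ∧ g w = χ (a, 0)) : Transverse g u := by
  refine ⟨χ '' {z | 0 < σ * z.1}, χ '' {z | σ * z.1 < 0},
    hχ.isOpenMap _ (isOpen_lt continuous_const (continuous_const.mul continuous_fst)),
    hχ.isOpenMap _ (isOpen_lt (continuous_const.mul continuous_fst) continuous_const), ?_, ?_, ?_, ?_⟩
  · rw [disjoint_image_iff hχ.injective, Set.disjoint_left]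
    intro z (hz : 0 < σ * z.1) (hz' : σ * z.1 < 0)
    exact lt_asymm hz hz'
  · exact hl.mono fun w ⟨a, ha, h⟩ => ⟨(a, 0), ha, h.symm⟩
  · exact hr.mono fun w ⟨a, ha, h⟩ => ⟨(a, 0), ha, h.symm⟩
  -- Only the signs of `σ * a` are given; `σ = 0` is impossible since `hl` holds at some time.
  · have hσ : σ ≠ 0 := by
      rintro rfl
      obtain ⟨w, a, ha, -⟩ := hl.exists
      simp at ha
    rw [hu]
    filter_upwards [hχ.isOpenMap.image_mem_nhds hcross]
    rintro _ ⟨z, hz, rfl⟩ hn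
    have h1 : z.1 ≠ 0 := fun h => hn (hz h)
    rcases lt_or_gt_of_ne (mul_ne_zero hσ h1) with h | h
    · exact Or.inr ⟨z, h, rfl⟩
    · exact Or.inl ⟨z, h, rfl⟩

/-- The affine change of coordinates that maps the axes to the lines of slopes `σ` and `-σ` through
the point `v`. -/
noncomputable def cornerHomeo (v : ℝ × ℝ) (σ : ℝ) (hσ : σ = 1 ∨ σ = -1) : ℝ × ℝ ≃ₜ ℝ × ℝ where
  toFun z := (v.1 + z.1 + z.2, v.2 + σ * (z.1 - z.2))
  invFun z := ((z.1 - v.1 + σ * (z.2 - v.2)) / 2, (z.1 - v.1 - σ * (z.2 - v.2)) / 2)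
  left_inv z := by rcases hσ with rfl | rfl <;> ext <;> simp <;> ring
  right_inv z := by rcases hσ with rfl | rfl <;> ext <;> simp <;> ring
  continuous_toFun := by fun_prop
  continuous_invFun := by fun_prop

/-! ### Pictures consisting of graphs of functions -/

variable {F : Type*} [TopologicalSpace F] [T2Space F]

/-- In the open set `V` of the plane, finitely many graphs of functions, any two of which intersect
in straight crossings with slopes `1` and `-1`, without triple points. -/
structure GraphPicture {ι : Type*} (V : Set (ℝ × ℝ)) (f : ι → ℝ → ℝ) : Prop where
  isOpen : IsOpen V
  cont : ∀ i, Continuous (f i)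
  ord : ∀ i, OrdConnected {x | (x, f i x) ∈ V}
  cross : ∀ i j, i ≠ j → ∀ x, (x, f i x) ∈ V → f i x = f j x → ∃ σ : ℝ, (σ = 1 ∨ σ = -1) ∧
    (∀ᶠ y in 𝓝 x, f i y = f i x + σ * (y - x) ∧ f j y = f i x - σ * (y - x)) ∧
    ∀ k, k ≠ i → k ≠ j → f k x ≠ f i x

/-- The part of the graph of `h` in `V`. -/
def graphIn (V : Set (ℝ × ℝ)) (h : ℝ → ℝ) : Set (ℝ × ℝ) := {z ∈ V | z.2 = h z.1}

/-- The first coordinate in the chart `φ`. -/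
noncomputable def absc (φ : ℝ × ℝ → F) (q : F) : ℝ := (Function.invFun φ q).1

theorem absc_apply {φ : ℝ × ℝ → F} (hφ : IsOpenEmbedding φ) (z : ℝ × ℝ) : absc φ (φ z) = z.1 := by
  rw [absc, invFun_apply hφ]

variable {ι : Type*} {V : Set (ℝ × ℝ)} {f : ι → ℝ → ℝ}

theorem line_graph {φ : ℝ × ℝ → F} (hφ : IsOpenEmbedding φ) (hV : IsOpen V) {h : ℝ → ℝ}
    (hc : Continuous h) (ho : OrdConnected {x | (x, h x) ∈ V}) :
    Line (φ '' V) (φ '' graphIn V h) (absc φ) (fun x => φ (x, h x)) {x | (x, h x) ∈ V} where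
  subset := image_mono fun z hz => hz.1
  closed := by
    rintro _ ⟨z, hz, rfl⟩ hcl
    refine ⟨z, ⟨hz, ?_⟩, rfl⟩
    have h1 : z ∈ closure (graphIn V h) := by
      rw [hφ.isEmbedding.closure_eq_preimage_closure_image]; exact hcl
    exact (isClosed_eq continuous_snd (hc.comp continuous_fst)).closure_subset_iff.2
      (fun w (hw : w ∈ graphIn V h) => hw.2) h1
  contX := (continuous_fst.comp_continuousOn (continuousOn_invFun hφ)).mono
    (image_subset_range _ _)
  openJ := hV.preimage (continuous_id.prodMk hc)
  ordJ := ho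
  contκ := (hφ.continuous.comp (continuous_id.prodMk hc)).continuousOn
  mapsκ := fun x hx => ⟨_, ⟨hx, rfl⟩, rfl⟩
  mapsX := by
    rintro _ ⟨z, ⟨hz, hz'⟩, rfl⟩
    rw [absc_apply hφ]
    have : ((z.1, h z.1) : ℝ × ℝ) = z := Prod.ext rfl hz'.symm
    exact this.symm ▸ hz
  left_inv := fun x _ => absc_apply hφ _
  right_inv := by
    rintro _ ⟨z, ⟨hz, hz'⟩, rfl⟩
    rw [absc_apply hφ]
    exact congrArg φ (Prod.ext rfl hz'.symm)

/-- At a crossing, `cornerHomeo` turns the two graphs into the coordinate axes and `straight`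
decides which of them the loop follows; if it follows the other one, it leaves graph `i` at once.
Away from crossings no other graph is near. -/
theorem GraphPicture.local_cases [Finite ι] (hf : GraphPicture V f) {φ : ℝ × ℝ → F}
    (hφ : IsOpenEmbedding φ) {g : ℝ → F} (hg : GenericLoop g)
    (hP : ∀ z ∈ V, φ z ∈ range g ↔ ∃ i, z.2 = f i z.1) {u : ℝ} {i : ι}
    (hu : g u ∈ φ '' graphIn V (f i)) :
    RunsOn g (φ '' graphIn V (f i)) u ∨
    ∃ j, j ≠ i ∧ g u ∈ φ '' graphIn V (f j) ∧ RunsOn g (φ '' graphIn V (f j)) u ∧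
      ∀ᶠ w in 𝓝[≠] u, g w ∉ φ '' graphIn V (f i) := by
  obtain ⟨z, ⟨hzV, hz⟩, hzu⟩ := hu
  have hgu : Tendsto g (𝓝 u) (𝓝 (φ z)) := hzu ▸ hg.continuous.continuousAt
  have hnear : ∀ (p : ℝ × ℝ → Prop), (∀ᶠ z' in 𝓝 z, p z') → ∀ᶠ w in 𝓝 u, ∃ z', p z' ∧ φ z' = g w :=
    fun p hp => hgu.eventually (hφ.isOpenMap.image_mem_nhds hp)
  have hVz : ∀ᶠ z' in 𝓝 z, z' ∈ V := hf.isOpen.mem_nhds hzV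
  have hzeq : ((z.1, f i z.1) : ℝ × ℝ) = z := Prod.ext rfl hz.symm
  by_cases H : ∃ j, j ≠ i ∧ f j z.1 = f i z.1
  · obtain ⟨j, hji, hj⟩ := H
    obtain ⟨σ, hσ, hslope, hk⟩ := hf.cross i j hji.symm z.1 (hzeq.symm ▸ hzV) hj.symm
    have hothers : ∀ᶠ z' in 𝓝 z, ∀ k, k ≠ i → k ≠ j → z'.2 ≠ f k z'.1 := by
      rw [eventually_all]
      intro k
      by_cases hki : k = i
      · exact Eventually.of_forall fun _ h => absurd hki h
      by_cases hkj : k = j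
      · exact Eventually.of_forall fun _ _ h => absurd hkj h
      have hne : z.2 ≠ f k z.1 := by rw [hz]; exact (hk k hki hkj).symm
      have := (isOpen_ne_fun continuous_snd ((hf.cont k).comp continuous_fst)).mem_nhds hne
      exact Eventually.mono this fun _ h _ _ => h
    have hsl : ∀ᶠ z' in 𝓝 z, f i z'.1 = f i z.1 + σ * (z'.1 - z.1) ∧ f j z'.1 = f i z.1 - σ * (z'.1 - z.1) :=
      (continuous_fst.tendsto z).eventually hslope
    let c := cornerHomeo z σ hσ
    have hc0 : c 0 = z := by simp [c, cornerHomeo]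
    have hct : Tendsto c (𝓝 0) (𝓝 z) := by
      have := c.continuous.tendsto 0; rwa [hc0] at this
    have hχ : IsOpenEmbedding (φ ∘ c) := hφ.comp c.isOpenEmbedding
    have hσσ := sign_mul_self hσ
    have hσ0 : σ ≠ 0 := by rintro rfl; simp at hσσ
    have hci : ∀ a b : ℝ, (c (a, b)).1 = z.1 + a + b ∧ (c (a, b)).2 = f i z.1 + σ * (a - b) :=
      fun a b => ⟨rfl, by rw [← hz]; rfl⟩
    have hcross : ∀ᶠ z' in 𝓝 (0 : ℝ × ℝ), (φ ∘ c) z' ∈ range g ↔ z'.2 = 0 ∨ z'.1 = 0 := by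
      filter_upwards [hct.eventually (hVz.and (hothers.and hsl))] with ⟨a, b⟩ ⟨h1, h2, h3⟩
      rw [Function.comp, hP _ h1]
      rw [(hci a b).1] at h3
      constructor
      · rintro ⟨k, hk'⟩
        rw [(hci a b).1] at hk'
        by_cases hki : k = i
        · subst hki
          rw [(hci a b).2, h3.1] at hk'
          left
          have : σ * b = 0 := by linarith
          exact (mul_eq_zero.1 this).resolve_left hσ0
        by_cases hkj : k = j
        · subst hkj
          rw [(hci a b).2, h3.2] at hk'
          right
          have : σ * a = 0 := by linarith
          exact (mul_eq_zero.1 this).resolve_left hσ0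
        · exact absurd (by rw [(hci a b).1]; exact hk') (h2 k hki hkj)
      · rintro (h | h)
        · refine ⟨i, ?_⟩
          simp only at h
          rw [(hci a b).1, (hci a b).2, h3.1, h]; ring
        · refine ⟨j, ?_⟩
          simp only at h
          rw [(hci a b).1, (hci a b).2, h3.2, h]; ring
    have hne := hg.eventually_ne u
    rcases straight hχ hg (by rw [Function.comp, hc0, hzu]) hcross with h | h
    · left
      filter_upwards [h, hnear _ (hVz.and hsl)] with w ⟨a, ha⟩ ⟨z', ⟨h1, h2⟩, h3⟩
      have hz' : z' = c (a, 0) := hφ.injective (h3.trans ha)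
      refine ⟨z', ⟨h1, ?_⟩, h3⟩
      rw [h2.1, hz', (hci a 0).1, (hci a 0).2]; ring
    · right
      refine ⟨j, hji, ⟨z, ⟨hzV, by rw [hz, hj]⟩, hzu⟩, ?_, ?_⟩
      · filter_upwards [h, hnear _ (hVz.and hsl)] with w ⟨b, hb⟩ ⟨z', ⟨h1, h2⟩, h3⟩
        have hz' : z' = c (0, b) := hφ.injective (h3.trans hb)
        refine ⟨z', ⟨h1, ?_⟩, h3⟩
        rw [h2.2, hz', (hci 0 b).1, (hci 0 b).2]; ring
      · rw [eventually_nhdsWithin_iff]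
        filter_upwards [h, hnear _ (hVz.and hsl), hne] with w ⟨b, hb⟩ ⟨z', ⟨h1, h2⟩, h3⟩ h4 hwu
        rintro ⟨z'', ⟨h5, h6⟩, h7⟩
        have hz' : z' = c (0, b) := hφ.injective (h3.trans hb)
        have hz'' : z'' = z' := hφ.injective (h7.trans h3.symm)
        rw [hz'', h2.1, hz', (hci 0 b).1, (hci 0 b).2] at h6
        have hb0 : σ * b = 0 := by linarith
        have hb0' : b = 0 := (mul_eq_zero.1 hb0).resolve_left hσ0
        refine h4 hwu ?_
        rw [hb, hb0', ← hzu, Function.comp]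
        exact congrArg φ hc0
  · left
    push Not at H
    have hothers : ∀ᶠ z' in 𝓝 z, ∀ k, k ≠ i → z'.2 ≠ f k z'.1 := by
      rw [eventually_all]
      intro k
      by_cases hki : k = i
      · exact Eventually.of_forall fun _ h => absurd hki h
      have hne : z.2 ≠ f k z.1 := by rw [hz]; exact (H k hki).symm
      have := (isOpen_ne_fun continuous_snd ((hf.cont k).comp continuous_fst)).mem_nhds hne
      exact Eventually.mono this fun _ h _ => h
    filter_upwards [hnear _ (hVz.and hothers)] with w ⟨z', ⟨h1, h2⟩, h3⟩
    obtain ⟨k, hk⟩ := (hP z' h1).1 ⟨w, h3.symm⟩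
    by_cases hki : k = i
    · exact ⟨z', ⟨h1, hki ▸ hk⟩, h3⟩
    · exact absurd hk (h2 k hki)

section

variable [Finite ι] (hf : GraphPicture V f) {φ : ℝ × ℝ → F}
    (hφ : IsOpenEmbedding φ) {g : ℝ → F} (hg : GenericLoop g)
    (hP : ∀ z ∈ V, φ z ∈ range g ↔ ∃ i, z.2 = f i z.1)
include hf hφ hg hP

/-- This supplies the hypothesis `hstr` of `Line.follow` for each graph. -/
theorem GraphPicture.runsOn_or {i : ι} (u : ℝ) (hu : g u ∈ φ '' graphIn V (f i)) :
    RunsOn g (φ '' graphIn V (f i)) u ∨ ∀ᶠ w in 𝓝[≠] u, g w ∉ φ '' graphIn V (f i) :=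
  (hf.local_cases hφ hg hP hu).imp_right fun ⟨_, _, _, _, h⟩ => h

theorem GraphPicture.exists_runsOn {u : ℝ} (hu : g u ∈ φ '' V) :
    ∃ i, RunsOn g (φ '' graphIn V (f i)) u := by
  obtain ⟨z, hz, hzu⟩ := hu
  obtain ⟨i, hi⟩ := (hP z hz).1 ⟨u, hzu.symm⟩
  rcases hf.local_cases hφ hg hP (i := i) ⟨z, ⟨hz, hi⟩, hzu⟩ with h | ⟨j, -, -, h, -⟩
  · exact ⟨i, h⟩
  · exact ⟨j, h⟩

/-- There is a strand along each of the graphs of the picture. -/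
theorem GraphPicture.exists_strand (hout : ∃ u, g u ∉ φ '' V) (i : ι) {x : ℝ} (hx : (x, f i x) ∈ V)
    (hx' : ∀ j, j ≠ i → f j x ≠ f i x) :
    ∃ α β, α < β ∧ Strand g (φ '' V) (φ '' graphIn V (f i)) (absc φ) {x | (x, f i x) ∈ V} α β := by
  obtain ⟨u, hu⟩ := (hP _ hx).2 ⟨i, rfl⟩
  have hu' : g u ∈ φ '' graphIn V (f i) := ⟨_, ⟨hx, rfl⟩, hu.symm⟩
  rcases hf.local_cases hφ hg hP hu' with h | ⟨j, hj, ⟨z, ⟨-, hz⟩, hzu⟩, -⟩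
  · obtain ⟨α, β, hI, hS⟩ := (line_graph hφ hf.isOpen (hf.cont i) (hf.ord i)).follow hg
      (hφ.isOpenMap _ hf.isOpen) hout (hf.runsOn_or hφ hg hP) h
    exact ⟨α, β, hI.1.trans hI.2, hS⟩
  · have : z = (x, f i x) := hφ.injective (hzu.trans hu)
    exact absurd (by simpa [this] using hz.symm) (hx' j hj)

theorem GraphPicture.exists_mem {i : ι} {α β : ℝ}
    (hS : Strand g (φ '' V) (φ '' graphIn V (f i)) (absc φ) {x | (x, f i x) ∈ V} α β) (hne : α < β)
    {u : ℝ} (hu : RunsOn g (φ '' graphIn V (f i)) u) : ∃ k : ℤ, u + k ∈ Ioo α β :=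
  hS.exists_mem hg (line_graph hφ hf.isOpen (hf.cont i) (hf.ord i)) (hφ.isOpenMap _ hf.isOpen)
    (hf.runsOn_or hφ hg hP) hne hu

end

theorem Strand.apply_eq {φ : ℝ × ℝ → F} (hφ : IsOpenEmbedding φ) {g : ℝ → F} {W : Set F}
    {h : ℝ → ℝ} {J : Set ℝ} {α β : ℝ} (hS : Strand g W (φ '' graphIn V h) (absc φ) J α β) {u : ℝ}
    (hu : u ∈ Ioo α β) : g u = φ (absc φ (g u), h (absc φ (g u))) := by
  obtain ⟨z, ⟨-, hz⟩, hzu⟩ := hS.mem u hu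
  rw [← hzu, absc_apply hφ, ← hz]

/-- Two monotone traversals of crossing graphs are transverse. -/
theorem transverse_of_graph {φ : ℝ × ℝ → F} (hφ : IsOpenEmbedding φ) {g : ℝ → F} {u : ℝ}
    {h₁ h₂ : ℝ → ℝ} {x : ℝ} {ξ : ℝ → ℝ} {a b : ℝ} (hu : u ∈ Ioo a b) (hξu : ξ u = x)
    (hξ : StrictMonoOn ξ (Ioo a b) ∨ StrictAntiOn ξ (Ioo a b)) (hξc : ContinuousAt ξ u)
    (hgξ : ∀ w ∈ Ioo a b, g w = φ (ξ w, h₁ (ξ w)))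
    {σ : ℝ} (hσ : σ = 1 ∨ σ = -1)
    (hslope : ∀ᶠ y in 𝓝 x, h₁ y = h₁ x + σ * (y - x) ∧ h₂ y = h₁ x - σ * (y - x))
    (h₂g : ∀ᶠ y in 𝓝 x, φ (y, h₂ y) ∈ range g) : Transverse g u := by
  let c := cornerHomeo (x, h₁ x) σ hσ
  have hχ : IsOpenEmbedding (φ ∘ c) := hφ.comp c.isOpenEmbedding
  have hu0 : g u = (φ ∘ c) 0 := by
    rw [hgξ u hu, hξu]; simp [c, cornerHomeo]
  have hcross : ∀ᶠ z in 𝓝 (0 : ℝ × ℝ), z.1 = 0 → (φ ∘ c) z ∈ range g := by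
    have ht : Tendsto (fun z : ℝ × ℝ => x + z.2) (𝓝 0) (𝓝 x) := by
      have : Continuous (fun z : ℝ × ℝ => x + z.2) := by fun_prop
      simpa using this.tendsto 0
    filter_upwards [ht.eventually (hslope.and h₂g)] with z ⟨h1, h2⟩ hz
    have : (φ ∘ c) z = φ (x + z.2, h₂ (x + z.2)) := by
      rw [h1.2, Function.comp]
      congr 1
      simp [c, cornerHomeo, hz]; ring
    rw [this]; exact h2
  have hI : Ioo a b ∈ 𝓝 u := Ioo_mem_nhds hu.1 hu.2
  have hform : ∀ᶠ w in 𝓝 u, g w = (φ ∘ c) (ξ w - x, 0) := by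
    filter_upwards [hI, hξc.eventually (hξu.symm ▸ hslope)] with w hw h1
    rw [hgξ w hw, h1.1, Function.comp, hξu]
    congr 1
    simp [c, cornerHomeo]
  have hL : ∀ᶠ w in 𝓝[<] u, w ∈ Ioo a u := Ioo_mem_nhdsLT hu.1
  have hR : ∀ᶠ w in 𝓝[>] u, w ∈ Ioo u b := Ioo_mem_nhdsGT hu.2
  have hform' := fun s => hform.filter_mono (nhdsWithin_le_nhds (s := s))
  rcases hξ with hm | hm
  · refine transverse_of_cross hχ hu0 hcross (σ := -1) ?_ ?_
    · filter_upwards [hL, hform' _] with w hw h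
      refine ⟨_, ?_, h⟩
      have := hm ⟨hw.1, hw.2.trans hu.2⟩ hu hw.2
      linarith
    · filter_upwards [hR, hform' _] with w hw h
      refine ⟨_, ?_, h⟩
      have := hm hu ⟨hu.1.trans hw.1, hw.2⟩ hw.1
      linarith
  · refine transverse_of_cross hχ hu0 hcross (σ := 1) ?_ ?_
    · filter_upwards [hL, hform' _] with w hw h
      refine ⟨_, ?_, h⟩
      have := hm ⟨hw.1, hw.2.trans hu.2⟩ hu hw.2
      linarith
    · filter_upwards [hR, hform' _] with w hw h
      refine ⟨_, ?_, h⟩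
      have := hm hu ⟨hu.1.trans hw.1, hw.2⟩ hw.1
      linarith

/-! ### Arc systems on the circle -/

variable {F : Type*}

/-- The closed arc of `ℝ / ℤ` from `a.1` to `a.2`, as a periodic subset of the line. -/
def Arc (a : ℝ × ℝ) : Set ℝ := {x | ∃ k : ℤ, a.1 ≤ x + k ∧ x + k ≤ a.2}

/-- The integer translates of the interval `[a, b]`. -/
def Zone (a b : ℝ) : Set ℝ := {x | ∃ k : ℤ, x + k ∈ Icc a b}

/-- A choice of one of the two arcs of the circle at each double point of the loop `g`, such that
the chosen arcs cover the circle, but no six of them do. -/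
structure ArcSystem (g : ℝ → F) (L : Set (ℝ × ℝ)) : Prop where
  lt : ∀ a ∈ L, a.1 < a.2
  lt_add_one : ∀ a ∈ L, a.2 < a.1 + 1
  eq : ∀ a ∈ L, g a.1 = g a.2
  choice : ∀ s t, s < t → t < s + 1 → g s = g t → (s, t) ∈ L ∨ (t, s + 1) ∈ L
  cover : ∀ x, ∃ a ∈ L, x ∈ Arc a
  not_cover : ∀ w : Fin 6 → ℝ × ℝ, (∀ i, w i ∈ L) → ∃ x, ∀ i, x ∉ Arc (w i)

theorem add_int_mem_Arc {a : ℝ × ℝ} {x : ℝ} (h : x ∈ Arc a) (k : ℤ) : x + k ∈ Arc a := by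
  obtain ⟨m, h1, h2⟩ := h
  refine ⟨m - k, ?_, ?_⟩ <;> push_cast <;> linarith

theorem add_int_mem_Arc_iff {a : ℝ × ℝ} {x : ℝ} (k : ℤ) : x + k ∈ Arc a ↔ x ∈ Arc a := by
  refine ⟨fun h => ?_, fun h => add_int_mem_Arc h k⟩
  have := add_int_mem_Arc h (-k)
  simpa using this

theorem Arc_add_int (s t : ℝ) (k : ℤ) : Arc (s + k, t + k) = Arc (s, t) := by
  ext x
  constructor
  · rintro ⟨m, h1, h2⟩
    refine ⟨m - k, ?_, ?_⟩ <;> push_cast <;> simp only at * <;> linarith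
  · rintro ⟨m, h1, h2⟩
    refine ⟨m + k, ?_, ?_⟩ <;> push_cast <;> simp only at * <;> linarith

theorem add_int_mem_Zone {a b x : ℝ} (h : x ∈ Zone a b) (k : ℤ) : x + k ∈ Zone a b := by
  obtain ⟨m, h1, h2⟩ := h
  refine ⟨m - k, ?_, ?_⟩ <;> push_cast <;> linarith

theorem add_int_mem_Zone_iff {a b x : ℝ} (k : ℤ) : x + k ∈ Zone a b ↔ x ∈ Zone a b := by
  refine ⟨fun h => ?_, fun h => add_int_mem_Zone h k⟩
  have := add_int_mem_Zone h (-k)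
  simpa using this

theorem mem_Zone_of_mem {a b x : ℝ} (h : x ∈ Icc a b) : x ∈ Zone a b := ⟨0, by simpa using h⟩

theorem int_lt_of_real {k : ℤ} {n : ℤ} (h : (k : ℝ) < n) : k < n := by exact_mod_cast h

/-- Within a period, membership in an arc. -/
theorem mem_Arc_iff {o s t x : ℝ} (hs : o ≤ s) (ht : t < o + 1) (hx : o ≤ x)
    (hx' : x < o + 1) : x ∈ Arc (s, t) ↔ s ≤ x ∧ x ≤ t := by
  constructor
  · rintro ⟨k, h1, h2⟩
    simp only at h1 h2
    have hk1 : k < 1 := int_lt_of_real (by push_cast; linarith)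
    have hk2 : -1 < k := int_lt_of_real (by push_cast; linarith)
    have : k = 0 := by omega
    subst this
    simp only [Int.cast_zero, add_zero] at h1 h2
    exact ⟨h1, h2⟩
  · exact fun h => ⟨0, by simpa using h.1, by simpa using h.2⟩

/-- The complementary arc wraps around the end of the period: the translate by `1` accounts for the
times before `s`, the translate by `0` for those after `t`. -/
theorem mem_Arc_compl_iff {o s t x : ℝ} (hs : o ≤ s) (hst : s < t) (ht : t < o + 1) (hx : o ≤ x)
    (hx' : x < o + 1) : x ∈ Arc (t, s + 1) ↔ x ≤ s ∨ t ≤ x := by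
  constructor
  · rintro ⟨k, h1, h2⟩
    simp only at h1 h2
    have hk1 : k < 2 := int_lt_of_real (by push_cast; linarith)
    have hk2 : -1 < k := int_lt_of_real (by push_cast; linarith)
    have : k = 0 ∨ k = 1 := by omega
    rcases this with rfl | rfl
    · right; simpa using h1
    · left; push_cast at h2; linarith
  · rintro (h | h)
    · exact ⟨1, by push_cast; linarith, by push_cast; linarith⟩
    · exact ⟨0, by simpa using h, by simp only; push_cast; linarith⟩

theorem exists_add_int_mem_Ico (o x : ℝ) : ∃ k : ℤ, o ≤ x + k ∧ x + k < o + 1 := by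
  refine ⟨-⌊x - o⌋, ?_, ?_⟩ <;> push_cast <;> linarith [Int.floor_le (x - o), Int.lt_floor_add_one (x - o)]

/-- To cover the circle, it suffices to cover a fundamental domain. -/
theorem cover_of_Ico {ι : Type*} (o : ℝ) {w : ι → ℝ × ℝ}
    (h : ∀ x, o ≤ x → x < o + 1 → ∃ i, x ∈ Arc (w i)) (x : ℝ) : ∃ i, x ∈ Arc (w i) := by
  obtain ⟨k, h1, h2⟩ := exists_add_int_mem_Ico o x
  obtain ⟨i, hi⟩ := h _ h1 h2
  exact ⟨i, (add_int_mem_Arc_iff k).1 hi⟩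

/-- The arc `a` has no end in the interval `[c, d]`. -/
def NoEnd (a : ℝ × ℝ) (c d : ℝ) : Prop := a.1 ∉ Zone c d ∧ a.2 ∉ Zone c d

/-- An arc without end in an interval contains it or avoids it. -/
theorem NoEnd.subset {a : ℝ × ℝ} {c d : ℝ} (h : NoEnd a c d) {x y : ℝ} (hx : x ∈ Icc c d)
    (hy : y ∈ Icc c d) (hxa : x ∈ Arc a) : y ∈ Arc a := by
  obtain ⟨k, h1, h2⟩ := hxa
  refine ⟨k, ?_, ?_⟩
  · by_contra! H
    exact h.1 ⟨-k, by push_cast; linarith [hx.1, hy.1], by push_cast; linarith [hx.2, hy.2]⟩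
  · by_contra! H
    exact h.2 ⟨-k, by push_cast; linarith [hx.1, hy.1], by push_cast; linarith [hx.2, hy.2]⟩

theorem NoEnd.zone_subset {a : ℝ × ℝ} {c d : ℝ} (h : NoEnd a c d) {x : ℝ} (hx : x ∈ Icc c d)
    (hxa : x ∈ Arc a) : Zone c d ⊆ Arc a := by
  rintro y ⟨k, hk⟩
  exact (add_int_mem_Arc_iff k).1 (h.subset hx hk hxa)

namespace ArcSystem

variable {g : ℝ → F} {L : Set (ℝ × ℝ)} (hL : ArcSystem g L)
include hL

/-- Two arcs do not cover. -/
theorem not_cover_two {a b : ℝ × ℝ} (ha : a ∈ L) (hb : b ∈ L) (h : ∀ x, x ∈ Arc a ∨ x ∈ Arc b) :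
    False := by
  -- Six arcs need not be distinct, so two arcs are repeated three times.
  obtain ⟨x, hx⟩ := hL.not_cover ![a, b, a, b, a, b] (by
    intro i; fin_cases i <;> assumption)
  rcases h x with h | h
  · exact hx 0 h
  · exact hx 1 h

/-- Complementary arcs are not both chosen. -/
theorem not_both {a b : ℝ × ℝ} (ha : a ∈ L) (hb : b ∈ L) {s t : ℝ} (hst : s < t)
    (hts : t < s + 1) (hA : Arc a = Arc (s, t)) (hB : Arc b = Arc (t, s + 1)) : False := by
  refine hL.not_cover_two ha hb fun x => ?_
  rw [hA, hB]
  obtain ⟨k, h1, h2⟩ := exists_add_int_mem_Ico s x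
  rw [← add_int_mem_Arc_iff k, ← add_int_mem_Arc_iff (a := (t, s + 1)) k,
    mem_Arc_iff le_rfl hts h1 h2, mem_Arc_compl_iff le_rfl hst hts h1 h2]
  rcases le_total (x + k) t with h | h
  · exact Or.inl ⟨h1, h⟩
  · exact Or.inr (Or.inr h)

end ArcSystem

/-- Both intervals have lengths strictly between `0` and `1`, so if their ends agree modulo `1`, the
two integers involved agree. -/
theorem sub_eq_of_int {s t p q : ℝ} (hst : s < t) (hst' : t < s + 1) (hpq : p < q)
    (hpq' : q < p + 1) {k m : ℤ} (hs : s = p + k) (ht : t = q + m) : t = q + k := by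
  have h1 : m - k < 1 := int_lt_of_real (by push_cast; linarith)
  have h2 : -1 < m - k := int_lt_of_real (by push_cast; linarith)
  have : m = k := by omega
  rw [ht, this]

/-! Kinks -/

/-- The times `[a₀, a₁]` of the loop `g` do not belong to double points. -/
def Plain (g : ℝ → F) (a₀ a₁ : ℝ) : Prop :=
  ∀ u ∈ Icc a₀ a₁, ∀ v, g u = g v → ∃ k : ℤ, v = u + k

/-- Within the times `[a₀, a₁]` the loop `g` only has one double point, with times `s`, `t`. -/
structure Kinked (g : ℝ → F) (a₀ a₁ s t : ℝ) : Prop where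
  lt₁ : a₀ < s
  lt₂ : s < t
  lt₃ : t < a₁
  lt₄ : a₁ < a₀ + 1
  eq : g s = g t
  only : ∀ u ∈ Icc a₀ a₁, ∀ v, g u = g v →
    ∃ k : ℤ, v = u + k ∨ (u = s ∧ v = t + k) ∨ (u = t ∧ v = s + k)

/-- The ends of a chosen arc have the same image. They are not congruent modulo `1`, since the
length of the arc lies strictly between `0` and `1`. -/
theorem ArcSystem.noEnd_of_plain {g : ℝ → F} {L : Set (ℝ × ℝ)} (hL : ArcSystem g L)
    (hper : Function.Periodic g 1) {a₀ a₁ : ℝ} (h : Plain g a₀ a₁) {a : ℝ × ℝ} (ha : a ∈ L) :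
    NoEnd a a₀ a₁ := by
  have h1 := hL.lt a ha
  have h2 := hL.lt_add_one a ha
  constructor
  · rintro ⟨k, hk⟩
    obtain ⟨m, hm⟩ := h _ hk a.2 (by rw [add_int_of_periodic hper, hL.eq a ha])
    have e1 : k + m < 1 := int_lt_of_real (by push_cast; linarith)
    have e2 : 0 < k + m := int_lt_of_real (by push_cast; linarith)
    omega
  · rintro ⟨k, hk⟩
    obtain ⟨m, hm⟩ := h _ hk a.1 (by rw [add_int_of_periodic hper, hL.eq a ha])
    have e1 : k + m < 0 := int_lt_of_real (by push_cast; linarith)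
    have e2 : -1 < k + m := int_lt_of_real (by push_cast; linarith)
    omega

theorem Kinked.end_cases {g : ℝ → F} (hper : Function.Periodic g 1) {a₀ a₁ s t : ℝ}
    (h : Kinked g a₀ a₁ s t) {u v : ℝ} (huv : u < v) (hvu : v < u + 1) (hg : g u = g v)
    (hu : u ∈ Zone a₀ a₁ ∨ v ∈ Zone a₀ a₁) :
    ∃ k : ℤ, (u = s + k ∧ v = t + k) ∨ (u = t + k ∧ v = s + 1 + k) := by
  have h1 := h.lt₁
  have h2 := h.lt₂
  have h3 := h.lt₃
  have h4 := h.lt₄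
  have key : ∀ k m : ℤ, (u = s + k ∧ v = t + m) ∨ (u = t + k ∧ v = s + m) → 
      ∃ k : ℤ, (u = s + k ∧ v = t + k) ∨ (u = t + k ∧ v = s + 1 + k) := by
    rintro k m (⟨e1, e2⟩ | ⟨e1, e2⟩)
    · exact ⟨k, Or.inl ⟨e1, sub_eq_of_int huv hvu h2 (by linarith) e1 e2⟩⟩
    · refine ⟨k, Or.inr ⟨e1, sub_eq_of_int (m := m - 1) huv hvu (by linarith) (by linarith) e1 ?_⟩⟩
      rw [e2]; push_cast; ring
  rcases hu with ⟨k, hk⟩ | ⟨k, hk⟩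
  · obtain ⟨m, hm | ⟨e1, e2⟩ | ⟨e1, e2⟩⟩ := h.only _ hk v (by rw [add_int_of_periodic hper, hg])
    · have e1 : k + m < 1 := int_lt_of_real (by push_cast; linarith)
      have e2 : 0 < k + m := int_lt_of_real (by push_cast; linarith)
      omega
    · exact key (-k) m (Or.inl ⟨by push_cast; linarith, e2⟩)
    · exact key (-k) m (Or.inr ⟨by push_cast; linarith, e2⟩)
  · obtain ⟨m, hm | ⟨e1, e2⟩ | ⟨e1, e2⟩⟩ := h.only _ hk u (by rw [add_int_of_periodic hper, hg])
    · have e1 : k + m < 0 := int_lt_of_real (by push_cast; linarith)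
      have e2 : -1 < k + m := int_lt_of_real (by push_cast; linarith)
      omega
    · exact key m (-k) (Or.inr ⟨e2, by push_cast; linarith⟩)
    · exact key m (-k) (Or.inl ⟨e2, by push_cast; linarith⟩)

/-- The arcs `[s, t]` of the new kink are added. Some old arc `d` contains `a₀`; having no end in
`[a₀, a₁]`, it contains this whole interval, hence `[s, t]`. So in a cover by six arcs every new arc
may be replaced by `d`. -/
theorem ArcSystem.insert_kink {g g' : ℝ → F} {L : Set (ℝ × ℝ)} (hL : ArcSystem g L)
    (hper : Function.Periodic g 1) (hper' : Function.Periodic g' 1) {a₀ a₁ s t : ℝ}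
    (h : Plain g a₀ a₁) (h' : Kinked g' a₀ a₁ s t) (hoff : ∀ u, u ∉ Zone a₀ a₁ → g' u = g u) :
    ∃ L', ArcSystem g' L' := by
  have h1 := h'.lt₁
  have h2 := h'.lt₂
  have h3 := h'.lt₃
  have h4 := h'.lt₄
  have hno : ∀ a ∈ L, NoEnd a a₀ a₁ := fun a ha => hL.noEnd_of_plain hper h ha
  refine ⟨L ∪ {a | ∃ k : ℤ, a = (s + k, t + k)}, ?_, ?_, ?_, ?_, ?_, ?_⟩
  · rintro a (ha | ⟨k, rfl⟩)
    · exact hL.lt a ha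
    · simpa using h2
  · rintro a (ha | ⟨k, rfl⟩)
    · exact hL.lt_add_one a ha
    · simp only; linarith
  · rintro a (ha | ⟨k, rfl⟩)
    · rw [hoff _ (hno a ha).1, hoff _ (hno a ha).2, hL.eq a ha]
    · simp only [add_int_of_periodic hper', h'.eq]
  · intro u v huv hvu hg
    by_cases hz : u ∈ Zone a₀ a₁ ∨ v ∈ Zone a₀ a₁
    · obtain ⟨k, ⟨e1, e2⟩ | ⟨e1, e2⟩⟩ := h'.end_cases hper' huv hvu hg hz
      · left; right; exact ⟨k, by rw [e1, e2]⟩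
      · right; right; refine ⟨k + 1, ?_⟩
        rw [e1, e2]; push_cast; ext <;> simp only <;> ring
    · push Not at hz
      rw [hoff _ hz.1, hoff _ hz.2] at hg
      exact (hL.choice u v huv hvu hg).imp Or.inl Or.inl
  · intro x
    obtain ⟨a, ha, hx⟩ := hL.cover x
    exact ⟨a, Or.inl ha, hx⟩
  · intro w hw
    obtain ⟨d, hd, hxd⟩ := hL.cover a₀
    have hzone := (hno d hd).zone_subset ⟨le_rfl, by linarith⟩ hxd
    classical
    obtain ⟨x, hx⟩ := hL.not_cover (fun i => if w i ∈ L then w i else d) (by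
      intro i; split_ifs with hi <;> assumption)
    refine ⟨x, fun i hi => ?_⟩
    have hxi := hx i
    split_ifs at hxi with hwi
    · exact hxi hi
    · rcases hw i with h5 | ⟨k, hk⟩
      · exact hwi h5
      · rw [hk, Arc_add_int] at hi
        obtain ⟨m, hm1, hm2⟩ := hi
        exact hxi (hzone ⟨m, by simp only at hm1; linarith, by simp only at hm2; linarith⟩)

/-- The arcs with ends at the kink are dropped. They are translates of the short arc only, and the
interval `[a₀, a₁]` is covered without it: `a₀` lies in no short arc, and an arc that contains `a₀`
and has no end in the interval contains all of it. -/
theorem ArcSystem.remove_kink {g g' : ℝ → F} {L : Set (ℝ × ℝ)} (hL : ArcSystem g L)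
    (hper : Function.Periodic g 1) (hper' : Function.Periodic g' 1) {a₀ a₁ s t : ℝ}
    (h : Kinked g a₀ a₁ s t) (h' : Plain g' a₀ a₁) (hoff : ∀ u, u ∉ Zone a₀ a₁ → g' u = g u) :
    ∃ L', ArcSystem g' L' := by
  have h1 := h.lt₁
  have h2 := h.lt₂
  have h3 := h.lt₃
  have h4 := h.lt₄
  have hends : ∀ a ∈ L, NoEnd a a₀ a₁ ∨ Arc a = Arc (s, t) ∨ Arc a = Arc (t, s + 1) := by
    intro a ha
    by_cases hz : a.1 ∈ Zone a₀ a₁ ∨ a.2 ∈ Zone a₀ a₁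
    · right
      obtain ⟨k, ⟨e1, e2⟩ | ⟨e1, e2⟩⟩ := h.end_cases hper (hL.lt a ha) (hL.lt_add_one a ha) (hL.eq a ha) hz
      · left; rw [← Arc_add_int s t k, ← e1, ← e2]
      · right; rw [← Arc_add_int t (s + 1) k, ← e1, ← e2]
    · push Not at hz; exact Or.inl hz
  have memst : ∀ x ∈ Icc a₀ a₁, (x ∈ Arc (s, t) ↔ s ≤ x ∧ x ≤ t) := fun x hx =>
    mem_Arc_iff h1.le (by linarith) hx.1 (by linarith [hx.2])
  have memts : ∀ x ∈ Icc a₀ a₁, (x ∈ Arc (t, s + 1) ↔ x ≤ s ∨ t ≤ x) := fun x hx =>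
    mem_Arc_compl_iff h1.le h2 (by linarith) hx.1 (by linarith [hx.2])
  -- If the long arc were chosen, it would form a cover together with an arc `d` through the middle
  -- of the monogon, since `d` contains `[s, t]`.
  have small : ∀ a ∈ L, Arc a ≠ Arc (t, s + 1) := by
    intro b hb hbA
    have hmid : (s + t) / 2 ∈ Icc a₀ a₁ := ⟨by linarith, by linarith⟩
    obtain ⟨d, hd, hxd⟩ := hL.cover ((s + t) / 2)
    have hcov : Icc s t ⊆ Arc d := by
      rcases hends d hd with h5 | h5 | h5
      · intro x hx
        exact h5.zone_subset hmid hxd (mem_Zone_of_mem ⟨by linarith [hx.1], by linarith [hx.2]⟩)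
      · intro x hx
        rw [h5, memst x ⟨by linarith [hx.1], by linarith [hx.2]⟩]; exact hx
      · rw [h5, memts _ hmid] at hxd
        rcases hxd with h | h <;> linarith
    refine hL.not_cover_two hb hd fun x => ?_
    obtain ⟨k, e1, e2⟩ := exists_add_int_mem_Ico s x
    rw [← add_int_mem_Arc_iff k, ← add_int_mem_Arc_iff (a := d) k, hbA,
      mem_Arc_compl_iff le_rfl h2 (by linarith) e1 e2]
    rcases le_total (x + k) t with h | h
    · exact Or.inr (hcov ⟨e1, h⟩)
    · exact Or.inl (Or.inr h)
  refine ⟨{a ∈ L | NoEnd a a₀ a₁}, fun a ha => hL.lt a ha.1, fun a ha => hL.lt_add_one a ha.1, ?_,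
    ?_, ?_, ?_⟩
  · intro a ha
    rw [hoff _ ha.2.1, hoff _ ha.2.2, hL.eq a ha.1]
  · intro u v huv hvu hg
    have hz : ∀ u v, u < v → v < u + 1 → g' u = g' v → u ∉ Zone a₀ a₁ ∧ v ∉ Zone a₀ a₁ := by
      intro u v huv hvu hg
      constructor
      · rintro ⟨k, hk⟩
        obtain ⟨m, hm⟩ := h' _ hk v (by rw [add_int_of_periodic hper', hg])
        have e1 : k + m < 1 := int_lt_of_real (by push_cast; linarith)
        have e2 : 0 < k + m := int_lt_of_real (by push_cast; linarith)
        omega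
      · rintro ⟨k, hk⟩
        obtain ⟨m, hm⟩ := h' _ hk u (by rw [add_int_of_periodic hper', hg])
        have e1 : k + m < 0 := int_lt_of_real (by push_cast; linarith)
        have e2 : -1 < k + m := int_lt_of_real (by push_cast; linarith)
        omega
    obtain ⟨hu, hv⟩ := hz u v huv hvu hg
    have hu1 : u + 1 ∉ Zone a₀ a₁ := by
      have := add_int_mem_Zone_iff (a := a₀) (b := a₁) (x := u) 1
      push_cast at this; rwa [this]
    rw [hoff _ hu, hoff _ hv] at hg
    exact (hL.choice u v huv hvu hg).imp (fun h => ⟨h, hu, hv⟩) fun h => ⟨h, hv, hu1⟩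
  · have hmem₀ : a₀ ∈ Icc a₀ a₁ := ⟨le_rfl, by linarith⟩
    intro x
    by_cases hx : x ∈ Zone a₀ a₁
    · obtain ⟨d, hd, hxd⟩ := hL.cover a₀
      rcases hends d hd with h5 | h5 | h5
      · exact ⟨d, ⟨hd, h5⟩, h5.zone_subset hmem₀ hxd hx⟩
      · rw [h5, memst _ hmem₀] at hxd; linarith [hxd.1]
      · exact absurd h5 (small d hd)
    · obtain ⟨d, hd, hxd⟩ := hL.cover x
      rcases hends d hd with h5 | h5 | h5
      · exact ⟨d, ⟨hd, h5⟩, hxd⟩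
      · rw [h5] at hxd
        obtain ⟨m, hm1, hm2⟩ := hxd
        simp only at hm1 hm2
        exact absurd ⟨m, by linarith, by linarith⟩ hx
      · exact absurd h5 (small d hd)
  · intro w hw
    exact hL.not_cover w fun i => (hw i).1

/-! Triangles -/

/-- The times `[a₀, a₁]`, `[b₀, b₁]`, `[c₀, c₁]`, in this order on the circle, contain the times of
the double points `p`, `q`, `r`. -/
structure TriOrder (a₀ a₁ b₀ b₁ c₀ c₁ pa pb qb qc rc ra : ℝ) : Prop where
  mem_pa : pa ∈ Ioo a₀ a₁
  mem_ra : ra ∈ Ioo a₀ a₁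
  mem_pb : pb ∈ Ioo b₀ b₁
  mem_qb : qb ∈ Ioo b₀ b₁
  mem_qc : qc ∈ Ioo c₀ c₁
  mem_rc : rc ∈ Ioo c₀ c₁
  ab : a₁ < b₀
  bc : b₁ < c₀
  ca : c₁ < a₀ + 1

/-- The only double points within the times `[a₀, a₁]`, `[b₀, b₁]`, `[c₀, c₁]` are one double point
between any two of these strands. -/
structure Triangle (g : ℝ → F) (a₀ a₁ b₀ b₁ c₀ c₁ pa pb qb qc rc ra : ℝ) : Prop
    extends TriOrder a₀ a₁ b₀ b₁ c₀ c₁ pa pb qb qc rc ra where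
  eq_p : g pa = g pb
  eq_q : g qb = g qc
  eq_r : g rc = g ra
  onlyA : ∀ u ∈ Icc a₀ a₁, ∀ v, g u = g v →
    ∃ k : ℤ, v = u + k ∨ (u = pa ∧ v = pb + k) ∨ (u = ra ∧ v = rc + k)
  onlyB : ∀ u ∈ Icc b₀ b₁, ∀ v, g u = g v →
    ∃ k : ℤ, v = u + k ∨ (u = pb ∧ v = pa + k) ∨ (u = qb ∧ v = qc + k)
  onlyC : ∀ u ∈ Icc c₀ c₁, ∀ v, g u = g v →
    ∃ k : ℤ, v = u + k ∨ (u = qc ∧ v = qb + k) ∨ (u = rc ∧ v = ra + k)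

/-- The cyclic order of the strands has no distinguished start. Moving the first strand forward by a
period allows the free gap to be placed last. -/
theorem Triangle.rotate {g : ℝ → F} (hper : Function.Periodic g 1)
    {a₀ a₁ b₀ b₁ c₀ c₁ pa pb qb qc rc ra : ℝ}
    (h : Triangle g a₀ a₁ b₀ b₁ c₀ c₁ pa pb qb qc rc ra) :
    Triangle g b₀ b₁ c₀ c₁ (a₀ + 1) (a₁ + 1) qb qc rc (ra + 1) (pa + 1) pb := by
  have h1 := h.ab
  have h2 := h.bc
  have h3 := h.ca
  refine ⟨⟨h.mem_qb, h.mem_pb, h.mem_qc, h.mem_rc, ?_, ?_, h.bc, h.ca, by linarith⟩, h.eq_q, ?_, ?_, ?_, ?_, ?_⟩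
  · exact ⟨by linarith [h.mem_ra.1], by linarith [h.mem_ra.2]⟩
  · exact ⟨by linarith [h.mem_pa.1], by linarith [h.mem_pa.2]⟩
  · rw [hper, h.eq_r]
  · rw [hper, h.eq_p]
  · intro u hu v hg
    obtain ⟨k, e | ⟨e1, e2⟩ | ⟨e1, e2⟩⟩ := h.onlyB u hu v hg
    · exact ⟨k, Or.inl e⟩
    · exact ⟨k - 1, Or.inr (Or.inr ⟨e1, by rw [e2]; push_cast; ring⟩)⟩
    · exact ⟨k, Or.inr (Or.inl ⟨e1, e2⟩)⟩
  · intro u hu v hg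
    obtain ⟨k, e | ⟨e1, e2⟩ | ⟨e1, e2⟩⟩ := h.onlyC u hu v hg
    · exact ⟨k, Or.inl e⟩
    · exact ⟨k, Or.inr (Or.inl ⟨e1, e2⟩)⟩
    · exact ⟨k - 1, Or.inr (Or.inr ⟨e1, by rw [e2]; push_cast; ring⟩)⟩
  · intro u hu v hg
    have hu' : u - 1 ∈ Icc a₀ a₁ := ⟨by linarith [hu.1], by linarith [hu.2]⟩
    have hp1 : g (u - 1) = g v := by rw [← hg, ← hper (u - 1)]; congr 1; ring
    obtain ⟨k, e | ⟨e1, e2⟩ | ⟨e1, e2⟩⟩ := h.onlyA _ hu' v hp1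
    · exact ⟨k - 1, Or.inl (by rw [e]; push_cast; ring)⟩
    · exact ⟨k, Or.inr (Or.inr ⟨by linarith, e2⟩)⟩
    · exact ⟨k, Or.inr (Or.inl ⟨by linarith, e2⟩)⟩

/-- The arc `a` has no ends in the three intervals. -/
def Off (a : ℝ × ℝ) (a₀ a₁ b₀ b₁ c₀ c₁ : ℝ) : Prop :=
  NoEnd a a₀ a₁ ∧ NoEnd a b₀ b₁ ∧ NoEnd a c₀ c₁

section Triangle

variable {a₀ a₁ b₀ b₁ c₀ c₁ pa pb qb qc rc ra pa' pb' qb' qc' rc' ra' : ℝ}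

/-- All arcs of the cover that end at crossings of the triangle are replaced by copies of a single
arc `e`. Outside the strands, `r` covers the gaps AB and BC, while `p` and `q` cover one of them
each; so `e = r` can replace `r'`, or `p'` and `q'` together. The strands themselves are covered
because an arc without ends in a strand contains it as soon as it contains one of its points. -/
theorem TriOrder.transfer (h : TriOrder a₀ a₁ b₀ b₁ c₀ c₁ pa pb qb qc rc ra)
    (h' : TriOrder a₀ a₁ b₀ b₁ c₀ c₁ pa' pb' qb' qc' rc' ra') {p q r : ℝ × ℝ}
    (hp : Arc p = Arc (pa, pb)) (hq : Arc q = Arc (qb, qc)) (hr : Arc r = Arc (ra, rc))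
    {ι : Type*} (w' : ι → ℝ × ℝ)
    (hw : ∀ i, Off (w' i) a₀ a₁ b₀ b₁ c₀ c₁ ∨ Arc (w' i) = Arc (pa', pb') ∨
      Arc (w' i) = Arc (qb', qc') ∨ Arc (w' i) = Arc (ra', rc'))
    (hc : ∀ x, ∃ i, x ∈ Arc (w' i)) :
    ∃ w : ι → ℝ × ℝ, (∀ i, (w i = w' i ∧ Off (w' i) a₀ a₁ b₀ b₁ c₀ c₁) ∨ w i = p ∨ w i = q ∨ w i = r) ∧
      ∀ x, ∃ i, x ∈ Arc (w i) := by
  classical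
  obtain ⟨⟨x1, x2⟩, ⟨x3, x4⟩, ⟨x5, x6⟩, ⟨x7, x8⟩, ⟨x9, x10⟩, ⟨x11, x12⟩, x13, x14, x15⟩ := h
  obtain ⟨⟨y1, y2⟩, ⟨y3, y4⟩, ⟨y5, y6⟩, ⟨y7, y8⟩, ⟨y9, y10⟩, ⟨y11, y12⟩, -, -, -⟩ := h'
  have mp : ∀ x, a₀ ≤ x → x < a₀ + 1 → (x ∈ Arc (pa, pb) ↔ pa ≤ x ∧ x ≤ pb) := fun x =>
    mem_Arc_iff (by linarith) (by linarith)
  have mq : ∀ x, a₀ ≤ x → x < a₀ + 1 → (x ∈ Arc (qb, qc) ↔ qb ≤ x ∧ x ≤ qc) := fun x =>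
    mem_Arc_iff (by linarith) (by linarith)
  have mr : ∀ x, a₀ ≤ x → x < a₀ + 1 → (x ∈ Arc (ra, rc) ↔ ra ≤ x ∧ x ≤ rc) := fun x =>
    mem_Arc_iff (by linarith) (by linarith)
  have mp' : ∀ x, a₀ ≤ x → x < a₀ + 1 → (x ∈ Arc (pa', pb') ↔ pa' ≤ x ∧ x ≤ pb') := fun x =>
    mem_Arc_iff (by linarith) (by linarith)
  have mq' : ∀ x, a₀ ≤ x → x < a₀ + 1 → (x ∈ Arc (qb', qc') ↔ qb' ≤ x ∧ x ≤ qc') := fun x =>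
    mem_Arc_iff (by linarith) (by linarith)
  have mr' : ∀ x, a₀ ≤ x → x < a₀ + 1 → (x ∈ Arc (ra', rc') ↔ ra' ≤ x ∧ x ≤ rc') := fun x =>
    mem_Arc_iff (by linarith) (by linarith)
  let uP : Prop := ∃ i, Arc (w' i) = Arc (pa', pb')
  let uQ : Prop := ∃ i, Arc (w' i) = Arc (qb', qc')
  let uR : Prop := ∃ i, Arc (w' i) = Arc (ra', rc')
  let e : ℝ × ℝ := if uR ∨ (uP ∧ uQ) then r else if uP then p else q
  have he : e = p ∨ e = q ∨ e = r := by
    simp only [e]; split_ifs <;> simp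
  let w : ι → ℝ × ℝ := fun i => if Off (w' i) a₀ a₁ b₀ b₁ c₀ c₁ then w' i else e
  have hwoff : ∀ i, Off (w' i) a₀ a₁ b₀ b₁ c₀ c₁ → w i = w' i := fun i hi => if_pos hi
  refine ⟨w, fun i => ?_, cover_of_Ico a₀ fun x hx1 hx2 => ?_⟩
  · by_cases hi : Off (w' i) a₀ a₁ b₀ b₁ c₀ c₁
    · exact Or.inl ⟨hwoff i hi, hi⟩
    · right; simp only [w, if_neg hi]; exact he
  -- Every arc `p'`, `q'`, `r'` starts after `a₀` and ends before `c₁`. So these two times are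
  -- covered by arcs without ends in the strands, which settles the strands A and C.
  have zA : ∃ i, ∀ y ∈ Icc a₀ a₁, y ∈ Arc (w i) := by
    obtain ⟨i, hi⟩ := hc a₀
    rcases hw i with h5 | h5 | h5 | h5
    · exact ⟨i, fun y hy => by rw [hwoff i h5]; exact h5.1.subset ⟨le_rfl, by linarith⟩ hy hi⟩
    · rw [h5, mp' _ le_rfl (by linarith)] at hi; linarith [hi.1]
    · rw [h5, mq' _ le_rfl (by linarith)] at hi; linarith [hi.1]
    · rw [h5, mr' _ le_rfl (by linarith)] at hi; linarith [hi.1]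
  have zC : ∃ i, ∀ y ∈ Icc c₀ c₁, y ∈ Arc (w i) := by
    obtain ⟨i, hi⟩ := hc c₁
    rcases hw i with h5 | h5 | h5 | h5
    · exact ⟨i, fun y hy => by rw [hwoff i h5]; exact h5.2.2.subset ⟨by linarith, le_rfl⟩ hy hi⟩
    · rw [h5, mp' _ (by linarith) (by linarith)] at hi; linarith [hi.2]
    · rw [h5, mq' _ (by linarith) (by linarith)] at hi; linarith [hi.2]
    · rw [h5, mr' _ (by linarith) (by linarith)] at hi; linarith [hi.2]
  obtain ⟨i, hi⟩ := hc x
  by_cases hioff : Off (w' i) a₀ a₁ b₀ b₁ c₀ c₁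
  · exact ⟨i, by rw [hwoff i hioff]; exact hi⟩
  have hwi : w i = e := if_neg hioff
  have hxi := (hw i).resolve_left hioff
  by_cases hxA : x ≤ a₁
  · obtain ⟨j, hj⟩ := zA; exact ⟨j, hj x ⟨hx1, hxA⟩⟩
  by_cases hxC : c₀ ≤ x ∧ x ≤ c₁
  · obtain ⟨j, hj⟩ := zC; exact ⟨j, hj x hxC⟩
  push Not at hxA
  -- What remains is the stretch between A and C; no arc `p'`, `q'`, `r'` reaches the gap after
  -- `c₁`.
  have hxc : x < c₀ := by
    by_contra! hge
    refine hxC ⟨hge, ?_⟩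
    rcases hxi with h5 | h5 | h5
    · rw [h5, mp' x hx1 hx2] at hi; linarith [hi.2]
    · rw [h5, mq' x hx1 hx2] at hi; linarith [hi.2]
    · rw [h5, mr' x hx1 hx2] at hi; linarith [hi.2]
  by_cases hcase : uR ∨ (uP ∧ uQ)
  · refine ⟨i, ?_⟩
    have : e = r := if_pos hcase
    rw [hwi, this, hr, mr x hx1 hx2]
    constructor <;> linarith
  · have huR : ¬ uR := fun h => hcase (Or.inl h)
    by_cases huP : uP
    · have huQ : ¬ uQ := fun h => hcase (Or.inr ⟨huP, h⟩)
      have heP : e = p := by simp only [e, if_neg hcase, if_pos huP]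
      have hxP : Arc (w' i) = Arc (pa', pb') := by
        rcases hxi with h5 | h5 | h5
        · exact h5
        · exact absurd ⟨i, h5⟩ huQ
        · exact absurd ⟨i, h5⟩ huR
      rw [hxP, mp' x hx1 hx2] at hi
      by_cases hxb : x < b₀
      · refine ⟨i, ?_⟩
        rw [hwi, heP, hp, mp x hx1 hx2]
        constructor <;> linarith
      -- Since `q'` and `r'` do not occur and `p'` ends before `b₁`, the time `b₁` is covered by an
      -- arc that contains the whole strand B.
      · obtain ⟨j, hj⟩ := hc b₁
        rcases hw j with h5 | h5 | h5 | h5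
        · exact ⟨j, by rw [hwoff j h5]; exact h5.2.1.subset ⟨by linarith, le_rfl⟩ ⟨by linarith, by linarith⟩ hj⟩
        · rw [h5, mp' _ (by linarith) (by linarith)] at hj; linarith [hj.2]
        · exact absurd ⟨j, h5⟩ huQ
        · exact absurd ⟨j, h5⟩ huR
    · have heQ : e = q := by simp only [e, if_neg hcase, if_neg huP]
      have hxQ : Arc (w' i) = Arc (qb', qc') := by
        rcases hxi with h5 | h5 | h5
        · exact absurd ⟨i, h5⟩ huP
        · exact h5
        · exact absurd ⟨i, h5⟩ huR
      rw [hxQ, mq' x hx1 hx2] at hi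
      by_cases hxb : b₁ < x
      · refine ⟨i, ?_⟩
        rw [hwi, heQ, hq, mq x hx1 hx2]
        constructor <;> linarith
      -- The mirror case: only `q'` occurs, and it starts after `b₀`.
      · obtain ⟨j, hj⟩ := hc b₀
        rcases hw j with h5 | h5 | h5 | h5
        · exact ⟨j, by rw [hwoff j h5]; exact h5.2.1.subset ⟨le_rfl, by linarith⟩ ⟨by linarith, by linarith⟩ hj⟩
        · exact absurd ⟨j, h5⟩ huP
        · rw [h5, mq' _ (by linarith) (by linarith)] at hj; linarith [hj.1]
        · exact absurd ⟨j, h5⟩ huR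

/-- The pair `(u, v)` is, up to translation, one of the two arcs with ends `p` and `q`. -/
theorem pair_cases {p q u v : ℝ} (huv : u < v) (hvu : v < u + 1) (hpq : p < q) (hqp : q < p + 1)
    {k m : ℤ} (h : (u = p + k ∧ v = q + m) ∨ (u = q + k ∧ v = p + m)) :
    ∃ k : ℤ, (u = p + k ∧ v = q + k) ∨ (u = q + k ∧ v = p + 1 + k) := by
  rcases h with ⟨e1, e2⟩ | ⟨e1, e2⟩
  · exact ⟨k, Or.inl ⟨e1, sub_eq_of_int huv hvu hpq hqp e1 e2⟩⟩
  · refine ⟨k, Or.inr ⟨e1, sub_eq_of_int (m := m - 1) huv hvu (by linarith) (by linarith) e1 ?_⟩⟩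
    rw [e2]; push_cast; ring

/-- A coincidence of times either avoids all three strands or is one of the two arcs at one of the
three crossings, up to translation. -/
theorem Triangle.end_cases {g : ℝ → F} (hper : Function.Periodic g 1)
    (h : Triangle g a₀ a₁ b₀ b₁ c₀ c₁ pa pb qb qc rc ra) {u v : ℝ} (huv : u < v) (hvu : v < u + 1)
    (hg : g u = g v) :
    (u ∉ Zone a₀ a₁ ∪ Zone b₀ b₁ ∪ Zone c₀ c₁ ∧ v ∉ Zone a₀ a₁ ∪ Zone b₀ b₁ ∪ Zone c₀ c₁) ∨
    ∃ k : ℤ, ((u = pa + k ∧ v = pb + k) ∨ (u = pb + k ∧ v = pa + 1 + k)) ∨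
      ((u = qb + k ∧ v = qc + k) ∨ (u = qc + k ∧ v = qb + 1 + k)) ∨
      ((u = ra + k ∧ v = rc + k) ∨ (u = rc + k ∧ v = ra + 1 + k)) := by
  obtain ⟨⟨⟨x1, x2⟩, ⟨x3, x4⟩, ⟨x5, x6⟩, ⟨x7, x8⟩, ⟨x9, x10⟩, ⟨x11, x12⟩, x13, x14, x15⟩, -, -, -, hA, hB, hC⟩ := h
  have P : ∀ k m : ℤ, (u = pa + k ∧ v = pb + m) ∨ (u = pb + k ∧ v = pa + m) → _ := fun k m =>
    pair_cases huv hvu (show pa < pb by linarith) (show pb < pa + 1 by linarith)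
  have Q : ∀ k m : ℤ, (u = qb + k ∧ v = qc + m) ∨ (u = qc + k ∧ v = qb + m) → _ := fun k m =>
    pair_cases huv hvu (show qb < qc by linarith) (show qc < qb + 1 by linarith)
  have R : ∀ k m : ℤ, (u = ra + k ∧ v = rc + m) ∨ (u = rc + k ∧ v = ra + m) → _ := fun k m =>
    pair_cases huv hvu (show ra < rc by linarith) (show rc < ra + 1 by linarith)
  have inc1 : ∀ k m : ℤ, v = u + k + m → False := fun k m hm => by
    have e1 : k + m < 1 := int_lt_of_real (by push_cast; linarith)
    have e2 : 0 < k + m := int_lt_of_real (by push_cast; linarith)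
    omega
  have inc2 : ∀ k m : ℤ, u = v + k + m → False := fun k m hm => by
    have e1 : k + m < 0 := int_lt_of_real (by push_cast; linarith)
    have e2 : -1 < k + m := int_lt_of_real (by push_cast; linarith)
    omega
  have sh : ∀ {x y : ℝ} {k : ℤ}, x + k = y → x = y + ((-k : ℤ) : ℝ) := fun {x y k} hk => by
    push_cast; linarith
  by_cases hz : u ∉ Zone a₀ a₁ ∪ Zone b₀ b₁ ∪ Zone c₀ c₁ ∧ v ∉ Zone a₀ a₁ ∪ Zone b₀ b₁ ∪ Zone c₀ c₁
  · exact Or.inl hz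
  right
  rw [not_and_or, not_not, not_not] at hz
  rcases hz with ((⟨k, hk⟩ | ⟨k, hk⟩) | ⟨k, hk⟩) | ((⟨k, hk⟩ | ⟨k, hk⟩) | ⟨k, hk⟩)
  · obtain ⟨m, hm | ⟨e1, e2⟩ | ⟨e1, e2⟩⟩ := hA _ hk v (by rw [add_int_of_periodic hper, hg])
    · exact (inc1 k m hm).elim
    · exact (P _ m (Or.inl ⟨sh e1, e2⟩)).imp fun _ => Or.inl
    · exact (R _ m (Or.inl ⟨sh e1, e2⟩)).imp fun _ h => Or.inr (Or.inr h)
  · obtain ⟨m, hm | ⟨e1, e2⟩ | ⟨e1, e2⟩⟩ := hB _ hk v (by rw [add_int_of_periodic hper, hg])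
    · exact (inc1 k m hm).elim
    · exact (P _ m (Or.inr ⟨sh e1, e2⟩)).imp fun _ => Or.inl
    · exact (Q _ m (Or.inl ⟨sh e1, e2⟩)).imp fun _ h => Or.inr (Or.inl h)
  · obtain ⟨m, hm | ⟨e1, e2⟩ | ⟨e1, e2⟩⟩ := hC _ hk v (by rw [add_int_of_periodic hper, hg])
    · exact (inc1 k m hm).elim
    · exact (Q _ m (Or.inr ⟨sh e1, e2⟩)).imp fun _ h => Or.inr (Or.inl h)
    · exact (R _ m (Or.inr ⟨sh e1, e2⟩)).imp fun _ h => Or.inr (Or.inr h)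
  · obtain ⟨m, hm | ⟨e1, e2⟩ | ⟨e1, e2⟩⟩ := hA _ hk u (by rw [add_int_of_periodic hper, hg])
    · exact (inc2 k m hm).elim
    · exact (P m _ (Or.inr ⟨e2, sh e1⟩)).imp fun _ => Or.inl
    · exact (R m _ (Or.inr ⟨e2, sh e1⟩)).imp fun _ h => Or.inr (Or.inr h)
  · obtain ⟨m, hm | ⟨e1, e2⟩ | ⟨e1, e2⟩⟩ := hB _ hk u (by rw [add_int_of_periodic hper, hg])
    · exact (inc2 k m hm).elim
    · exact (P m _ (Or.inl ⟨e2, sh e1⟩)).imp fun _ => Or.inl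
    · exact (Q m _ (Or.inr ⟨e2, sh e1⟩)).imp fun _ h => Or.inr (Or.inl h)
  · obtain ⟨m, hm | ⟨e1, e2⟩ | ⟨e1, e2⟩⟩ := hC _ hk u (by rw [add_int_of_periodic hper, hg])
    · exact (inc2 k m hm).elim
    · exact (Q m _ (Or.inl ⟨e2, sh e1⟩)).imp fun _ h => Or.inr (Or.inl h)
    · exact (R m _ (Or.inl ⟨e2, sh e1⟩)).imp fun _ h => Or.inr (Or.inr h)

theorem off_of_notMem {a : ℝ × ℝ} (h1 : a.1 ∉ Zone a₀ a₁ ∪ Zone b₀ b₁ ∪ Zone c₀ c₁)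
    (h2 : a.2 ∉ Zone a₀ a₁ ∪ Zone b₀ b₁ ∪ Zone c₀ c₁) : Off a a₀ a₁ b₀ b₁ c₀ c₁ := by
  simp only [mem_union, not_or] at h1 h2
  exact ⟨⟨h1.1.1, h2.1.1⟩, ⟨h1.1.2, h2.1.2⟩, ⟨h1.2, h2.2⟩⟩

theorem Off.notMem {a : ℝ × ℝ} (h : Off a a₀ a₁ b₀ b₁ c₀ c₁) :
    a.1 ∉ Zone a₀ a₁ ∪ Zone b₀ b₁ ∪ Zone c₀ c₁ ∧ a.2 ∉ Zone a₀ a₁ ∪ Zone b₀ b₁ ∪ Zone c₀ c₁ := by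
  simp only [mem_union, not_or]
  exact ⟨⟨⟨h.1.1, h.2.1.1⟩, h.2.2.1⟩, ⟨⟨h.1.2, h.2.1.2⟩, h.2.2.2⟩⟩

/-- An arc of the system without ends in the strands, or one of the three chosen arcs at the
triangle. -/
theorem ArcSystem.triangle_cases {g : ℝ → F} {L : Set (ℝ × ℝ)} (hL : ArcSystem g L)
    (hper : Function.Periodic g 1) (h : Triangle g a₀ a₁ b₀ b₁ c₀ c₁ pa pb qb qc rc ra)
    {p q r : ℝ × ℝ} (hpL : p ∈ L) (hqL : q ∈ L) (hrL : r ∈ L)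
    (hp : Arc p = Arc (pa, pb) ∨ Arc p = Arc (pb, pa + 1))
    (hq : Arc q = Arc (qb, qc) ∨ Arc q = Arc (qc, qb + 1))
    (hr : Arc r = Arc (ra, rc) ∨ Arc r = Arc (rc, ra + 1)) {d : ℝ × ℝ} (hd : d ∈ L) :
    Off d a₀ a₁ b₀ b₁ c₀ c₁ ∨ Arc d = Arc p ∨ Arc d = Arc q ∨ Arc d = Arc r := by
  have hor : ∀ {s t : ℝ} {p : ℝ × ℝ}, p ∈ L → s < t → t < s + 1 →
      (Arc p = Arc (s, t) ∨ Arc p = Arc (t, s + 1)) →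
      (∃ k : ℤ, (d.1 = s + k ∧ d.2 = t + k) ∨ (d.1 = t + k ∧ d.2 = s + 1 + k)) → Arc d = Arc p := by
    rintro s t p hpL hst hts hp ⟨k, ⟨e1, e2⟩ | ⟨e1, e2⟩⟩
    · have hA : Arc d = Arc (s, t) := by rw [← Arc_add_int s t k, ← e1, ← e2]
      rcases hp with hp | hp
      · rw [hA, hp]
      · exact (hL.not_both hd hpL hst hts hA hp).elim
    · have hA : Arc d = Arc (t, s + 1) := by rw [← Arc_add_int t (s + 1) k, ← e1, ← e2]
      rcases hp with hp | hp
      · exact (hL.not_both hpL hd hst hts hp hA).elim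
      · rw [hA, hp]
  have x1 := h.mem_pa; have x2 := h.mem_pb; have x3 := h.mem_qb; have x4 := h.mem_qc; have x5 := h.mem_rc
  have x6 := h.mem_ra; have x7 := h.ab; have x8 := h.bc; have x9 := h.ca
  simp only [mem_Ioo] at x1 x2 x3 x4 x5 x6
  rcases h.end_cases hper (hL.lt d hd) (hL.lt_add_one d hd) (hL.eq d hd) with ⟨h1, h2⟩ | ⟨k, h1 | h1 | h1⟩
  · exact Or.inl (off_of_notMem h1 h2)
  · exact Or.inr (Or.inl (hor hpL (by linarith) (by linarith) hp ⟨k, h1⟩))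
  · exact Or.inr (Or.inr (Or.inl (hor hqL (by linarith) (by linarith) hq ⟨k, h1⟩)))
  · exact Or.inr (Or.inr (Or.inr (hor hrL (by linarith) (by linarith) hr ⟨k, h1⟩)))

/-- The arcs chosen at a triangle do not cover all the three gaps between the strands. -/
theorem ArcSystem.exists_gap {g : ℝ → F} {L : Set (ℝ × ℝ)} (hL : ArcSystem g L)
    (hper : Function.Periodic g 1) (h : Triangle g a₀ a₁ b₀ b₁ c₀ c₁ pa pb qb qc rc ra)
    {p q r : ℝ × ℝ} (hpL : p ∈ L) (hqL : q ∈ L) (hrL : r ∈ L)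
    (hp : Arc p = Arc (pa, pb) ∨ Arc p = Arc (pb, pa + 1))
    (hq : Arc q = Arc (qb, qc) ∨ Arc q = Arc (qc, qb + 1))
    (hr : Arc r = Arc (ra, rc) ∨ Arc r = Arc (rc, ra + 1)) :
    ∃ x, (x ∈ Ioo a₁ b₀ ∨ x ∈ Ioo b₁ c₀ ∨ x ∈ Ioo c₁ (a₀ + 1)) ∧ x ∉ Arc p ∧ x ∉ Arc q ∧ x ∉ Arc r := by
  -- In each strand, the part outside `p`, `q`, `r` is contained in one arc of the system: an arc
  -- covering a point of that part is not one of the three, so it has no ends in the strand.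
  have zone : ∀ (c d : ℝ), (∀ e, Off e a₀ a₁ b₀ b₁ c₀ c₁ → NoEnd e c d) →
      ∃ e ∈ L, ∀ y ∈ Icc c d, y ∉ Arc p → y ∉ Arc q → y ∉ Arc r → y ∈ Arc e := by
    intro c d hcd
    by_cases H : ∃ y ∈ Icc c d, y ∉ Arc p ∧ y ∉ Arc q ∧ y ∉ Arc r
    · obtain ⟨y, hy, y1, y2, y3⟩ := H
      obtain ⟨e, he, hye⟩ := hL.cover y
      rcases hL.triangle_cases hper h hpL hqL hrL hp hq hr he with h5 | h5 | h5 | h5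
      · exact ⟨e, he, fun z hz _ _ _ => (hcd e h5).subset hy hz hye⟩
      · exact absurd (h5 ▸ hye) y1
      · exact absurd (h5 ▸ hye) y2
      · exact absurd (h5 ▸ hye) y3
    · exact ⟨p, hpL, fun y hy y1 y2 y3 => absurd ⟨y, hy, y1, y2, y3⟩ H⟩
  obtain ⟨eA, heA, hA⟩ := zone a₀ a₁ fun e he => he.1
  obtain ⟨eB, heB, hB⟩ := zone b₀ b₁ fun e he => he.2.1
  obtain ⟨eC, heC, hC⟩ := zone c₀ c₁ fun e he => he.2.2
  -- The three arcs at the triangle and one arc for each strand are six arcs, so they miss some `x`;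
  -- it cannot lie in a strand.
  obtain ⟨x, hx⟩ := hL.not_cover ![p, q, r, eA, eB, eC] (by
    intro i; fin_cases i <;> assumption)
  obtain ⟨k, k1, k2⟩ := exists_add_int_mem_Ico a₀ x
  have hx' : ∀ i, x + k ∉ Arc (![p, q, r, eA, eB, eC] i) := fun i hi =>
    hx i ((add_int_mem_Arc_iff k).1 hi)
  have y1 : x + k ∉ Arc p := hx' 0
  have y2 : x + k ∉ Arc q := hx' 1
  have y3 : x + k ∉ Arc r := hx' 2
  refine ⟨x + k, ?_, y1, y2, y3⟩
  by_cases z1 : x + k ≤ a₁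
  · exact absurd (hA _ ⟨k1, z1⟩ y1 y2 y3) (hx' 3)
  by_cases z2 : x + k < b₀
  · exact Or.inl ⟨not_le.1 z1, z2⟩
  by_cases z3 : x + k ≤ b₁
  · exact absurd (hB _ ⟨not_lt.1 z2, z3⟩ y1 y2 y3) (hx' 4)
  by_cases z4 : x + k < c₀
  · exact Or.inr (Or.inl ⟨not_le.1 z3, z4⟩)
  by_cases z5 : x + k ≤ c₁
  · exact absurd (hC _ ⟨not_lt.1 z4, z5⟩ y1 y2 y3) (hx' 5)
  · exact Or.inr (Or.inr ⟨not_le.1 z5, k2⟩)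

/-- The triangle move, if the arcs chosen at the triangle leave the third gap free. -/
theorem ArcSystem.triangle_of_gap {g g' : ℝ → F} {L : Set (ℝ × ℝ)} (hL : ArcSystem g L)
    (hper : Function.Periodic g 1) (hper' : Function.Periodic g' 1)
    (h : Triangle g a₀ a₁ b₀ b₁ c₀ c₁ pa pb qb qc rc ra)
    (h' : Triangle g' a₀ a₁ b₀ b₁ c₀ c₁ pa' pb' qb' qc' rc' ra')
    (hoff : ∀ u, u ∉ Zone a₀ a₁ ∪ Zone b₀ b₁ ∪ Zone c₀ c₁ → g' u = g u)
    {p q r : ℝ × ℝ} (hpL : p ∈ L) (hqL : q ∈ L) (hrL : r ∈ L)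
    (hp : Arc p = Arc (pa, pb)) (hq : Arc q = Arc (qb, qc)) (hr : Arc r = Arc (ra, rc)) :
    ∃ L', ArcSystem g' L' := by
  have cases := fun {d : ℝ × ℝ} => hL.triangle_cases hper h hpL hqL hrL (Or.inl hp) (Or.inl hq) (Or.inl hr) (d := d)
  obtain ⟨⟨y1, y2⟩, ⟨y3, y4⟩, ⟨y5, y6⟩, ⟨y7, y8⟩, ⟨y9, y10⟩, ⟨y11, y12⟩, y13, y14, y15⟩ := h'.toTriOrder
  refine ⟨{a | (a ∈ L ∧ Off a a₀ a₁ b₀ b₁ c₀ c₁) ∨ ∃ k : ℤ, a = (pa' + k, pb' + k) ∨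
    a = (qb' + k, qc' + k) ∨ a = (ra' + k, rc' + k)}, ?_, ?_, ?_, ?_, ?_, ?_⟩
  · rintro a (⟨ha, -⟩ | ⟨k, rfl | rfl | rfl⟩)
    · exact hL.lt a ha
    all_goals simp only; linarith
  · rintro a (⟨ha, -⟩ | ⟨k, rfl | rfl | rfl⟩)
    · exact hL.lt_add_one a ha
    all_goals simp only; linarith
  · rintro a (⟨ha, hao⟩ | ⟨k, rfl | rfl | rfl⟩)
    · rw [hoff _ hao.notMem.1, hoff _ hao.notMem.2, hL.eq a ha]
    · simp only [add_int_of_periodic hper', h'.eq_p]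
    · simp only [add_int_of_periodic hper', h'.eq_q]
    · simp only [add_int_of_periodic hper', h'.eq_r]
  · intro u v huv hvu hg
    rcases h'.end_cases hper' huv hvu hg with ⟨h1, h2⟩ | ⟨k, (⟨e1, e2⟩ | ⟨e1, e2⟩) | (⟨e1, e2⟩ | ⟨e1, e2⟩) | (⟨e1, e2⟩ | ⟨e1, e2⟩)⟩
    · have hu1 : u + 1 ∉ Zone a₀ a₁ ∪ Zone b₀ b₁ ∪ Zone c₀ c₁ := by
        have key : ∀ c d : ℝ, u + 1 ∈ Zone c d ↔ u ∈ Zone c d := fun c d => by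
          have := add_int_mem_Zone_iff (a := c) (b := d) (x := u) 1
          push_cast at this; exact this
        simpa only [mem_union, key] using h1
      rw [hoff _ h1, hoff _ h2] at hg
      exact (hL.choice u v huv hvu hg).imp (fun h => Or.inl ⟨h, off_of_notMem h1 h2⟩)
        fun h => Or.inl ⟨h, off_of_notMem h2 hu1⟩
    · left; right; exact ⟨k, Or.inl (by rw [e1, e2])⟩
    · right; right; refine ⟨k + 1, Or.inl ?_⟩
      rw [e1, e2]; push_cast; ext <;> simp only <;> ring
    · left; right; exact ⟨k, Or.inr (Or.inl (by rw [e1, e2]))⟩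
    · right; right; refine ⟨k + 1, Or.inr (Or.inl ?_)⟩
      rw [e1, e2]; push_cast; ext <;> simp only <;> ring
    · left; right; exact ⟨k, Or.inr (Or.inr (by rw [e1, e2]))⟩
    · right; right; refine ⟨k + 1, Or.inr (Or.inr ?_)⟩
      rw [e1, e2]; push_cast; ext <;> simp only <;> ring
  -- Here the old system itself, as an infinite family, is the cover to be transferred; below, a
  -- cover by six new arcs is transferred back.
  · obtain ⟨w, hw, hc⟩ := h'.toTriOrder.transfer h.toTriOrder (p := (pa', pb')) (q := (qb', qc'))
      (r := (ra', rc')) rfl rfl rfl (ι := L) (fun a => a.1)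
      (fun a => by simpa only [hp, hq, hr] using cases a.2)
      (fun x => by obtain ⟨a, ha, hx⟩ := hL.cover x; exact ⟨⟨a, ha⟩, hx⟩)
    intro x
    obtain ⟨i, hi⟩ := hc x
    refine ⟨w i, ?_, hi⟩
    rcases hw i with ⟨e1, e2⟩ | e | e | e
    · rw [e1]; exact Or.inl ⟨i.2, e2⟩
    · exact Or.inr ⟨0, Or.inl (by simpa using e)⟩
    · exact Or.inr ⟨0, Or.inr (Or.inl (by simpa using e))⟩
    · exact Or.inr ⟨0, Or.inr (Or.inr (by simpa using e))⟩
  · intro w' hw'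
    by_contra! hc
    obtain ⟨w, hw, hcov⟩ := h.toTriOrder.transfer h'.toTriOrder hp hq hr w' (fun i => by
      rcases hw' i with ⟨-, e⟩ | ⟨k, e | e | e⟩
      · exact Or.inl e
      · rw [e, Arc_add_int]; exact Or.inr (Or.inl rfl)
      · rw [e, Arc_add_int]; exact Or.inr (Or.inr (Or.inl rfl))
      · rw [e, Arc_add_int]; exact Or.inr (Or.inr (Or.inr rfl))) hc
    obtain ⟨x, hx⟩ := hL.not_cover w fun i => by
      rcases hw i with ⟨e, ho⟩ | e | e | e
      · rw [e]
        rcases hw' i with ⟨h5, -⟩ | ⟨k, h5 | h5 | h5⟩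
        · exact h5
        -- The new arcs at the triangle start in the strands A or B, so they are not `Off`.
        all_goals
          exfalso
          rw [h5] at ho
          first
            | exact ho.1.1 ⟨-k, by push_cast; linarith, by push_cast; linarith⟩
            | exact ho.2.1.1 ⟨-k, by push_cast; linarith, by push_cast; linarith⟩
      all_goals rw [e]; assumption
    obtain ⟨i, hi⟩ := hcov x
    exact hx i hi

theorem Zone_add_int (c d : ℝ) (k : ℤ) : Zone (c + k) (d + k) = Zone c d := by
  ext x
  constructor
  · rintro ⟨m, h1, h2⟩
    exact ⟨m - k, by push_cast; linarith, by push_cast; linarith⟩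
  · rintro ⟨m, h1, h2⟩
    exact ⟨m + k, by push_cast; linarith, by push_cast; linarith⟩

theorem Zone_add_one (c d : ℝ) : Zone (c + 1) (d + 1) = Zone c d := by
  simpa using Zone_add_int c d 1

theorem Arc_add_one (s t : ℝ) : Arc (s + 1, t + 1) = Arc (s, t) := by
  simpa using Arc_add_int s t 1

/-- Arc systems persist under triangle moves. -/
theorem ArcSystem.triangle {g g' : ℝ → F} {L : Set (ℝ × ℝ)} (hL : ArcSystem g L)
    (hper : Function.Periodic g 1) (hper' : Function.Periodic g' 1)
    (h : Triangle g a₀ a₁ b₀ b₁ c₀ c₁ pa pb qb qc rc ra)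
    (h' : Triangle g' a₀ a₁ b₀ b₁ c₀ c₁ pa' pb' qb' qc' rc' ra')
    (hoff : ∀ u, u ∉ Zone a₀ a₁ ∪ Zone b₀ b₁ ∪ Zone c₀ c₁ → g' u = g u) :
    ∃ L', ArcSystem g' L' := by
  obtain ⟨⟨x1, x2⟩, ⟨x3, x4⟩, ⟨x5, x6⟩, ⟨x7, x8⟩, ⟨x9, x10⟩, ⟨x11, x12⟩, x13, x14, x15⟩ := h.toTriOrder
  have pick : ∀ s t, s < t → t < s + 1 → g s = g t →
      ∃ p ∈ L, Arc p = Arc (s, t) ∨ Arc p = Arc (t, s + 1) := fun s t h1 h2 h3 =>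
    (hL.choice s t h1 h2 h3).elim (fun h => ⟨_, h, Or.inl rfl⟩) fun h => ⟨_, h, Or.inr rfl⟩
  obtain ⟨p, hpL, hp⟩ := pick pa pb (by linarith) (by linarith) h.eq_p
  obtain ⟨q, hqL, hq⟩ := pick qb qc (by linarith) (by linarith) h.eq_q
  obtain ⟨r, hrL, hr⟩ := pick ra rc (by linarith) (by linarith) h.eq_r.symm
  obtain ⟨x, hx, xp, xq, xr⟩ := hL.exists_gap hper h hpL hqL hrL hp hq hr
  have h2 := h.rotate hper
  have h2' := h'.rotate hper'
  have h3 := h2.rotate hper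
  have h3' := h2'.rotate hper'
  have hxa : a₀ ≤ x ∧ x < a₀ + 1 := by
    rcases hx with ⟨e1, e2⟩ | ⟨e1, e2⟩ | ⟨e1, e2⟩ <;> constructor <;> linarith
  have mp := mem_Arc_iff (show a₀ ≤ pa by linarith) (show pb < a₀ + 1 by linarith) hxa.1 hxa.2
  have mq := mem_Arc_iff (show a₀ ≤ qb by linarith) (show qc < a₀ + 1 by linarith) hxa.1 hxa.2
  have mr := mem_Arc_iff (show a₀ ≤ ra by linarith) (show rc < a₀ + 1 by linarith) hxa.1 hxa.2
  have np := mem_Arc_compl_iff (show a₀ ≤ pa by linarith) (show pa < pb by linarith) (by linarith) hxa.1 hxa.2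
  have nq := mem_Arc_compl_iff (show a₀ ≤ qb by linarith) (show qb < qc by linarith) (by linarith) hxa.1 hxa.2
  have nr := mem_Arc_compl_iff (show a₀ ≤ ra by linarith) (show ra < rc by linarith) (by linarith) hxa.1 hxa.2
  have hoff₂ : ∀ u, u ∉ Zone b₀ b₁ ∪ Zone c₀ c₁ ∪ Zone (a₀ + 1) (a₁ + 1) → g' u = g u := by
    intro u hu
    refine hoff u fun h => hu ?_
    rw [Zone_add_one]
    rcases h with (h | h) | h
    exacts [Or.inr h, Or.inl (Or.inl h), Or.inl (Or.inr h)]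
  have hoff₃ : ∀ u, u ∉ Zone c₀ c₁ ∪ Zone (a₀ + 1) (a₁ + 1) ∪ Zone (b₀ + 1) (b₁ + 1) →
      g' u = g u := by
    intro u hu
    refine hoff u fun h => hu ?_
    rw [Zone_add_one, Zone_add_one]
    rcases h with (h | h) | h
    exacts [Or.inl (Or.inr h), Or.inr h, Or.inl (Or.inl h)]
  -- Of the eight combinations of choices, five cover all three gaps, contrary to the choice of `x`.
  -- The other three leave free the gap CA, BC or AB respectively, and a rotation makes this gap the
  -- last one.
  rcases hp with hp | hp <;> rcases hq with hq | hq <;> rcases hr with hr | hr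
  · exact hL.triangle_of_gap hper hper' h h' hoff hpL hqL hrL hp hq hr
  · exfalso
    rw [hp, mp] at xp; rw [hq, mq] at xq; rw [hr, nr] at xr
    push Not at xr
    rcases hx with ⟨e1, e2⟩ | ⟨e1, e2⟩ | ⟨e1, e2⟩
    · exact xp ⟨by linarith, by linarith⟩
    · exact xq ⟨by linarith, by linarith⟩
    · linarith
  · exfalso
    rw [hp, mp] at xp; rw [hq, nq] at xq; rw [hr, mr] at xr
    push Not at xq
    rcases hx with ⟨e1, e2⟩ | ⟨e1, e2⟩ | ⟨e1, e2⟩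
    · linarith
    · exact xr ⟨by linarith, by linarith⟩
    · linarith
  · refine hL.triangle_of_gap hper hper' h3 h3' hoff₃ hrL hpL hqL hr ?_ hq
    rw [Arc_add_one, hp]
  · exfalso
    rw [hp, np] at xp; rw [hq, mq] at xq; rw [hr, mr] at xr
    push Not at xp
    rcases hx with ⟨e1, e2⟩ | ⟨e1, e2⟩ | ⟨e1, e2⟩
    · exact xr ⟨by linarith, by linarith⟩
    · linarith
    · linarith
  · exact hL.triangle_of_gap hper hper' h2 h2' hoff₂ hqL hrL hpL hq hr hp
  all_goals
    exfalso
    rw [hp, np] at xp; rw [hq, nq] at xq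
    push Not at xp xq
    rcases hx with ⟨e1, e2⟩ | ⟨e1, e2⟩ | ⟨e1, e2⟩ <;> linarith

end Triangle

/-! ### Changing a loop during an interval of times -/

variable {F : Type*} [TopologicalSpace F]

instance fact_zero_lt_one_real : Fact ((0 : ℝ) < 1) := ⟨one_pos⟩

/-- Replace a piece of a loop by a path with the same ends. -/
theorem exists_replace {g γ : ℝ → F} (hc : Continuous g) (hper : Function.Periodic g 1) {a₀ a₁ : ℝ}
    (h01 : a₀ ≤ a₁) (h1 : a₁ < a₀ + 1) (hγ : ContinuousOn γ (Icc a₀ a₁)) (e₀ : γ a₀ = g a₀)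
    (e₁ : γ a₁ = g a₁) :
    ∃ g' : ℝ → F, Continuous g' ∧ Function.Periodic g' 1 ∧ (∀ u ∈ Icc a₀ a₁, g' u = γ u) ∧
      ∀ u, u ∉ Zone a₀ a₁ → g' u = g u := by
  classical
  -- The new loop is described on one period, starting at `a₀`, and then descends to the circle;
  -- continuity needs agreement at `a₁` and at the two ends of the period.
  let f : ℝ → F := fun u => if u ≤ a₁ then γ u else g u
  have hf : ContinuousOn f (Icc a₀ (a₀ + 1)) := by
    refine ContinuousOn.if ?_ ?_ ?_
    · rintro u ⟨-, hu⟩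
      have : frontier {u : ℝ | u ≤ a₁} = {a₁} := frontier_Iic
      rw [this] at hu
      rw [mem_singleton_iff.1 hu, e₁]
    · have : closure {u : ℝ | u ≤ a₁} = Iic a₁ := isClosed_Iic.closure_eq
      rw [this]
      exact hγ.mono fun u hu => ⟨hu.1.1, hu.2⟩
    · exact hc.continuousOn
  have hf' : f a₀ = f (a₀ + 1) := by
    simp only [f, if_pos h01, if_neg (not_le.2 h1), e₀, hper a₀]
  have hcont : Continuous (AddCircle.liftIco 1 a₀ f) := AddCircle.liftIco_continuous hf' hf
  have hperiod : Function.Periodic (fun u : ℝ => AddCircle.liftIco 1 a₀ f (u : AddCircle (1 : ℝ))) 1 := by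
    intro u
    simp only
    rw [AddCircle.coe_add_period]
  refine ⟨fun u => AddCircle.liftIco 1 a₀ f (u : AddCircle (1 : ℝ)),
    hcont.comp (AddCircle.continuous_mk' 1), hperiod, ?_, ?_⟩
  · intro u hu
    simp only
    rw [AddCircle.liftIco_coe_apply ⟨hu.1, hu.2.trans_lt h1⟩]
    simp only [f, if_pos hu.2]
  · intro u hu
    obtain ⟨k, hk1, hk2⟩ := exists_add_int_mem_Ico a₀ u
    have h2 : ¬ u + k ≤ a₁ := fun h => hu ⟨k, hk1, h⟩
    refine (add_int_of_periodic hperiod u k).symm.trans ?_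
    rw [← add_int_of_periodic hper u k]
    rw [AddCircle.liftIco_coe_apply ⟨hk1, hk2⟩]
    simp only [f, if_neg h2]

theorem finite_translates (τ : ℝ) : {u ∈ Icc (0 : ℝ) 1 | ∃ k : ℤ, u = τ + k}.Finite := by
  refine ((Set.finite_Icc (⌊-τ⌋) (⌈1 - τ⌉)).image fun k : ℤ => τ + k).subset ?_
  rintro _ ⟨⟨h0, h1⟩, k, rfl⟩
  refine ⟨k, ⟨?_, ?_⟩, rfl⟩
  · have := Int.floor_le (-τ)
    exact_mod_cast (show ((⌊-τ⌋ : ℤ) : ℝ) ≤ k by linarith)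
  · have := Int.le_ceil (1 - τ)
    exact_mod_cast (show (k : ℝ) ≤ ((⌈1 - τ⌉ : ℤ) : ℝ) by linarith)

theorem Transverse.add_int {g : ℝ → F} (hper : Function.Periodic g 1) {t : ℝ} (h : Transverse g t)
    (k : ℤ) : Transverse g (t + k) := by
  obtain ⟨O₁, O₂, h1, h2, hd, hl, hr, h3⟩ := h
  refine ⟨O₁, O₂, h1, h2, hd, ?_, ?_, by rwa [add_int_of_periodic hper]⟩
  · have ht : Tendsto (fun w : ℝ => w - k) (𝓝[<] (t + k)) (𝓝[<] t) := by
      refine tendsto_nhdsWithin_iff.2 ⟨?_, ?_⟩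
      · have : Continuous fun w : ℝ => w - k := by fun_prop
        have := (this.tendsto (t + k)).mono_left (nhdsWithin_le_nhds (s := Iio (t + k)))
        simpa using this
      · filter_upwards [self_mem_nhdsWithin] with w (hw : w < t + k)
        exact (sub_lt_iff_lt_add.2 hw : w - k < t)
    filter_upwards [ht.eventually hl] with w hw
    have := add_int_of_periodic hper (w - k) k
    rw [sub_add_cancel] at this
    rwa [this]
  · have ht : Tendsto (fun w : ℝ => w - k) (𝓝[>] (t + k)) (𝓝[>] t) := by
      refine tendsto_nhdsWithin_iff.2 ⟨?_, ?_⟩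
      · have : Continuous fun w : ℝ => w - k := by fun_prop
        have := (this.tendsto (t + k)).mono_left (nhdsWithin_le_nhds (s := Ioi (t + k)))
        simpa using this
      · filter_upwards [self_mem_nhdsWithin] with w (hw : t + k < w)
        exact (lt_sub_iff_add_lt.2 hw : t < w - k)
    filter_upwards [ht.eventually hr] with w hw
    have := add_int_of_periodic hper (w - k) k
    rw [sub_add_cancel] at this
    rwa [this]

section Modify

variable {g g' : ℝ → F} {a₀ a₁ : ℝ} {Q : Set F}

theorem mem_of_mem_Zone (hper : Function.Periodic g 1) (hQ : ∀ u ∈ Icc a₀ a₁, g u ∈ Q) {u : ℝ}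
    (hu : u ∈ Zone a₀ a₁) : g u ∈ Q := by
  obtain ⟨k, hk⟩ := hu
  rw [← add_int_of_periodic hper u k]
  exact hQ _ hk

theorem mem_iff_of_modify (hper : Function.Periodic g 1) (hper' : Function.Periodic g' 1)
    (hQ : ∀ u ∈ Icc a₀ a₁, g u ∈ Q) (hQ' : ∀ u ∈ Icc a₀ a₁, g' u ∈ Q)
    (hoff : ∀ u, u ∉ Zone a₀ a₁ → g' u = g u) (u : ℝ) : g u ∈ Q ↔ g' u ∈ Q := by
  by_cases hu : u ∈ Zone a₀ a₁
  · exact iff_of_true (mem_of_mem_Zone hper hQ hu) (mem_of_mem_Zone hper' hQ' hu)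
  · rw [hoff u hu]

theorem eq_of_notMem (hper : Function.Periodic g 1) (hper' : Function.Periodic g' 1)
    (hQ : ∀ u ∈ Icc a₀ a₁, g u ∈ Q) (hQ' : ∀ u ∈ Icc a₀ a₁, g' u ∈ Q)
    (hoff : ∀ u, u ∉ Zone a₀ a₁ → g' u = g u) {u : ℝ} (hu : g u ∉ Q ∨ g' u ∉ Q) : g' u = g u := by
  refine hoff u fun hz => ?_
  rcases hu with hu | hu
  · exact hu (mem_of_mem_Zone hper hQ hz)
  · exact hu (mem_of_mem_Zone hper' hQ' hz)

/-- A generic loop remains generic if it is changed inside a closed set in a generic way. -/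
theorem genericLoop_of_modify (hg : GenericLoop g) (hc : Continuous g')
    (hper' : Function.Periodic g' 1) (hcl : IsClosed Q)
    (hQ : ∀ u ∈ Icc a₀ a₁, g u ∈ Q) (hQ' : ∀ u ∈ Icc a₀ a₁, g' u ∈ Q)
    (hoff : ∀ u, u ∉ Zone a₀ a₁ → g' u = g u) {T : Set ℝ} (hT : T.Finite)
    (hd : ∀ u, g' u ∈ Q → DoubleTime g' u → ∃ τ ∈ T, ∃ k : ℤ, u = τ + k)
    (htr : ∀ τ ∈ T, Transverse g' τ) : GenericLoop g' := by
  -- Both times of a coincidence outside `Q` are times at which the two loops agree, so the double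
  -- point is an old one.
  have key : ∀ u, g' u ∉ Q → DoubleTime g' u → DoubleTime g u := by
    rintro u hu ⟨s, hs, hk⟩
    refine ⟨s, ?_, hk⟩
    rw [← eq_of_notMem hg.periodic hper' hQ hQ' hoff (u := s) (Or.inr (hs ▸ hu)), hs,
      eq_of_notMem hg.periodic hper' hQ hQ' hoff (Or.inr hu)]
  refine ⟨hc, hper', ?_, ?_⟩
  · refine ((hg.finite).union (hT.biUnion fun τ _ => finite_translates τ)).subset ?_
    rintro u ⟨hu, hdu⟩
    by_cases huQ : g' u ∈ Q
    · obtain ⟨τ, hτ, hk⟩ := hd u huQ hdu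
      exact Or.inr (mem_biUnion hτ ⟨hu, hk⟩)
    · exact Or.inl ⟨hu, key u huQ hdu⟩
  · intro u hdu
    by_cases huQ : g' u ∈ Q
    · obtain ⟨τ, hτ, k, rfl⟩ := hd u huQ hdu
      exact (htr τ hτ).add_int hper' k
    · have hgu : g' u = g u := eq_of_notMem hg.periodic hper' hQ hQ' hoff (Or.inr huQ)
      obtain ⟨O₁, O₂, h1, h2, hd', hl, hr, h3⟩ := hg.transverse u (key u huQ hdu)
      have hev : ∀ᶠ w in 𝓝 u, g' w = g w := by
        filter_upwards [hc.continuousAt.eventually (hcl.isOpen_compl.mem_nhds huQ)] with w hw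
        exact eq_of_notMem hg.periodic hper' hQ hQ' hoff (Or.inr hw)
      refine ⟨O₁, O₂, h1, h2, hd', ?_, ?_, ?_⟩
      · filter_upwards [hl, hev.filter_mono nhdsWithin_le_nhds] with w hw he
        rwa [he]
      · filter_upwards [hr, hev.filter_mono nhdsWithin_le_nhds] with w hw he
        rwa [he]
      · rw [hgu] at huQ ⊢
        filter_upwards [h3, hcl.isOpen_compl.mem_nhds huQ] with q hq hqQ hqr
        refine hq ?_
        rintro ⟨w, rfl⟩
        exact hqr ⟨w, eq_of_notMem hg.periodic hper' hQ hQ' hoff (Or.inl hqQ)⟩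

theorem range_of_modify {C' : Set F} (hper : Function.Periodic g 1) (hper' : Function.Periodic g' 1)
    (hQ : ∀ u ∈ Icc a₀ a₁, g u ∈ Q) (hQ' : ∀ u ∈ Icc a₀ a₁, g' u ∈ Q)
    (hoff : ∀ u, u ∉ Zone a₀ a₁ → g' u = g u) (hout : ∀ q, q ∉ Q → (q ∈ range g ↔ q ∈ C'))
    (hin : ∀ q ∈ Q, q ∈ range g' ↔ q ∈ C') : range g' = C' := by
  ext q
  by_cases hq : q ∈ Q
  · exact hin q hq
  · rw [← hout q hq]
    constructor
    · rintro ⟨u, rfl⟩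
      exact ⟨u, (eq_of_notMem hper hper' hQ hQ' hoff (Or.inr hq)).symm⟩
    · rintro ⟨u, rfl⟩
      exact ⟨u, eq_of_notMem hper hper' hQ hQ' hoff (Or.inl hq)⟩

end Modify

/-- If the picture of a loop in a disk is unbounded, then the loop leaves the disk. -/
theorem exists_notMem_range {g : ℝ → F} (hc : Continuous g) (hper : Function.Periodic g 1)
    {φ : ℝ × ℝ → F} (hφ : IsOpenEmbedding φ) (h : ∀ B : ℝ, ∃ z : ℝ × ℝ, φ z ∈ range g ∧ B < z.1) :
    ∃ u, g u ∉ range φ := by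
  by_contra! H
  -- If the loop stayed in the disk, its picture would be compact, hence bounded.
  have hK : IsCompact (range g) := hper.compact_of_continuous one_ne_zero hc
  have h2 : IsCompact (φ ⁻¹' range g) :=
    hφ.isEmbedding.isInducing.isCompact_preimage' hK (range_subset_iff.2 H)
  obtain ⟨B, hB⟩ := (h2.image continuous_fst).bddAbove
  obtain ⟨z, hz, hlt⟩ := h B
  exact absurd (hB ⟨z, hz, rfl⟩) (not_le.2 hlt)

/-- During the times `[a₀, a₁]` the loop `g` runs once along the graph of `h`, in the disk `φ`, over
the interval `[m, n]`, and its first coordinate is `ξ`. -/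
structure Pass (g : ℝ → F) (φ : ℝ × ℝ → F) (h ξ : ℝ → ℝ) (m n a₀ a₁ : ℝ) : Prop where
  lt : a₀ < a₁
  cont : ContinuousOn ξ (Icc a₀ a₁)
  ends : (StrictMonoOn ξ (Icc a₀ a₁) ∧ ξ a₀ = m ∧ ξ a₁ = n) ∨
    (StrictAntiOn ξ (Icc a₀ a₁) ∧ ξ a₀ = n ∧ ξ a₁ = m)
  apply : ∀ u ∈ Icc a₀ a₁, g u = φ (ξ u, h (ξ u))

namespace Pass

variable {g : ℝ → F} {φ : ℝ × ℝ → F} {h ξ : ℝ → ℝ} {m n a₀ a₁ : ℝ} (hp : Pass g φ h ξ m n a₀ a₁)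
include hp

theorem injOn : InjOn ξ (Icc a₀ a₁) := hp.ends.elim (fun h => h.1.injOn) fun h => h.1.injOn

theorem mem_Icc {u : ℝ} (hu : u ∈ Icc a₀ a₁) : ξ u ∈ Icc m n := by
  have hl := left_mem_Icc.2 hp.lt.le
  have hr := right_mem_Icc.2 hp.lt.le
  rcases hp.ends with ⟨h, rfl, rfl⟩ | ⟨h, rfl, rfl⟩
  · exact ⟨h.monotoneOn hl hu hu.1, h.monotoneOn hu hr hu.2⟩
  · exact ⟨h.antitoneOn hu hr hu.2, h.antitoneOn hl hu hu.1⟩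

theorem exists_Icc {x : ℝ} (hx : x ∈ Icc m n) : ∃ u ∈ Icc a₀ a₁, ξ u = x := by
  rcases hp.ends with ⟨h, rfl, rfl⟩ | ⟨h, rfl, rfl⟩
  · exact intermediate_value_Icc hp.lt.le hp.cont hx
  · exact intermediate_value_Icc' hp.lt.le hp.cont hx

theorem mem_Ioo {u : ℝ} (hu : u ∈ Icc a₀ a₁) (hx : ξ u ∈ Ioo m n) : u ∈ Ioo a₀ a₁ := by
  refine ⟨lt_of_le_of_ne hu.1 ?_, lt_of_le_of_ne hu.2 ?_⟩ <;> rintro rfl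
  · rcases hp.ends with ⟨-, h, -⟩ | ⟨-, h, -⟩
    · exact hx.1.ne' h
    · exact hx.2.ne h
  · rcases hp.ends with ⟨-, -, h⟩ | ⟨-, -, h⟩
    · exact hx.2.ne h
    · exact hx.1.ne' h

theorem exists_Ioo {x : ℝ} (hx : x ∈ Ioo m n) : ∃ u ∈ Ioo a₀ a₁, ξ u = x := by
  obtain ⟨u, hu, rfl⟩ := hp.exists_Icc (Ioo_subset_Icc_self hx)
  exact ⟨u, hp.mem_Ioo hu hx, rfl⟩

theorem monoOn : StrictMonoOn ξ (Ioo a₀ a₁) ∨ StrictAntiOn ξ (Ioo a₀ a₁) :=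
  hp.ends.imp (fun h => h.1.mono Ioo_subset_Icc_self) fun h => h.1.mono Ioo_subset_Icc_self

theorem continuousAt {u : ℝ} (hu : u ∈ Ioo a₀ a₁) : ContinuousAt ξ u :=
  hp.cont.continuousAt (Icc_mem_nhds hu.1 hu.2)

theorem translate (hper : Function.Periodic g 1) (k : ℤ) :
    Pass g φ h (fun u => ξ (u - k)) m n (a₀ + k) (a₁ + k) where
  lt := by linarith [hp.lt]
  cont := hp.cont.comp (by fun_prop) fun u hu => ⟨by linarith [hu.1], by linarith [hu.2]⟩
  ends := by
    simp only [add_sub_cancel_right]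
    refine hp.ends.imp (fun h => ⟨fun x hx y hy hxy => ?_, h.2⟩) fun h => ⟨fun x hx y hy hxy => ?_, h.2⟩
    all_goals
      exact h.1 ⟨by linarith [hx.1], by linarith [hx.2]⟩ ⟨by linarith [hy.1], by linarith [hy.2]⟩
        (by linarith)
  apply := fun u hu => by
    have := add_int_of_periodic hper (u - k) k
    rw [sub_add_cancel] at this
    rw [this, hp.apply _ ⟨by linarith [hu.1], by linarith [hu.2]⟩]

end Pass

/-- Restriction of a strand to an interval of values. -/
theorem Strand.exists_pass [T2Space F] {φ : ℝ × ℝ → F} (hφ : IsOpenEmbedding φ) {g : ℝ → F} {W : Set F}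
    {h : ℝ → ℝ} {J : Set ℝ} {α β : ℝ} (hS : Strand g W (φ '' graphIn V h) (absc φ) J α β)
    (hgc : Continuous g) {m n : ℝ} (hmn : m < n) (hm : m ∈ J) (hn : n ∈ J) :
    ∃ a₀ a₁, α < a₀ ∧ a₁ < β ∧ Pass g φ h (absc φ ∘ g) m n a₀ a₁ ∧
      ∀ u ∈ Ioo α β, (u ∈ Icc a₀ a₁ ↔ absc φ (g u) ∈ Icc m n) := by
  have hc : ContinuousOn (absc φ ∘ g) (Ioo α β) := by
    have : ContinuousOn (absc φ) (range φ) := continuous_fst.comp_continuousOn (continuousOn_invFun hφ)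
    exact this.comp hgc.continuousOn fun u hu => image_subset_range _ _ (hS.mem u hu)
  rw [← hS.image] at hm hn
  obtain ⟨s, hs, rfl⟩ := hm
  obtain ⟨t, ht, rfl⟩ := hn
  rcases hS.mono with h | h
  · have hst := (h.lt_iff_lt hs ht).1 hmn
    have hsub : Icc s t ⊆ Ioo α β := fun u hu => ⟨hs.1.trans_le hu.1, hu.2.trans_lt ht.2⟩
    refine ⟨s, t, hs.1, ht.2, ⟨hst, hc.mono hsub, Or.inl ⟨h.mono hsub, rfl, rfl⟩,
      fun u hu => hS.apply_eq hφ (hsub hu)⟩, fun u hu => ?_⟩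
    exact and_congr (h.le_iff_le hs hu).symm (h.le_iff_le hu ht).symm
  · have hst := (h.lt_iff_gt hs ht).1 hmn
    have hsub : Icc t s ⊆ Ioo α β := fun u hu => ⟨ht.1.trans_le hu.1, hu.2.trans_lt hs.2⟩
    refine ⟨t, s, ht.1, hs.2, ⟨hst, hc.mono hsub, Or.inr ⟨h.mono hsub, rfl, rfl⟩,
      fun u hu => hS.apply_eq hφ (hsub hu)⟩, fun u hu => ?_⟩
    exact and_comm.trans (and_congr (h.le_iff_ge hs hu).symm (h.le_iff_ge hu ht).symm)

/-! ### Curves with an arc system, and pictures of moves -/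

variable {F : Type*} [TopologicalSpace F] [T2Space F]

/-- The curve `C` is traversed by a generic loop that has an arc system. -/
def HasArcSystem (C : Set F) : Prop :=
  ∃ (g : ℝ → F) (L : Set (ℝ × ℝ)), GenericLoop g ∧ range g = C ∧ ArcSystem g L

/-- This identifies, modulo the period, all times at which the loop runs on the graph over `[m, n]`
with the times of one pass. -/
theorem GraphPicture.mem_Zone {ι : Type*} [Finite ι] {V : Set (ℝ × ℝ)} {f : ι → ℝ → ℝ}
    (hf : GraphPicture V f) {φ : ℝ × ℝ → F} (hφ : IsOpenEmbedding φ) {g : ℝ → F}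
    (hg : GenericLoop g) (hP : ∀ z ∈ V, φ z ∈ range g ↔ ∃ i, z.2 = f i z.1) {i : ι} {α β : ℝ}
    (hS : Strand g (φ '' V) (φ '' graphIn V (f i)) (absc φ) {x | (x, f i x) ∈ V} α β) (hne : α < β)
    {a₀ a₁ m n : ℝ} (hI : ∀ u ∈ Ioo α β, (u ∈ Icc a₀ a₁ ↔ absc φ (g u) ∈ Icc m n)) {u : ℝ}
    (hu : RunsOn g (φ '' graphIn V (f i)) u) (hx : absc φ (g u) ∈ Icc m n) : u ∈ Zone a₀ a₁ := by
  obtain ⟨k, hk⟩ := hf.exists_mem hφ hg hP hS hne hu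
  exact ⟨k, (hI _ hk).2 (by rwa [hg.add_int])⟩

theorem Pass.transverse {g : ℝ → F} {φ : ℝ × ℝ → F} {h ξ : ℝ → ℝ} {m n a₀ a₁ : ℝ}
    (hp : Pass g φ h ξ m n a₀ a₁) (hφ : IsOpenEmbedding φ) {u : ℝ} (hu : u ∈ Ioo a₀ a₁) {h₂ : ℝ → ℝ}
    {σ : ℝ} (hσ : σ = 1 ∨ σ = -1) (hslope : ∀ᶠ y in 𝓝 (ξ u),
      h y = h (ξ u) + σ * (y - ξ u) ∧ h₂ y = h (ξ u) - σ * (y - ξ u))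
    (h₂g : ∀ᶠ y in 𝓝 (ξ u), φ (y, h₂ y) ∈ range g) : Transverse g u :=
  transverse_of_graph hφ hu rfl hp.monoOn (hp.continuousAt hu)
    (fun w hw => hp.apply w (Ioo_subset_Icc_self hw)) hσ hslope h₂g

/-- The two pictures agree outside `B`, and the two curves agree outside the disk. -/
theorem replaces_iff {L R B : Set (ℝ × ℝ)} {C C' : Set F} {φ : ℝ × ℝ → F}
    (hL : φ ⁻¹' C = L) (hR : φ ⁻¹' C' = R) (hd : C \ range φ = C' \ range φ)
    (hLR : ∀ z, z ∉ B → (z ∈ L ↔ z ∈ R)) (q : F) (hq : q ∉ φ '' B) : q ∈ C ↔ q ∈ C' := by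
  by_cases hqφ : q ∈ range φ
  · obtain ⟨z, rfl⟩ := hqφ
    have := hLR z fun hz => hq ⟨z, hz, rfl⟩
    rwa [← hL, ← hR] at this
  · constructor
    · intro h
      exact (hd ▸ (⟨h, hqφ⟩ : q ∈ C \ range φ) : q ∈ C' \ range φ).1
    · intro h
      exact (hd ▸ (⟨h, hqφ⟩ : q ∈ C' \ range φ) : q ∈ C \ range φ).1

/-! ### Triangle moves -/

/-- The functions whose graphs form the triangle pictures: `ε = -1` below, `ε = 1` above. -/
noncomputable def triFun (ε : ℝ) : Fin 3 → ℝ → ℝ := ![fun x => x, fun x => -x, fun x => ε * max 0 (1 - |x|)]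

/-- The first coordinates of the crossings in the triangle pictures. -/
noncomputable def triPt (ε : ℝ) : Fin 3 → Fin 3 → ℝ := ![![0, 0, ε / 2], ![0, 0, -(ε / 2)], ![ε / 2, -(ε / 2), 0]]

theorem triPt_comm (ε : ℝ) (i j : Fin 3) : triPt ε i j = triPt ε j i := by
  fin_cases i <;> fin_cases j <;> simp [triPt]

theorem triPt_mem {ε : ℝ} (hε : ε = 1 ∨ ε = -1) (i j : Fin 3) : triPt ε i j ∈ Ioo (-2 : ℝ) 2 := by
  rcases hε with rfl | rfl <;> fin_cases i <;> fin_cases j <;> norm_num [triPt]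

theorem triFun_bound {ε : ℝ} (hε : ε = 1 ∨ ε = -1) (i : Fin 3) {x : ℝ} (hx : x ∈ Icc (-2 : ℝ) 2) :
    triFun ε i x ∈ Icc (-2 : ℝ) 2 := by
  obtain ⟨h1, h2⟩ := hx
  have h3 : max 0 (1 - |x|) ≤ 1 := max_le zero_le_one (by linarith [abs_nonneg x])
  have h4 : 0 ≤ max 0 (1 - |x|) := le_max_left _ _
  rcases hε with rfl | rfl <;> fin_cases i <;> simp only [triFun, Fin.zero_eta, Fin.mk_one,
    Fin.reduceFinMk, Matrix.cons_val, mem_Icc] <;> constructor <;> linarith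

theorem triFun_eq_iff {ε : ℝ} (hε : ε = 1 ∨ ε = -1) {i j : Fin 3} (hij : i ≠ j) (x : ℝ) :
    triFun ε i x = triFun ε j x ↔ x = triPt ε i j := by
  have e01 : x = -x ↔ x = 0 := ⟨fun h => by linarith, fun h => by rw [h]; simp⟩
  have e02 : x = ε * max 0 (1 - |x|) ↔ x = ε / 2 := by
    rcases hε with rfl | rfl
    all_goals
      rcases abs_cases x with ⟨h, h'⟩ | ⟨h, h'⟩ <;> rcases max_cases 0 (1 - |x|) with ⟨h1, h2⟩ | ⟨h1, h2⟩ <;>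
        rw [h1] <;> constructor <;> intro h3 <;> linarith
  have e12 : -x = ε * max 0 (1 - |x|) ↔ x = -(ε / 2) := by
    rcases hε with rfl | rfl
    all_goals
      rcases abs_cases x with ⟨h, h'⟩ | ⟨h, h'⟩ <;> rcases max_cases 0 (1 - |x|) with ⟨h1, h2⟩ | ⟨h1, h2⟩ <;>
        rw [h1] <;> constructor <;> intro h3 <;> linarith
  fin_cases i <;> fin_cases j <;> simp [triFun, triPt] at hij ⊢
  · exact e01
  · exact e02
  · rw [eq_comm]; exact e01
  · exact e12
  · rw [eq_comm]; exact e02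
  · rw [eq_comm]; exact e12

/-- The crossings of the third graph with the diagonals have abscissas `±1/2`, well inside the
ranges where it is affine with slope `1` or `-1`, opposite to the slope of the diagonal. -/
theorem triFun_slope {ε : ℝ} (hε : ε = 1 ∨ ε = -1) {i j : Fin 3} (hij : i ≠ j) {x : ℝ}
    (hx : x = triPt ε i j) : ∃ σ : ℝ, (σ = 1 ∨ σ = -1) ∧ ∀ᶠ y in 𝓝 x,
      triFun ε i y = triFun ε i x + σ * (y - x) ∧ triFun ε j y = triFun ε i x - σ * (y - x) := by
  have hcomm : ∀ i j : Fin 3, i ≠ j → ∀ σ : ℝ, (σ = 1 ∨ σ = -1) → x = triPt ε i j → (∀ᶠ y in 𝓝 x,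
      triFun ε i y = triFun ε i x + σ * (y - x) ∧ triFun ε j y = triFun ε i x - σ * (y - x)) →
      ∃ σ : ℝ, (σ = 1 ∨ σ = -1) ∧ ∀ᶠ y in 𝓝 x,
      triFun ε j y = triFun ε j x + σ * (y - x) ∧ triFun ε i y = triFun ε j x - σ * (y - x) := by
    intro i j hij σ hσ hx h
    refine ⟨-σ, by rcases hσ with rfl | rfl <;> simp, h.mono fun y hy => ?_⟩
    rw [← (triFun_eq_iff hε hij x).2 hx, hy.1, hy.2]
    constructor <;> ring
  have c01 : x = triPt ε 0 1 → ∀ᶠ y in 𝓝 x,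
      triFun ε 0 y = triFun ε 0 x + 1 * (y - x) ∧ triFun ε 1 y = triFun ε 0 x - 1 * (y - x) := by
    intro hx
    have hx : x = 0 := by simpa [triPt] using hx
    refine Eventually.of_forall fun y => ?_
    simp [triFun, hx]
  have near : ∀ c : ℝ, ∀ᶠ y in 𝓝 c, y ∈ Ioo (c - 1 / 4) (c + 1 / 4) := fun c =>
    Ioo_mem_nhds (by linarith) (by linarith)
  have c02 : x = triPt ε 0 2 → ∀ᶠ y in 𝓝 x,
      triFun ε 0 y = triFun ε 0 x + 1 * (y - x) ∧ triFun ε 2 y = triFun ε 0 x - 1 * (y - x) := by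
    intro hx
    have hx : x = ε / 2 := by simpa [triPt] using hx
    filter_upwards [near x] with y hy
    obtain ⟨h1, h2⟩ := hy
    simp only [triFun, Matrix.cons_val]
    rcases hε with rfl | rfl
    · rw [abs_of_pos (by linarith), max_eq_right (by linarith)]
      constructor <;> linarith
    · rw [abs_of_neg (by linarith), max_eq_right (by linarith)]
      constructor <;> linarith
  have c12 : x = triPt ε 1 2 → ∀ᶠ y in 𝓝 x,
      triFun ε 1 y = triFun ε 1 x + -1 * (y - x) ∧ triFun ε 2 y = triFun ε 1 x - -1 * (y - x) := by
    intro hx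
    have hx : x = -(ε / 2) := by simpa [triPt] using hx
    filter_upwards [near x] with y hy
    obtain ⟨h1, h2⟩ := hy
    simp only [triFun, Matrix.cons_val]
    rcases hε with rfl | rfl
    · rw [abs_of_neg (by linarith), max_eq_right (by linarith)]
      constructor <;> linarith
    · rw [abs_of_pos (by linarith), max_eq_right (by linarith)]
      constructor <;> linarith
  fin_cases i <;> fin_cases j
  · exact absurd rfl hij
  · exact ⟨1, Or.inl rfl, c01 hx⟩
  · exact ⟨1, Or.inl rfl, c02 hx⟩
  · exact hcomm 0 1 (by decide) 1 (Or.inl rfl) (hx.trans (triPt_comm _ _ _)) (c01 (hx.trans (triPt_comm _ _ _)))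
  · exact absurd rfl hij
  · exact ⟨-1, Or.inr rfl, c12 hx⟩
  · exact hcomm 0 2 (by decide) 1 (Or.inl rfl) (hx.trans (triPt_comm _ _ _)) (c02 (hx.trans (triPt_comm _ _ _)))
  · exact hcomm 1 2 (by decide) (-1) (Or.inr rfl) (hx.trans (triPt_comm _ _ _)) (c12 (hx.trans (triPt_comm _ _ _)))
  · exact absurd rfl hij

theorem graphPicture_triFun {ε : ℝ} (hε : ε = 1 ∨ ε = -1) : GraphPicture univ (triFun ε) where
  isOpen := isOpen_univ
  cont := by
    intro i
    fin_cases i <;> simp [triFun] <;> fun_prop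
  ord := by simp [ordConnected_univ]
  cross := by
    intro i j hij x _ hx
    have hx' := (triFun_eq_iff hε hij x).1 hx
    obtain ⟨σ, hσ, h⟩ := triFun_slope hε hij hx'
    refine ⟨σ, hσ, h, fun k hki hkj hk => ?_⟩
    have h1 := (triFun_eq_iff hε hki x).1 hk
    rw [hx'] at h1
    revert h1
    fin_cases i <;> fin_cases j <;> fin_cases k <;> simp [triPt] at hij hki hkj ⊢
    all_goals rcases hε with rfl | rfl <;> norm_num

/-- The square outside of which the pictures of the moves agree. -/
def box : Set (ℝ × ℝ) := Icc (-2) 2 ×ˢ Icc (-2) 2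

theorem isClosed_box {φ : ℝ × ℝ → F} (hφ : IsOpenEmbedding φ) : IsClosed (φ '' box) :=
  ((isCompact_Icc.prod isCompact_Icc).image hφ.continuous).isClosed

section

variable {g : ℝ → F} {φ : ℝ × ℝ → F} {ε : ℝ} {ξ : ℝ → ℝ} {a b : Fin 3 → ℝ}

/-- In a triangle picture, coincidences of values are crossings. -/
theorem crossing_of_eq (hφ : IsOpenEmbedding φ) (hε : ε = 1 ∨ ε = -1) (hper : Function.Periodic g 1)
    (hp : ∀ l, Pass g φ (triFun ε l) ξ (-2) 2 (a l) (b l))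
    (hZ : ∀ u, g u ∈ φ '' box → ∃ l, u ∈ Zone (a l) (b l)) {i : Fin 3} {u v : ℝ}
    (hu : u ∈ Icc (a i) (b i)) (h : g u = g v) :
    (∃ k : ℤ, v = u + k) ∨ ∃ l, l ≠ i ∧ ξ u = triPt ε i l ∧
      ∃ k : ℤ, v + k ∈ Icc (a l) (b l) ∧ ξ (v + k) = triPt ε i l := by
  have hgu := (hp i).apply u hu
  have hx := (hp i).mem_Icc hu
  obtain ⟨l, k, hk⟩ := hZ v (h ▸ hgu ▸ mem_image_of_mem φ ⟨hx, triFun_bound hε i hx⟩)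
  have hgv := (hp l).apply _ hk
  rw [add_int_of_periodic hper, ← h, hgu] at hgv
  have h1 := hφ.injective hgv
  rw [Prod.mk.injEq] at h1
  by_cases hl : l = i
  · subst hl
    have := (hp l).injOn hu hk h1.1
    exact Or.inl ⟨-k, by rw [this]; push_cast; ring⟩
  · have h2 := (triFun_eq_iff hε (Ne.symm hl) (ξ u)).1 (by rw [h1.2, h1.1])
    exact Or.inr ⟨l, hl, h2, k, hk, h1.1 ▸ h2⟩

/-- Three disjoint passes along the three graphs, in cyclic order `i`, `j`, `k`, give the
combinatorial data of a triangle. `P i l` is the time on the strand `i` of its crossing with the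
strand `l`. -/
theorem triangle_of_pass (hφ : IsOpenEmbedding φ) (hε : ε = 1 ∨ ε = -1) (hper : Function.Periodic g 1)
    (hp : ∀ l, Pass g φ (triFun ε l) ξ (-2) 2 (a l) (b l))
    (hZ : ∀ u, g u ∈ φ '' box → ∃ l, u ∈ Zone (a l) (b l)) {i j k : Fin 3} (hij : i ≠ j)
    (hjk : j ≠ k) (hki : k ≠ i) (h1 : b i < a j) (h2 : b j < a k) (h3 : b k < a i + 1) :
    ∃ pa pb qb qc rc ra, Triangle g (a i) (b i) (a j) (b j) (a k) (b k) pa pb qb qc rc ra := by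
  have hall : ∀ l, l = i ∨ l = j ∨ l = k := by
    clear h1 h2 h3
    revert i j k; decide
  choose P hP hPξ using fun i l => (hp i).exists_Ioo (triPt_mem hε i l)
  have heq : ∀ i l, i ≠ l → g (P i l) = g (P l i) := by
    intro i l hil
    rw [(hp i).apply _ (Ioo_subset_Icc_self (hP i l)), (hp l).apply _ (Ioo_subset_Icc_self (hP l i)),
      hPξ, hPξ, triPt_comm ε l i, (triFun_eq_iff hε hil _).2 rfl]
  have honly : ∀ i u, u ∈ Icc (a i) (b i) → ∀ v, g u = g v → (∃ k : ℤ, v = u + k) ∨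
      ∃ l, l ≠ i ∧ u = P i l ∧ ∃ k : ℤ, v = P l i + k := by
    intro i u hu v huv
    refine (crossing_of_eq hφ hε hper hp hZ hu huv).imp_right ?_
    rintro ⟨l, hl, hx, m, hm, hx'⟩
    refine ⟨l, hl, (hp i).injOn hu (Ioo_subset_Icc_self (hP i l)) (hx.trans (hPξ i l).symm), -m, ?_⟩
    have := (hp l).injOn hm (Ioo_subset_Icc_self (hP l i))
      (hx'.trans ((triPt_comm ε i l).trans (hPξ l i).symm))
    rw [← this]; push_cast; ring
  refine ⟨P i j, P j i, P j k, P k j, P k i, P i k, ⟨hP _ _, hP _ _, hP _ _, hP _ _, hP _ _, hP _ _,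
    h1, h2, h3⟩, heq _ _ hij, heq _ _ hjk, heq _ _ hki, ?_, ?_, ?_⟩
  · intro u hu v huv
    rcases honly i u hu v huv with ⟨m, hm⟩ | ⟨l, hl, hul, m, hm⟩
    · exact ⟨m, Or.inl hm⟩
    · rcases hall l with rfl | rfl | rfl
      · exact absurd rfl hl
      · exact ⟨m, Or.inr (Or.inl ⟨hul, hm⟩)⟩
      · exact ⟨m, Or.inr (Or.inr ⟨hul, hm⟩)⟩
  · intro u hu v huv
    rcases honly j u hu v huv with ⟨m, hm⟩ | ⟨l, hl, hul, m, hm⟩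
    · exact ⟨m, Or.inl hm⟩
    · rcases hall l with rfl | rfl | rfl
      · exact ⟨m, Or.inr (Or.inl ⟨hul, hm⟩)⟩
      · exact absurd rfl hl
      · exact ⟨m, Or.inr (Or.inr ⟨hul, hm⟩)⟩
  · intro u hu v huv
    rcases honly k u hu v huv with ⟨m, hm⟩ | ⟨l, hl, hul, m, hm⟩
    · exact ⟨m, Or.inl hm⟩
    · rcases hall l with rfl | rfl | rfl
      · exact ⟨m, Or.inr (Or.inr ⟨hul, hm⟩)⟩
      · exact ⟨m, Or.inr (Or.inl ⟨hul, hm⟩)⟩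
      · exact absurd rfl hl

/-- In a triangle picture, double points are transverse. -/
theorem exists_transverse_times (hφ : IsOpenEmbedding φ) (hε : ε = 1 ∨ ε = -1)
    (hper : Function.Periodic g 1) (hp : ∀ l, Pass g φ (triFun ε l) ξ (-2) 2 (a l) (b l))
    (hZ : ∀ u, g u ∈ φ '' box → ∃ l, u ∈ Zone (a l) (b l))
    (hP : ∀ z ∈ box, φ z ∈ range g ↔ ∃ i, z.2 = triFun ε i z.1) :
    ∃ T : Set ℝ, T.Finite ∧ (∀ u, g u ∈ φ '' box → DoubleTime g u → ∃ τ ∈ T, ∃ k : ℤ, u = τ + k) ∧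
      ∀ τ ∈ T, Transverse g τ := by
  refine ⟨⋃ i, ⋃ l, {u | u ∈ Icc (a i) (b i) ∧ i ≠ l ∧ ξ u = triPt ε i l}, ?_, ?_, ?_⟩
  · refine finite_iUnion fun i => finite_iUnion fun l => Subsingleton.finite ?_
    rintro u ⟨hu, -, hx⟩ v ⟨hv, -, hy⟩
    exact (hp i).injOn hu hv (hx.trans hy.symm)
  · rintro u hu ⟨s, hs, hk⟩
    obtain ⟨i, m, hm⟩ := hZ u hu
    rcases crossing_of_eq hφ hε hper hp hZ hm ((add_int_of_periodic hper u m).trans hs.symm) with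
      ⟨n, hn⟩ | ⟨l, hl, hx, -⟩
    · exact absurd (by rw [hn]; push_cast; ring) (hk (m + n))
    · refine ⟨u + m, ?_, -m, by push_cast; ring⟩
      simp only [mem_iUnion]
      exact ⟨i, l, hm, hl.symm, hx⟩
  · intro u hu
    simp only [mem_iUnion] at hu
    obtain ⟨i, l, hu, hil, hx⟩ := hu
    have hx2 := triPt_mem hε i l
    rw [← hx] at hx2
    obtain ⟨σ, hσ, hslope⟩ := triFun_slope hε hil hx
    refine (hp i).transverse hφ ((hp i).mem_Ioo hu hx2) hσ hslope ?_
    filter_upwards [Ioo_mem_nhds hx2.1 hx2.2] with y hy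
    have hy' := Ioo_subset_Icc_self hy
    exact (hP _ ⟨hy', triFun_bound hε l hy'⟩).2 ⟨l, rfl⟩

end

/-- Disjoint intervals on the circle have a cyclic order. All starts are translated into the period
beginning at `a 0`, so only the order of the two other intervals is open. -/
theorem exists_ordered {a b : Fin 3 → ℝ} (hab : ∀ l, a l < b l)
    (hdisj : ∀ i j, i ≠ j → ∀ u, u ∈ Zone (a i) (b i) → u ∉ Zone (a j) (b j)) :
    ∃ m : Fin 3 → ℤ, ∃ i j k : Fin 3, i ≠ j ∧ j ≠ k ∧ k ≠ i ∧ b i + m i < a j + m j ∧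
      b j + m j < a k + m k ∧ b k + m k < a i + m i + 1 := by
  choose m hm using fun l => exists_add_int_mem_Ico (a 0) (a l)
  have hm0 : m 0 = 0 := by
    have h1 : m 0 < 1 := int_lt_of_real (by push_cast; linarith [(hm 0).2])
    have h2 : -1 < m 0 := int_lt_of_real (by push_cast; linarith [(hm 0).1])
    omega
  have hlt : ∀ i j, i ≠ j → ∀ n : ℤ, a i + m i ≤ a j + m j + n → b i + m i < a j + m j + n := by
    intro i j hij n h
    by_contra! H
    refine hdisj i j hij (a j) ⟨m j + n - m i, ?_, ?_⟩ ⟨0, ?_, ?_⟩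
    · push_cast; linarith
    · push_cast; linarith
    · simp
    · simpa using (hab j).le
  have h0 : (m 0 : ℝ) = 0 := by rw [hm0]; simp
  have key : ∀ j k : Fin 3, 0 ≠ j → j ≠ k → k ≠ 0 → a j + m j ≤ a k + m k →
      b 0 + m 0 < a j + m j ∧ b j + m j < a k + m k ∧ b k + m k < a 0 + m 0 + 1 := by
    intro j k h1 h2 h3 hle
    refine ⟨?_, ?_, ?_⟩
    · have := hlt 0 j h1 0 (by push_cast; linarith [(hm j).1]); simpa using this
    · have := hlt j k h2 0 (by simpa using hle); simpa using this
    · have := hlt k 0 h3 1 (by push_cast; linarith [(hm k).2]); simpa using this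
  rcases le_total (a 1 + m 1) (a 2 + m 2) with h | h
  · exact ⟨m, 0, 1, 2, by decide, by decide, by decide, key 1 2 (by decide) (by decide) (by decide) h⟩
  · exact ⟨m, 0, 2, 1, by decide, by decide, by decide, key 2 1 (by decide) (by decide) (by decide) h⟩

theorem mem_triangle_iff (z : ℝ × ℝ) :
    (z ∈ triangleBelow ↔ ∃ i, z.2 = triFun (-1) i z.1) ∧
      (z ∈ triangleAbove ↔ ∃ i, z.2 = triFun 1 i z.1) := by
  simp only [triangleBelow, triangleAbove, mem_ofPred_eq, Fin.exists_fin_succ, triFun]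
  constructor <;> simp

theorem triangle_agree (z : ℝ × ℝ) (hz : z ∉ box) : z ∈ triangleBelow ↔ z ∈ triangleAbove := by
  obtain ⟨x, y⟩ := z
  simp only [triangleBelow, triangleAbove, mem_ofPred_eq]
  rcases le_or_gt 1 |x| with h | h
  · rw [max_eq_left (by linarith)]; simp
  · rw [max_eq_right (by linarith)]
    have hb : ∀ w : ℝ, -2 ≤ w → w ≤ 2 → y ≠ w := by
      rintro w h1 h2 rfl
      exact hz ⟨⟨by linarith [neg_abs_le x], by linarith [le_abs_self x]⟩, ⟨h1, h2⟩⟩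
    have := abs_nonneg x
    simp only [hb x (by linarith [neg_abs_le x]) (by linarith [le_abs_self x]),
      hb (-x) (by linarith [le_abs_self x]) (by linarith [neg_abs_le x]),
      hb (-(1 - |x|)) (by linarith) (by linarith), hb (1 - |x|) (by linarith) (by linarith)]

/-- The loop follows each of the three graphs once, over `[-2, 2]`. Only the third strand has to be
changed, and the intervals of times are the same before and after, so that `ArcSystem.triangle`
compares the two triangles. -/
theorem HasArcSystem.move3 {C C' : Set F} (h : HasArcSystem C) (hM : Move3 C C') :
    HasArcSystem C' := by
  obtain ⟨g, L, hg, rfl, hL⟩ := h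
  obtain ⟨φ, hφ, hB, hA, hd⟩ := hM
  have hε : (-1 : ℝ) = 1 ∨ (-1 : ℝ) = -1 := Or.inr rfl
  have hf := graphPicture_triFun hε
  have hP : ∀ z ∈ univ, φ z ∈ range g ↔ ∃ i, z.2 = triFun (-1) i z.1 := by
    intro z _
    rw [← (mem_triangle_iff z).1, ← hB]; rfl
  have hout : ∃ u, g u ∉ φ '' univ := by
    rw [image_univ]
    refine exists_notMem_range hg.continuous hg.periodic hφ fun B => ⟨(B + 1, B + 1), ?_, by simp⟩
    exact (hP _ (mem_univ _)).2 ⟨0, by simp [triFun]⟩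
  have hstr : ∀ i, ∃ α β, α < β ∧ Strand g (φ '' univ) (φ '' graphIn univ (triFun (-1) i)) (absc φ)
      {x | (x, triFun (-1) i x) ∈ univ} α β := by
    -- The abscissa `2` lies to the right of all crossings.
    refine fun i => hf.exists_strand hφ hg hP hout i (x := 2) (mem_univ _) fun j hji h => ?_
    have := (triFun_eq_iff hε hji 2).1 h
    have h2 := (triPt_mem hε j i).2
    linarith
  choose α β hαβ hS using hstr
  have hps := fun i => (hS i).exists_pass hφ hg.continuous (show (-2 : ℝ) < 2 by norm_num) (mem_univ _) (mem_univ _)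
  choose a b hαa hbβ hp hI using hps
  -- If the times of two strands overlapped, the loop would lie on both graphs for a short while,
  -- although these graphs have only one common point.
  have hdisj : ∀ i j, i ≠ j → ∀ u, u ∈ Zone (a i) (b i) → u ∉ Zone (a j) (b j) := by
    rintro i j hij u ⟨m, hm⟩ ⟨n, hn⟩
    have hmi : u + m ∈ Ioo (α i) (β i) := ⟨(hαa i).trans_le hm.1, hm.2.trans_lt (hbβ i)⟩
    have hni : u + n ∈ Ioo (α j) (β j) := ⟨(hαa j).trans_le hn.1, hn.2.trans_lt (hbβ j)⟩
    have hall : ∀ w : ℝ, w + m ∈ Ioo (α i) (β i) → w + n ∈ Ioo (α j) (β j) →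
        absc φ (g w) = triPt (-1) i j := by
      intro w h1 h2
      have e1 := (hS i).apply_eq hφ h1
      have e2 := (hS j).apply_eq hφ h2
      rw [hg.add_int] at e1 e2
      have := hφ.injective (e1.symm.trans e2)
      rw [Prod.mk.injEq] at this
      exact (triFun_eq_iff hε hij _).1 this.2
    have h1 : ∀ᶠ w : ℝ in 𝓝 u, w + m ∈ Ioo (α i) (β i) ∧ w + n ∈ Ioo (α j) (β j) := by
      have c1 : Continuous fun w : ℝ => w + m := by fun_prop
      have c2 : Continuous fun w : ℝ => w + n := by fun_prop
      exact (c1.continuousAt.eventually (Ioo_mem_nhds hmi.1 hmi.2)).and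
        (c2.continuousAt.eventually (Ioo_mem_nhds hni.1 hni.2))
    obtain ⟨w, hw, hwu⟩ := (h1.filter_mono nhdsWithin_le_nhds).and
      (self_mem_nhdsWithin (a := u) (s := {u}ᶜ)) |>.exists
    have e := (hall w hw.1 hw.2).trans (hall u hmi hni).symm
    have := (hS i).injOn hw.1 hmi (by simp only [Function.comp, hg.add_int]; exact e)
    exact hwu (by simpa using this)
  have hZ : ∀ u, g u ∈ φ '' box → ∃ l, u ∈ Zone (a l) (b l) := by
    rintro u ⟨z, hz, hzu⟩
    obtain ⟨l, hl⟩ := hf.exists_runsOn hφ hg hP (u := u) ⟨z, mem_univ _, hzu⟩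
    refine ⟨l, hf.mem_Zone hφ hg hP (hS l) (hαβ l) (hI l) hl ?_⟩
    rw [← hzu, absc_apply hφ]; exact hz.1
  obtain ⟨m, i, j, k, hij, hjk, hki, o1, o2, o3⟩ := exists_ordered (fun l => (hp l).lt) hdisj
  -- The coordinate is read off from the periodic loop, so one function `ξ` serves for all
  -- translated passes.
  have hξ : ∀ n : ℤ, (fun u => (absc φ ∘ g) (u - n)) = absc φ ∘ g := by
    intro n; funext u
    have := hg.add_int (u - n) n
    rw [sub_add_cancel] at this
    simp only [Function.comp, this]
  generalize ha' : (fun l => a l + (m l : ℝ)) = a' at *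
  generalize hb' : (fun l => b l + (m l : ℝ)) = b' at *
  have haa : ∀ l, a' l = a l + m l := fun l => by rw [← ha']
  have hbb : ∀ l, b' l = b l + m l := fun l => by rw [← hb']
  have hp' : ∀ l, Pass g φ (triFun (-1) l) (absc φ ∘ g) (-2) 2 (a' l) (b' l) := by
    intro l
    have := (hp l).translate hg.periodic (m l)
    rwa [hξ, ← haa, ← hbb] at this
  have hzone : ∀ l, Zone (a' l) (b' l) = Zone (a l) (b l) := fun l => by rw [haa, hbb, Zone_add_int]
  simp only [← hzone] at hZ hdisj
  rw [← haa, ← hbb] at o1 o2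
  rw [← haa, ← hbb] at o3
  clear hp hI hξ
  generalize absc φ ∘ g = ξ at hp'
  have hlt1 : b' 2 < a' 2 + 1 := by
    have : b 2 - a 2 < 1 := by linarith [hαa 2, hbβ 2, (hS 2).le]
    rw [haa, hbb]; linarith
  -- At the ends of the pass the third graph has the same height in both pictures, so the new piece
  -- fits.
  have hmax : ∀ x : ℝ, (x = 2 ∨ x = -2) → triFun 1 2 x = triFun (-1) 2 x := by
    rintro x (rfl | rfl) <;> norm_num [triFun]
  have hend : ∀ u, u = a' 2 ∨ u = b' 2 → (ξ u = 2 ∨ ξ u = -2) := by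
    rintro u (rfl | rfl) <;> rcases (hp' 2).ends with ⟨-, h1, h2⟩ | ⟨-, h1, h2⟩ <;> simp [h1, h2]
  have hl := left_mem_Icc.2 (hp' 2).lt.le
  have hr := right_mem_Icc.2 (hp' 2).lt.le
  have hc2 : Continuous (triFun 1 2) := (graphPicture_triFun (Or.inl rfl)).cont 2
  obtain ⟨g', hc', hper', hin, hoff⟩ := exists_replace hg.continuous hg.periodic
    (γ := fun u => φ (ξ u, triFun 1 2 (ξ u))) (hp' 2).lt.le hlt1
    (hφ.continuous.comp_continuousOn ((hp' 2).cont.prodMk (hc2.comp_continuousOn (hp' 2).cont)))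
    (by rw [(hp' 2).apply _ hl, hmax _ (hend _ (Or.inl rfl))])
    (by rw [(hp' 2).apply _ hr, hmax _ (hend _ (Or.inr rfl))])
  have h1ε : (1 : ℝ) = 1 ∨ (1 : ℝ) = -1 := Or.inl rfl
  have hfix : ∀ l : Fin 3, l ≠ 2 → triFun (-1) l = triFun 1 l := by
    intro l hl; fin_cases l
    · rfl
    · rfl
    · exact absurd rfl hl
  have hpass : ∀ l, Pass g' φ (triFun 1 l) ξ (-2) 2 (a' l) (b' l) := by
    intro l
    refine ⟨(hp' l).lt, (hp' l).cont, (hp' l).ends, fun u hu => ?_⟩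
    by_cases hl2 : l = 2
    · subst hl2; exact hin u hu
    · rw [hoff u (hdisj l 2 hl2 u (mem_Zone_of_mem hu)), (hp' l).apply u hu, hfix l hl2]
  have hQ : ∀ u ∈ Icc (a' 2) (b' 2), g u ∈ φ '' box := fun u hu => by
    have := (hp' 2).mem_Icc hu
    exact ⟨_, ⟨this, triFun_bound hε 2 this⟩, ((hp' 2).apply u hu).symm⟩
  have hQ' : ∀ u ∈ Icc (a' 2) (b' 2), g' u ∈ φ '' box := fun u hu => by
    have := (hpass 2).mem_Icc hu
    exact ⟨_, ⟨this, triFun_bound h1ε 2 this⟩, ((hpass 2).apply u hu).symm⟩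
  have hZ' : ∀ u, g' u ∈ φ '' box → ∃ l, u ∈ Zone (a' l) (b' l) := fun u hu =>
    hZ u ((mem_iff_of_modify hg.periodic hper' hQ hQ' hoff u).2 hu)
  have hP' : ∀ z ∈ box, φ z ∈ range g' ↔ ∃ i, z.2 = triFun 1 i z.1 := by
    intro z hz
    constructor
    · rintro ⟨u, hu⟩
      obtain ⟨l, n, hn⟩ := hZ' u (hu ▸ mem_image_of_mem φ hz)
      have := (hpass l).apply _ hn
      rw [add_int_of_periodic hper', hu] at this
      have := hφ.injective this
      exact ⟨l, by rw [this]⟩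
    · rintro ⟨l, hl⟩
      obtain ⟨u, hu, hx⟩ := (hpass l).exists_Icc hz.1
      refine ⟨u, ?_⟩
      rw [(hpass l).apply u hu, hx, ← hl]
  obtain ⟨T, hT, hdT, hTt⟩ := exists_transverse_times hφ h1ε hper' hpass hZ' hP'
  have hg' := genericLoop_of_modify hg hc' hper' (isClosed_box hφ) hQ hQ' hoff hT hdT hTt
  have hrange : range g' = C' := by
    refine range_of_modify hg.periodic hper' hQ hQ' hoff (replaces_iff hB hA hd triangle_agree) ?_
    rintro _ ⟨z, hz, rfl⟩
    rw [hP' z hz, ← (mem_triangle_iff z).2, ← hA]; rfl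
  obtain ⟨pa, pb, qb, qc, rc, ra, hT1⟩ := triangle_of_pass hφ hε hg.periodic hp' hZ hij hjk hki o1 o2 o3
  obtain ⟨pa', pb', qb', qc', rc', ra', hT2⟩ :=
    triangle_of_pass hφ h1ε hper' hpass hZ' hij hjk hki o1 o2 o3
  obtain ⟨L', hL'⟩ := hL.triangle hg.periodic hper' hT1 hT2 fun u hu => hoff u fun h2 => hu (by
    have : (2 : Fin 3) = i ∨ (2 : Fin 3) = j ∨ (2 : Fin 3) = k := by
      clear hT1 hT2 o1 o2 o3 hu
      revert i j k; decide
    rcases this with h | h | h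
    · exact Or.inl (Or.inl (h ▸ h2))
    · exact Or.inl (Or.inr (h ▸ h2))
    · exact Or.inr (h ▸ h2))
  exact ⟨g', L', hg', hrange, hL'⟩

/-! ### Creating a kink -/

variable {F : Type*} [TopologicalSpace F] [T2Space F]

/-- A parametrization of the kink. -/
noncomputable def kinkPath (τ : ℝ) : ℝ × ℝ :=
  (max (τ - 2) (min (τ + 2) (-τ)), max 0 (min 2 (3 - |τ|)))

theorem continuous_kinkPath : Continuous kinkPath := by
  unfold kinkPath; fun_prop

theorem kinkPath_of_le_neg_three {τ : ℝ} (h : τ ≤ -3) : kinkPath τ = (τ + 2, 0) := by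
  rw [kinkPath, abs_of_neg (by linarith), min_eq_left (by linarith), max_eq_right (by linarith),
    min_eq_right (by linarith), max_eq_left (by linarith)]

theorem kinkPath_of_le_neg_one {τ : ℝ} (h : -3 ≤ τ) (h' : τ ≤ -1) : kinkPath τ = (τ + 2, τ + 3) := by
  rw [kinkPath, abs_of_neg (by linarith), min_eq_left (by linarith), max_eq_right (by linarith),
    min_eq_right (by linarith), max_eq_right (by linarith)]
  congr 1; ring

theorem kinkPath_of_le_one {τ : ℝ} (h : -1 ≤ τ) (h' : τ ≤ 1) : kinkPath τ = (-τ, 2) := by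
  rw [kinkPath, min_eq_right (by linarith), max_eq_right (by linarith),
    min_eq_left (by linarith [abs_le.2 ⟨h, h'⟩]), max_eq_right (by linarith)]

theorem kinkPath_of_le_three {τ : ℝ} (h : 1 ≤ τ) (h' : τ ≤ 3) : kinkPath τ = (τ - 2, 3 - τ) := by
  rw [kinkPath, abs_of_pos (by linarith), min_eq_right (by linarith), max_eq_left (by linarith),
    min_eq_right (by linarith), max_eq_right (by linarith)]

theorem kinkPath_of_three_le {τ : ℝ} (h : 3 ≤ τ) : kinkPath τ = (τ - 2, 0) := by
  rw [kinkPath, abs_of_pos (by linarith), min_eq_right (by linarith), max_eq_left (by linarith),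
    min_eq_right (by linarith), max_eq_left (by linarith)]

theorem kinkPath_cases (τ : ℝ) : (τ ≤ -3 ∧ kinkPath τ = (τ + 2, 0)) ∨
    (-3 ≤ τ ∧ τ ≤ -1 ∧ kinkPath τ = (τ + 2, τ + 3)) ∨ (-1 ≤ τ ∧ τ ≤ 1 ∧ kinkPath τ = (-τ, 2)) ∨
    (1 ≤ τ ∧ τ ≤ 3 ∧ kinkPath τ = (τ - 2, 3 - τ)) ∨ (3 ≤ τ ∧ kinkPath τ = (τ - 2, 0)) := by
  rcases le_total τ (-3) with h | h
  · exact Or.inl ⟨h, kinkPath_of_le_neg_three h⟩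
  rcases le_total τ (-1) with h1 | h1
  · exact Or.inr (Or.inl ⟨h, h1, kinkPath_of_le_neg_one h h1⟩)
  rcases le_total τ 1 with h2 | h2
  · exact Or.inr (Or.inr (Or.inl ⟨h1, h2, kinkPath_of_le_one h1 h2⟩))
  rcases le_total τ 3 with h3 | h3
  · exact Or.inr (Or.inr (Or.inr (Or.inl ⟨h2, h3, kinkPath_of_le_three h2 h3⟩)))
  · exact Or.inr (Or.inr (Or.inr (Or.inr ⟨h3, kinkPath_of_three_le h3⟩)))

theorem kinkPath_eq {τ τ' : ℝ} (h : kinkPath τ = kinkPath τ') :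
    τ = τ' ∨ (τ = -2 ∧ τ' = 2) ∨ (τ = 2 ∧ τ' = -2) := by
  rcases kinkPath_cases τ with ⟨h1, e⟩ | ⟨h1, h1', e⟩ | ⟨h1, h1', e⟩ | ⟨h1, h1', e⟩ | ⟨h1, e⟩ <;>
  rcases kinkPath_cases τ' with ⟨h2, e'⟩ | ⟨h2, h2', e'⟩ | ⟨h2, h2', e'⟩ | ⟨h2, h2', e'⟩ | ⟨h2, e'⟩ <;>
  · rw [e, e', Prod.mk.injEq] at h
    obtain ⟨e1, e2⟩ := h
    first
    | exact Or.inl (by linarith)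
    | exact Or.inr (Or.inl ⟨by linarith, by linarith⟩)
    | exact Or.inr (Or.inr ⟨by linarith, by linarith⟩)

theorem kinkPath_mem (τ : ℝ) : kinkPath τ ∈ kink := by
  rcases kinkPath_cases τ with ⟨h1, e⟩ | ⟨h1, h1', e⟩ | ⟨h1, h1', e⟩ | ⟨h1, h1', e⟩ | ⟨h1, e⟩ <;> rw [e]
  · exact Or.inl ⟨by rw [abs_of_neg (by linarith)]; linarith, rfl⟩
  · exact Or.inr ⟨abs_le.2 ⟨by linarith, by linarith⟩, Or.inr (congrArg _ (by simp; ring))⟩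
  · exact Or.inr ⟨abs_le.2 ⟨by linarith, by linarith⟩, Or.inl rfl⟩
  · exact Or.inr ⟨abs_le.2 ⟨by linarith, by linarith⟩, Or.inr (by
      simp only; rw [← abs_neg]; congr 1; ring)⟩
  · exact Or.inl ⟨by rw [abs_of_pos (by linarith)]; linarith, rfl⟩

theorem exists_kinkPath {z : ℝ × ℝ} (h : z ∈ kink) : ∃ τ, kinkPath τ = z := by
  obtain ⟨x, y⟩ := z
  rcases h with ⟨h1, h2⟩ | ⟨h1, h2 | h2⟩ <;> simp only at h1 h2
  · rcases le_abs.1 h1 with h | h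
    · exact ⟨x + 2, by rw [kinkPath_of_three_le (by linarith), h2]; simp⟩
    · exact ⟨x - 2, by rw [kinkPath_of_le_neg_three (by linarith), h2]; simp⟩
  · obtain ⟨h3, h4⟩ := abs_le.1 h1
    exact ⟨-x, by rw [kinkPath_of_le_one (by linarith) (by linarith), h2, neg_neg]⟩
  · obtain ⟨h3, h4⟩ := abs_le.1 h1
    rcases abs_eq_abs.1 h2 with h | h
    · refine ⟨x - 2, ?_⟩
      rw [kinkPath_of_le_neg_one (by linarith) (by linarith)]
      exact Prod.ext (by simp) (by simp only; linarith)
    · refine ⟨x + 2, ?_⟩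
      rw [kinkPath_of_le_three (by linarith) (by linarith)]
      exact Prod.ext (by simp) (by simp only; linarith)

theorem kinkPath_fst_bound (τ : ℝ) : |(kinkPath τ).1| ≤ 2 ↔ |τ| ≤ 4 := by
  rw [abs_le, abs_le]
  rcases kinkPath_cases τ with ⟨h1, e⟩ | ⟨h1, h1', e⟩ | ⟨h1, h1', e⟩ | ⟨h1, h1', e⟩ | ⟨h1, e⟩ <;> rw [e] <;>
    constructor <;> rintro ⟨h3, h4⟩ <;> constructor <;> simp only at * <;> linarith

theorem kinkPath_snd_mem (τ : ℝ) : (kinkPath τ).2 ∈ Icc (0 : ℝ) 2 :=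
  ⟨le_max_left _ _, max_le (by norm_num) (min_le_left _ _)⟩

theorem kinkPath_mem_box_iff (τ : ℝ) : kinkPath τ ∈ box ↔ |τ| ≤ 4 := by
  rw [← kinkPath_fst_bound, abs_le]
  have := kinkPath_snd_mem τ
  exact ⟨fun h => h.1, fun h => ⟨h, by linarith [this.1], this.2⟩⟩

theorem strand_agree (z : ℝ × ℝ) (hz : z ∉ box) : z ∈ strand ↔ z ∈ kink := by
  obtain ⟨x, y⟩ := z
  constructor
  · intro (h : y = 0)
    refine Or.inl ⟨?_, h⟩
    by_contra! hx
    obtain ⟨h1, h2⟩ := abs_lt.1 hx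
    exact hz ⟨⟨by linarith, by linarith⟩, by rw [h]; constructor <;> norm_num⟩
  · rintro (h | ⟨h1, h2⟩)
    · exact h.2
    · exfalso
      simp only at h1 h2
      obtain ⟨h3, h4⟩ := abs_le.1 h1
      refine hz ⟨⟨by linarith, by linarith⟩, ?_⟩
      rcases h2 with h2 | h2
      · rw [h2]; constructor <;> norm_num
      · obtain ⟨h5, h6⟩ := abs_le.1 (h2.trans_le h1)
        exact ⟨by linarith, by linarith⟩

theorem graphPicture_strand : GraphPicture univ (fun (_ : Unit) (_ : ℝ) => (0 : ℝ)) where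
  isOpen := isOpen_univ
  cont := fun _ => continuous_const
  ord := by simp [ordConnected_univ]
  cross := fun i j h => absurd (Subsingleton.elim i j) h

/-- The loop passes the horizontal axis once, without double points over `[-2, 2]`; this pass is
replaced by `kinkPath`. -/
theorem HasArcSystem.move1b {C C' : Set F} (h : HasArcSystem C) (hM : Move1b C C') :
    HasArcSystem C' := by
  obtain ⟨g, L, hg, rfl, hL⟩ := h
  obtain ⟨φ, hφ, hB, hA, hd⟩ := hM
  have hf := graphPicture_strand
  have hP : ∀ z ∈ univ, φ z ∈ range g ↔ ∃ _ : Unit, z.2 = 0 := by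
    intro z _
    rw [exists_const]
    exact iff_of_eq (congrArg (z ∈ ·) hB)
  have hout : ∃ u, g u ∉ φ '' univ := by
    rw [image_univ]
    refine exists_notMem_range hg.continuous hg.periodic hφ fun B => ⟨(B + 1, 0), ?_, by simp⟩
    exact (hP _ (mem_univ _)).2 ⟨(), rfl⟩
  obtain ⟨α, β, hαβ, hS⟩ := hf.exists_strand hφ hg hP hout () (x := 0) (mem_univ _)
    fun j hj => absurd rfl hj
  obtain ⟨a, b, hαa, hbβ, hp, hI⟩ := hS.exists_pass hφ hg.continuous (show (-2 : ℝ) < 2 by norm_num)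
    (mem_univ _) (mem_univ _)
  have hZ : ∀ u, g u ∈ φ '' box → u ∈ Zone a b := by
    rintro u ⟨z, hz, hzu⟩
    obtain ⟨l, hl⟩ := hf.exists_runsOn hφ hg hP (u := u) ⟨z, mem_univ _, hzu⟩
    refine hf.mem_Zone hφ hg hP (i := ()) hS hαβ hI hl ?_
    rw [← hzu, absc_apply hφ]; exact hz.1
  have hlt1 : b < a + 1 := by linarith [hS.le]
  clear hI
  generalize absc φ ∘ g = ξ at hp
  have h0 : (0 : ℝ) ∈ Icc (-2) 2 := by constructor <;> norm_num
  have hQ : ∀ u ∈ Icc a b, g u ∈ φ '' box := fun u hu =>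
    ⟨_, ⟨hp.mem_Icc hu, h0⟩, (hp.apply u hu).symm⟩
  have hplain : Plain g a b := by
    intro u hu v huv
    obtain ⟨k, hk⟩ := hZ v (huv ▸ hQ u hu)
    have h1 := hp.apply _ hk
    rw [hg.add_int, ← huv, hp.apply u hu] at h1
    have h2 := hφ.injective h1
    rw [Prod.mk.injEq] at h2
    refine ⟨-k, ?_⟩
    rw [hp.injOn hu hk h2.1]; push_cast; ring
  -- The part of the kink in the box is parametrized by `[-4, 4]`, while `ξ` runs through `[-2, 2]`;
  -- hence the factor `2`.
  have hends : ∀ u, u = a ∨ u = b → kinkPath (2 * ξ u) = (ξ u, 0) := by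
    intro u hu
    have h1 : ξ u = 2 ∨ ξ u = -2 := by
      rcases hu with rfl | rfl <;> rcases hp.ends with ⟨-, h1, h2⟩ | ⟨-, h1, h2⟩ <;> simp [h1, h2]
    rcases h1 with h1 | h1 <;> rw [h1]
    · rw [kinkPath_of_three_le (by norm_num)]; norm_num
    · rw [kinkPath_of_le_neg_three (by norm_num)]; norm_num
  have hl := left_mem_Icc.2 hp.lt.le
  have hr := right_mem_Icc.2 hp.lt.le
  obtain ⟨g', hc', hper', hin, hoff⟩ := exists_replace hg.continuous hg.periodic
    (γ := fun u => φ (kinkPath (2 * ξ u))) hp.lt.le hlt1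
    ((hφ.continuous.comp continuous_kinkPath).comp_continuousOn (continuousOn_const.mul hp.cont))
    (by rw [hp.apply _ hl, hends _ (Or.inl rfl)]) (by rw [hp.apply _ hr, hends _ (Or.inr rfl)])
  have hQ' : ∀ u ∈ Icc a b, g' u ∈ φ '' box := fun u hu => by
    rw [hin u hu]
    refine mem_image_of_mem φ ((kinkPath_mem_box_iff _).2 ?_)
    have := hp.mem_Icc hu
    rw [abs_le]; constructor <;> linarith [this.1, this.2]
  have hZ' : ∀ u, g' u ∈ φ '' box → u ∈ Zone a b := fun u hu =>
    hZ u ((mem_iff_of_modify hg.periodic hper' hQ hQ' hoff u).2 hu)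
  have hrange : range g' = C' := by
    refine range_of_modify hg.periodic hper' hQ hQ' hoff (replaces_iff hB hA hd strand_agree) ?_
    rintro _ ⟨z, hz, rfl⟩
    have hA' : φ z ∈ C' ↔ z ∈ kink := by rw [← hA]; rfl
    rw [hA']
    constructor
    · rintro ⟨u, hu⟩
      obtain ⟨k, hk⟩ := hZ' u (hu ▸ mem_image_of_mem φ hz)
      rw [← add_int_of_periodic hper' u k, hin _ hk] at hu
      rw [← hφ.injective hu]
      exact kinkPath_mem _
    · intro hzk
      obtain ⟨τ, rfl⟩ := exists_kinkPath hzk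
      obtain ⟨h1, h2⟩ := abs_le.1 ((kinkPath_mem_box_iff _).1 hz)
      obtain ⟨u, hu, hx⟩ := hp.exists_Icc (x := τ / 2) ⟨by linarith, by linarith⟩
      refine ⟨u, ?_⟩
      rw [hin u hu, hx]; congr 2; ring
  have hA' : ∀ z, z ∈ kink → φ z ∈ range g' := fun z hz => by
    rw [hrange]; exact (hA ▸ hz : z ∈ φ ⁻¹' C')
  -- The double point of `kinkPath` is taken at the parameters `-2` and `2`, that is, for `ξ = -1`
  -- and `ξ = 1`.
  obtain ⟨s, hs, hxs⟩ := hp.exists_Ioo (x := -1) ⟨by norm_num, by norm_num⟩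
  obtain ⟨t, ht, hxt⟩ := hp.exists_Ioo (x := 1) ⟨by norm_num, by norm_num⟩
  have heq : g' s = g' t := by
    rw [hin s (Ioo_subset_Icc_self hs), hin t (Ioo_subset_Icc_self ht), hxs, hxt,
      kinkPath_of_le_neg_one (by norm_num) (by norm_num),
      kinkPath_of_le_three (by norm_num) (by norm_num)]
    norm_num
  have honly : ∀ u ∈ Icc a b, ∀ v, g' u = g' v →
      ∃ k : ℤ, v = u + k ∨ (u = s ∧ v = t + k) ∨ (u = t ∧ v = s + k) := by
    intro u hu v huv
    obtain ⟨k, hk⟩ := hZ' v (huv ▸ hQ' u hu)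
    have h1 := hin _ hk
    rw [add_int_of_periodic hper', ← huv, hin u hu] at h1
    refine ⟨-k, ?_⟩
    have hinj : ∀ w x : ℝ, w ∈ Icc a b → x ∈ Icc a b → ξ w = ξ x → w = x := fun w x hw hx h =>
      hp.injOn hw hx h
    rcases kinkPath_eq (hφ.injective h1) with h | ⟨h, h'⟩ | ⟨h, h'⟩
    · left
      rw [hinj u _ hu hk (by linarith)]; push_cast; ring
    · right; left
      refine ⟨hinj _ _ hu (Ioo_subset_Icc_self hs) (by linarith), ?_⟩
      rw [← hinj _ _ hk (Ioo_subset_Icc_self ht) (by linarith)]; push_cast; ring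
    · right; right
      refine ⟨hinj _ _ hu (Ioo_subset_Icc_self ht) (by linarith), ?_⟩
      rw [← hinj _ _ hk (Ioo_subset_Icc_self hs) (by linarith)]; push_cast; ring
  -- Near `s` and near `t` the path stays on one leg of the kink, which is the graph of an affine
  -- function, so that `transverse_of_graph` applies.
  have hsub : ∀ u ∈ Ioo a b, ∀ c d : ℝ, 2 * ξ u ∈ Ioo c d → ∃ a' b', u ∈ Ioo a' b' ∧
      (StrictMonoOn ξ (Ioo a' b') ∨ StrictAntiOn ξ (Ioo a' b')) ∧
      ∀ w ∈ Ioo a' b', w ∈ Icc a b ∧ 2 * ξ w ∈ Ioo c d := by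
    intro u hu c d hx
    have h1 : ∀ᶠ w in 𝓝 u, 2 * ξ w ∈ Ioo c d :=
      (continuousAt_const.mul (hp.continuousAt hu)).eventually (Ioo_mem_nhds hx.1 hx.2)
    obtain ⟨a', b', hu', hsub⟩ := mem_nhds_iff_exists_Ioo_subset.1
      (inter_mem h1 (Ioo_mem_nhds hu.1 hu.2))
    exact ⟨a', b', hu', hp.monoOn.imp (fun h => h.mono fun w hw => (hsub hw).2)
      (fun h => h.mono fun w hw => (hsub hw).2),
      fun w hw => ⟨Ioo_subset_Icc_self (hsub hw).2, (hsub hw).1⟩⟩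
  have hmono : ∀ (S : Set ℝ) (d : ℝ), StrictMonoOn ξ S ∨ StrictAntiOn ξ S →
      StrictMonoOn (fun w => 2 * ξ w + d) S ∨ StrictAntiOn (fun w => 2 * ξ w + d) S := by
    intro S d h
    exact h.imp (fun h x hx y hy hxy => by have := h hx hy hxy; simp only; linarith)
      fun h x hx y hy hxy => by have := h hx hy hxy; simp only; linarith
  have near : ∀ᶠ y in 𝓝 (0 : ℝ), y ∈ Ioo (-1 : ℝ) 1 := Ioo_mem_nhds (by norm_num) (by norm_num)
  have hts : Transverse g' s := by
    obtain ⟨a', b', hs', hm, hab⟩ := hsub s hs (-3) (-1) (by rw [hxs]; constructor <;> norm_num)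
    refine transverse_of_graph hφ hs' (h₁ := fun x => 1 + x) (h₂ := fun x => 1 - x)
      (ξ := fun w => 2 * ξ w + 2) (x := 0) (σ := 1) (by rw [hxs]; norm_num) (hmono _ _ hm)
      ((continuousAt_const.mul (hp.continuousAt hs)).add continuousAt_const) ?_ (Or.inl rfl)
      (Eventually.of_forall fun y => by constructor <;> ring) ?_
    · intro w hw
      rw [hin w (hab w hw).1, kinkPath_of_le_neg_one (hab w hw).2.1.le (hab w hw).2.2.le]
      congr 2; ring
    · filter_upwards [near] with y hy
      refine hA' _ (Or.inr ⟨abs_le.2 ⟨hy.1.le, hy.2.le⟩, Or.inr ?_⟩)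
      simp only; rw [← abs_neg]; congr 1; ring
  have htt : Transverse g' t := by
    obtain ⟨a', b', hs', hm, hab⟩ := hsub t ht 1 3 (by rw [hxt]; constructor <;> norm_num)
    refine transverse_of_graph hφ hs' (h₁ := fun x => 1 - x) (h₂ := fun x => 1 + x)
      (ξ := fun w => 2 * ξ w + -2) (x := 0) (σ := -1) (by rw [hxt]; norm_num) (hmono _ _ hm)
      ((continuousAt_const.mul (hp.continuousAt ht)).add continuousAt_const) ?_ (Or.inr rfl)
      (Eventually.of_forall fun y => by constructor <;> ring) ?_
    · intro w hw
      rw [hin w (hab w hw).1, kinkPath_of_le_three (hab w hw).2.1.le (hab w hw).2.2.le]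
      congr 2; ring
    · filter_upwards [near] with y hy
      refine hA' _ (Or.inr ⟨abs_le.2 ⟨hy.1.le, hy.2.le⟩, Or.inr ?_⟩)
      simp only; congr 1; ring
  have hg' : GenericLoop g' := by
    refine genericLoop_of_modify hg hc' hper' (isClosed_box hφ) hQ hQ' hoff (T := {s, t})
      (toFinite _) ?_ ?_
    · rintro u hu ⟨v, hv, hk⟩
      obtain ⟨m, hm⟩ := hZ' u hu
      obtain ⟨k, h | ⟨h, -⟩ | ⟨h, -⟩⟩ := honly _ hm v ((add_int_of_periodic hper' u m).trans hv.symm)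
      · exact absurd (by rw [h]; push_cast; ring) (hk (m + k))
      · exact ⟨s, by simp, -m, by rw [← h]; push_cast; ring⟩
      · exact ⟨t, by simp, -m, by rw [← h]; push_cast; ring⟩
    · rintro τ (rfl | rfl)
      exacts [hts, htt]
  -- Which of `s` and `t` comes earlier depends on the direction in which the loop passes the
  -- strand.
  have hkink : ∃ s t, Kinked g' a b s t := by
    rcases lt_trichotomy s t with h | h | h
    · exact ⟨s, t, hs.1, h, ht.2, hlt1, heq, honly⟩
    · rw [h, hxt] at hxs; norm_num at hxs
    · refine ⟨t, s, ht.1, h, hs.2, hlt1, heq.symm, fun u hu v huv => ?_⟩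
      obtain ⟨k, hk⟩ := honly u hu v huv
      exact ⟨k, hk.imp_right Or.symm⟩
  obtain ⟨s', t', hk⟩ := hkink
  obtain ⟨L', hL'⟩ := hL.insert_kink hg.periodic hper' hplain hk hoff
  exact ⟨g', L', hg', hrange, hL'⟩

/-! ### The picture of a kink and its monogon -/

variable {F : Type*} [TopologicalSpace F] [T2Space F]

/-- The two strands of the lower part of the kink, as graphs. -/
def legFun : Fin 2 → ℝ → ℝ := ![fun x => max 0 (1 + x), fun x => max 0 (1 - x)]

/-- The lower part of the picture of the kink. -/
def lower : Set (ℝ × ℝ) := {z | z.2 < 3 / 2}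

/-- The upper part of the picture of the kink. -/
def upper : Set (ℝ × ℝ) := {z | 1 < z.2}

theorem isOpen_lower : IsOpen lower := isOpen_lt continuous_snd continuous_const

theorem isOpen_upper : IsOpen upper := isOpen_lt continuous_const continuous_snd

/-- Below the height `3 / 2` the top edge of the kink is cut off, and what remains is two graphs
with one crossing at height `1`. Above the height `1` the kink is a single arc. The two parts
overlap and cover the kink. -/
theorem graphPicture_leg : GraphPicture lower legFun where
  isOpen := isOpen_lower
  cont := by
    intro i
    fin_cases i <;> simp [legFun] <;> fun_prop
  ord := by
    intro i
    fin_cases i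
    · have : {x : ℝ | (x, legFun 0 x) ∈ lower} = Iio (1 / 2) := by
        ext x
        simp only [lower, legFun, Matrix.cons_val, mem_ofPred_eq, mem_Iio, max_lt_iff]
        exact ⟨fun h => by linarith [h.2], fun h => ⟨by norm_num, by linarith⟩⟩
      exact this ▸ ordConnected_Iio
    · have : {x : ℝ | (x, legFun 1 x) ∈ lower} = Ioi (-1 / 2) := by
        ext x
        simp only [lower, legFun, Matrix.cons_val, mem_ofPred_eq, mem_Ioi, max_lt_iff]
        exact ⟨fun h => by linarith [h.2], fun h => ⟨by norm_num, by linarith⟩⟩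
      exact this ▸ ordConnected_Ioi
  cross := by
    have hx0 : ∀ x, legFun 0 x = legFun 1 x → x = 0 := by
      intro x h
      simp only [legFun, Matrix.cons_val] at h
      rcases max_cases 0 (1 + x) with ⟨h1, h2⟩ | ⟨h1, h2⟩ <;> rcases max_cases 0 (1 - x) with ⟨h3, h4⟩ | ⟨h3, h4⟩ <;>
        rw [h1, h3] at h <;> linarith
    have near : ∀ᶠ y in 𝓝 (0 : ℝ), y ∈ Ioo (-1 : ℝ) 1 := Ioo_mem_nhds (by norm_num) (by norm_num)
    have l0 : ∀ y ∈ Ioo (-1 : ℝ) 1, legFun 0 y = 1 + y := fun y hy => max_eq_right (by linarith [hy.1])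
    have l1 : ∀ y ∈ Ioo (-1 : ℝ) 1, legFun 1 y = 1 - y := fun y hy => max_eq_right (by linarith [hy.2])
    have h0 : (0 : ℝ) ∈ Ioo (-1 : ℝ) 1 := by constructor <;> norm_num
    intro i j hij x hxV hx
    have hij' : (i = 0 ∧ j = 1) ∨ (i = 1 ∧ j = 0) := by clear hx hxV; revert i j; decide
    rcases hij' with ⟨rfl, rfl⟩ | ⟨rfl, rfl⟩
    · obtain rfl := hx0 x hx
      refine ⟨1, Or.inl rfl, ?_, by decide +revert⟩
      filter_upwards [near] with y hy
      rw [l0 y hy, l1 y hy, l0 0 h0]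
      constructor <;> ring
    · obtain rfl := hx0 x hx.symm
      refine ⟨-1, Or.inr rfl, ?_, by decide +revert⟩
      filter_upwards [near] with y hy
      rw [l0 y hy, l1 y hy, l1 0 h0]
      constructor <;> ring

theorem mem_kink_iff {z : ℝ × ℝ} (hz : z ∈ lower) : z ∈ kink ↔ ∃ i, z.2 = legFun i z.1 := by
  obtain ⟨x, y⟩ := z
  have hz' : y < 3 / 2 := hz
  simp only [Fin.exists_fin_two, legFun, Matrix.cons_val]
  constructor
  · rintro (⟨h1, h2⟩ | ⟨h1, h2⟩) <;> simp only at h1 h2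
    · rcases le_abs.1 h1 with h | h
      · right; rw [max_eq_left (by linarith), h2]
      · left; rw [max_eq_left (by linarith), h2]
    · obtain ⟨h3, h4⟩ := abs_le.1 h1
      rcases h2 with h2 | h2
      · linarith
      rcases abs_eq_abs.1 h2 with h | h
      · left; rw [max_eq_right (by linarith)]; linarith
      · right; rw [max_eq_right (by linarith)]; linarith
  · rintro (h | h)
    · rcases max_cases 0 (1 + x) with ⟨h1, h2⟩ | ⟨h1, h2⟩ <;> rw [h1] at h
      · exact Or.inl ⟨by rw [abs_of_neg (by linarith)]; linarith, h⟩
      · exact Or.inr ⟨abs_le.2 ⟨by linarith, by linarith⟩, Or.inr (by simp only; congr 1; linarith)⟩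
    · rcases max_cases 0 (1 - x) with ⟨h1, h2⟩ | ⟨h1, h2⟩ <;> rw [h1] at h
      · exact Or.inl ⟨by rw [abs_of_pos (by linarith)]; linarith, h⟩
      · exact Or.inr ⟨abs_le.2 ⟨by linarith, by linarith⟩, Or.inr (by
          simp only; rw [← abs_neg]; congr 1; linarith)⟩

theorem kinkPath_mem_upper {τ : ℝ} : kinkPath τ ∈ upper ↔ τ ∈ Ioo (-2 : ℝ) 2 := by
  rcases kinkPath_cases τ with ⟨h1, e⟩ | ⟨h1, h1', e⟩ | ⟨h1, h1', e⟩ | ⟨h1, h1', e⟩ | ⟨h1, e⟩ <;> rw [e] <;>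
    simp only [upper, mem_ofPred_eq, mem_Ioo] <;> constructor <;> intro h <;> (try constructor) <;> linarith

/-- The coordinate of the upper part of the kink. -/
noncomputable def capCoord (z : ℝ × ℝ) : ℝ := -z.1 - 2 * (2 - z.2) * z.1 / (z.2 - 1)

/-- On the top edge the correction term of `capCoord` vanishes. On the legs the quotient of `z.1` by
`z.2 - 1` is `1` or `-1`, so that the formula becomes affine and matches the parameter. -/
theorem capCoord_kinkPath {τ : ℝ} (h : τ ∈ Ioo (-2 : ℝ) 2) : capCoord (kinkPath τ) = τ := by
  obtain ⟨h2, h3⟩ := h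
  rcases kinkPath_cases τ with ⟨h1, e⟩ | ⟨h1, h1', e⟩ | ⟨h1, h1', e⟩ | ⟨h1, h1', e⟩ | ⟨h1, e⟩ <;>
    rw [e, capCoord]
  · linarith
  · have : τ + 3 - 1 ≠ 0 := by linarith
    simp only
    field_simp
    ring
  · norm_num
  · have : 3 - τ - 1 ≠ 0 := by linarith
    simp only
    field_simp
    ring
  · linarith

theorem line_cap {φ : ℝ × ℝ → F} (hφ : IsOpenEmbedding φ) (hcl : IsClosed kink) :
    Line (φ '' upper) (φ '' (kink ∩ upper)) (fun q => capCoord (Function.invFun φ q))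
      (fun τ => φ (kinkPath τ)) (Ioo (-2) 2) where
  subset := image_mono inter_subset_right
  closed := by
    rintro _ ⟨z, hz, rfl⟩ hz'
    refine ⟨z, ⟨?_, hz⟩, rfl⟩
    have h1 : z ∈ closure (kink ∩ upper) := by
      rw [hφ.isEmbedding.closure_eq_preimage_closure_image]; exact hz'
    exact hcl.closure_subset_iff.2 inter_subset_left h1
  contX := by
    have h1 : ContinuousOn capCoord upper := by
      have : ∀ z ∈ upper, z.2 - 1 ≠ (0 : ℝ) := fun z (hz : 1 < z.2) => by linarith
      unfold capCoord
      fun_prop (disch := assumption)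
    refine h1.comp ((continuousOn_invFun hφ).mono (image_subset_range _ _)) ?_
    rintro _ ⟨z, hz, rfl⟩
    rw [invFun_apply hφ]; exact hz.2
  openJ := isOpen_Ioo
  ordJ := ordConnected_Ioo
  contκ := (hφ.continuous.comp continuous_kinkPath).continuousOn
  mapsκ := fun τ hτ => ⟨_, ⟨kinkPath_mem τ, kinkPath_mem_upper.2 hτ⟩, rfl⟩
  mapsX := by
    rintro _ ⟨z, ⟨hz, hz'⟩, rfl⟩
    obtain ⟨τ, rfl⟩ := exists_kinkPath hz
    have := kinkPath_mem_upper.1 hz'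
    simp only [invFun_apply hφ, capCoord_kinkPath this]
    exact this
  left_inv := fun τ hτ => by simp only [invFun_apply hφ, capCoord_kinkPath hτ]
  right_inv := by
    rintro _ ⟨z, ⟨hz, hz'⟩, rfl⟩
    obtain ⟨τ, rfl⟩ := exists_kinkPath hz
    simp only [invFun_apply hφ, capCoord_kinkPath (kinkPath_mem_upper.1 hz')]

/-- The loop runs once around the monogon of a kink. -/
theorem exists_monogon {g : ℝ → F} (hg : GenericLoop g) {φ : ℝ × ℝ → F} (hφ : IsOpenEmbedding φ)
    (hk : ∀ z, φ z ∈ range g ↔ z ∈ kink) (hout : ∃ u, g u ∉ range φ) :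
    ∃ s t, s < t ∧ t < s + 1 ∧ g s = φ (0, 1) ∧ g t = φ (0, 1) ∧ (∀ w ∈ Ioo s t, g w ∈ φ '' upper) ∧
      (∀ w, g w ∈ φ '' upper → ∃ k : ℤ, w + k ∈ Ioo s t) ∧ InjOn g (Ioo s t) := by
  have hcont := hg.continuous
  have hK : IsCompact (range g) := hg.periodic.compact_of_continuous one_ne_zero hcont
  have hcl : IsClosed kink := by
    have : kink = φ ⁻¹' range g := by ext z; exact (hk z).symm
    rw [this]; exact hK.isClosed.preimage hφ.continuous
  have hL := line_cap hφ hcl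
  have hmem : ∀ u, g u ∈ φ '' upper → g u ∈ φ '' (kink ∩ upper) := by
    rintro u ⟨z, hz, hzu⟩
    exact ⟨z, ⟨(hk z).1 ⟨u, hzu.symm⟩, hz⟩, hzu⟩
  have hV : IsOpen (φ '' upper) := hφ.isOpenMap _ isOpen_upper
  have hruns : ∀ u, g u ∈ φ '' upper → RunsOn g (φ '' (kink ∩ upper)) u := fun u hu => by
    filter_upwards [hcont.continuousAt.eventually (hV.mem_nhds hu)] with w hw
    exact hmem w hw
  have hstr : ∀ u, g u ∈ φ '' (kink ∩ upper) → RunsOn g (φ '' (kink ∩ upper)) u ∨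
      ∀ᶠ w in 𝓝[≠] u, g w ∉ φ '' (kink ∩ upper) := fun u hu => Or.inl (hruns u (hL.subset hu))
  have hout' : ∃ u, g u ∉ φ '' upper := hout.imp fun u hu h => hu (image_subset_range _ _ h)
  have h02 : ((0 : ℝ), (2 : ℝ)) ∈ kink ∩ upper :=
    ⟨Or.inr ⟨by simp, Or.inl rfl⟩, (by norm_num : (1 : ℝ) < 2)⟩
  obtain ⟨u₀, hu₀⟩ := (hk (0, 2)).2 h02.1
  obtain ⟨s, t, hst, hS⟩ := hL.follow hg hV hout' hstr (hruns u₀ ⟨_, h02.2, hu₀.symm⟩)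
  have hlt := hst.1.trans hst.2
  -- The ends of the passage lie in the closure of the cap but not in the open upper half, and the
  -- vertex `(0, 1)` is the only such point.
  have hcomp : IsClosed (φ '' (kink ∩ (Icc (-1) 1 ×ˢ Icc 1 2))) :=
    (((isCompact_Icc.prod isCompact_Icc).inter_left hcl).image hφ.continuous).isClosed
  have hsub : kink ∩ upper ⊆ kink ∩ (Icc (-1) 1 ×ˢ Icc 1 2) := by
    rintro ⟨x, y⟩ ⟨h, (h' : 1 < y)⟩
    refine ⟨h, ?_⟩
    rcases h with ⟨h1, h2⟩ | ⟨h1, h2⟩ <;> simp only at h1 h2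
    · linarith
    · refine ⟨abs_le.1 h1, h'.le, ?_⟩
      rcases h2 with h2 | h2
      · exact h2.le
      · simp only; linarith [le_abs_self (y - 1)]
  have hvertex : ∀ e, e ∈ closure (Ioo s t) → g e ∉ φ '' upper → g e = φ (0, 1) := by
    intro e he hne
    have h1 : g e ∈ φ '' (kink ∩ (Icc (-1) 1 ×ˢ Icc 1 2)) := by
      refine hcomp.closure_subset_iff.2 (image_mono hsub) ?_
      refine closure_mono ?_ (image_closure_subset_closure_image hcont ⟨e, he, rfl⟩)
      rintro _ ⟨w, hw, rfl⟩; exact hS.mem w hw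
    obtain ⟨⟨x, y⟩, ⟨hz, -, ⟨hy, -⟩⟩, hze⟩ := h1
    have hy1 : y = 1 := le_antisymm (not_lt.1 fun h => hne ⟨_, h, hze⟩) hy
    subst hy1
    rcases hz with ⟨-, h2⟩ | ⟨-, h2 | h2⟩
    · norm_num at h2
    · norm_num at h2
    · have : x = 0 := by simpa using h2.symm
      rw [← hze, this]
  have hcls : closure (Ioo s t) = Icc s t := closure_Ioo hlt.ne
  have hgs := hvertex s (hcls ▸ left_mem_Icc.2 hlt.le) hS.notMem_left
  have hgt := hvertex t (hcls ▸ right_mem_Icc.2 hlt.le) hS.notMem_right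
  -- If the passage took a full period, the loop would never leave the disk.
  refine ⟨s, t, hlt, lt_of_le_of_ne hS.le ?_, hgs, hgt, fun w hw => hL.subset (hS.mem w hw), ?_, ?_⟩
  · rintro rfl
    obtain ⟨u, hu⟩ := hout
    obtain ⟨k, h1, h2⟩ := exists_add_int_mem_Ico s u
    rw [← hg.add_int u k] at hu
    rcases h1.eq_or_lt with h | h
    · rw [← h, hgs] at hu; exact hu ⟨_, rfl⟩
    · exact hu (image_subset_range _ _ (hS.mem _ ⟨h, h2⟩))
  · exact fun w hw => hS.exists_mem hg hL hV hstr hlt (hruns w hw)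
  · intro u hu v hv huv
    exact hS.injOn hu hv (by simp only [Function.comp, huv])

/-! ### Removing a kink -/

variable {F : Type*} [TopologicalSpace F] [T2Space F]

theorem mem_leg_iff {i : Fin 2} {x : ℝ} :
    x ∈ {x : ℝ | (x, legFun i x) ∈ lower} ↔ (if i = 0 then x < 1 / 2 else -1 / 2 < x) := by
  fin_cases i
  · simp only [lower, legFun, Fin.zero_eta, Matrix.cons_val, mem_ofPred_eq, max_lt_iff, if_true]
    exact ⟨fun h => by linarith [h.2], fun h => ⟨by norm_num, by linarith⟩⟩
  · simp only [lower, legFun, Fin.mk_one, Matrix.cons_val, mem_ofPred_eq, max_lt_iff]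
    exact ⟨fun h => by simp; linarith [h.2], fun h => ⟨by norm_num, by simp at h; linarith⟩⟩

/-- Removal of a kink whose monogon is entered along the left leg. -/
theorem HasArcSystem.remove_kink_of_left {C' : Set F} {g : ℝ → F} {L : Set (ℝ × ℝ)}
    (hg : GenericLoop g) (hL : ArcSystem g L) {φ : ℝ × ℝ → F} (hφ : IsOpenEmbedding φ)
    (hk : ∀ z, φ z ∈ range g ↔ z ∈ kink) (hA : φ ⁻¹' C' = strand)
    (hd : range g \ range φ = C' \ range φ) (hout : ∃ u, g u ∉ range φ) {s t : ℝ} (hst : s < t)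
    (hts : t < s + 1) (hgs : g s = φ (0, 1)) (hgt : g t = φ (0, 1))
    (hup : ∀ w ∈ Ioo s t, g w ∈ φ '' upper)
    (hcov : ∀ w, g w ∈ φ '' upper → ∃ k : ℤ, w + k ∈ Ioo s t) (hinj : InjOn g (Ioo s t))
    (hs : RunsOn g (φ '' graphIn lower (legFun 0)) s) : HasArcSystem C' := by
  have hf := graphPicture_leg
  have hP : ∀ z ∈ lower, φ z ∈ range g ↔ ∃ i, z.2 = legFun i z.1 := fun z hz =>
    (hk z).trans (mem_kink_iff hz)
  have hV : IsOpen (φ '' lower) := hφ.isOpenMap _ isOpen_lower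
  have hout' : ∃ u, g u ∉ φ '' lower := hout.imp fun u hu h => hu (image_subset_range _ _ h)
  have hline := fun i => line_graph hφ isOpen_lower (hf.cont i) (hf.ord i)
  have hro := fun i => hf.runsOn_or hφ hg hP (i := i)
  have heq : ∀ i u v, RunsOn g (φ '' graphIn lower (legFun i)) u →
      RunsOn g (φ '' graphIn lower (legFun i)) v → g u = g v → ∃ k : ℤ, v = u + k :=
    fun i u v hu hv h => (hline i).eq_add_int hg hV hout' (hro i) hu hv h
  have hexists : ∀ u, g u ∈ φ '' lower → RunsOn g (φ '' graphIn lower (legFun 0)) u ∨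
      RunsOn g (φ '' graphIn lower (legFun 1)) u := by
    intro u hu
    obtain ⟨i, hi⟩ := hf.exists_runsOn hφ hg hP hu
    fin_cases i
    exacts [Or.inl hi, Or.inr hi]
  have h01 : ((0 : ℝ), (1 : ℝ)) ∈ lower := by norm_num [lower]
  -- A loop follows each leg only once, so the two passages through the vertex use different legs.
  have ht : RunsOn g (φ '' graphIn lower (legFun 1)) t := by
    refine (hexists t ⟨_, h01, hgt.symm⟩).resolve_left fun h => ?_
    obtain ⟨k, hk⟩ := heq 0 s t hs h (hgs.trans hgt.symm)
    exact not_int_of_abs_lt hst.ne' (abs_lt.2 ⟨by linarith, by linarith⟩) k hk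
  have hvertex : ∀ v, g v = φ (0, 1) → ∃ k : ℤ, v = s + k ∨ v = t + k := by
    intro v hv
    rcases hexists v ⟨_, h01, hv.symm⟩ with h | h
    · obtain ⟨k, hk⟩ := heq 0 s v hs h (hgs.trans hv.symm)
      exact ⟨k, Or.inl hk⟩
    · obtain ⟨k, hk⟩ := heq 1 t v ht h (hgt.trans hv.symm)
      exact ⟨k, Or.inr hk⟩
  obtain ⟨α, β, hsI, hS⟩ := (hline 0).follow hg hV hout' (hro 0) hs
  obtain ⟨α', β', htI, hS'⟩ := (hline 1).follow hg hV hout' (hro 1) ht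
  have happ : ∀ w ∈ Ioo α β, g w = φ (absc φ (g w), max 0 (1 + absc φ (g w))) := fun w hw =>
    hS.apply_eq hφ hw
  have happ' : ∀ w ∈ Ioo α' β', g w = φ (absc φ (g w), max 0 (1 - absc φ (g w))) := fun w hw =>
    hS'.apply_eq hφ hw
  have hruns : ∀ w ∈ Ioo α β, RunsOn g (φ '' graphIn lower (legFun 0)) w := fun w hw =>
    (eventually_of_mem (Ioo_mem_nhds hw.1 hw.2) hS.mem)
  have hruns' : ∀ w ∈ Ioo α' β', RunsOn g (φ '' graphIn lower (legFun 1)) w := fun w hw =>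
    (eventually_of_mem (Ioo_mem_nhds hw.1 hw.2) hS'.mem)
  have hnup : ∀ x y : ℝ, φ (x, y) ∈ φ '' upper → 1 < y := by
    rintro x y ⟨z, hz, hzu⟩
    have := hφ.injective hzu
    subst this; exact hz
  have hxs : absc φ (g s) = 0 := by rw [hgs, absc_apply hφ]
  have hxt : absc φ (g t) = 0 := by rw [hgt, absc_apply hφ]
  -- Right after `s` the loop is above height `1`, which on the left leg means a positive abscissa.
  -- So the abscissa increases through `0`; just before `t` the same argument applies to the right
  -- leg.
  have hmono : StrictMonoOn (absc φ ∘ g) (Ioo α β) := by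
    refine hS.mono.resolve_right fun h => ?_
    have h1 : s < min t β := lt_min hst hsI.2
    have hw : (s + min t β) / 2 ∈ Ioo α β :=
      ⟨by linarith [hsI.1], by linarith [min_le_right t β, hsI.2]⟩
    have h2 := h hsI hw (by linarith)
    simp only [Function.comp, hxs] at h2
    have h3 := hup _ (show (s + min t β) / 2 ∈ Ioo s t from ⟨by linarith, by linarith [min_le_left t β]⟩)
    rw [happ _ hw] at h3
    have h4 := hnup _ _ h3
    rcases max_cases 0 (1 + absc φ (g ((s + min t β) / 2))) with ⟨h5, h6⟩ | ⟨h5, h6⟩ <;> rw [h5] at h4 <;>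
      linarith
  have hmono' : StrictMonoOn (absc φ ∘ g) (Ioo α' β') := by
    refine hS'.mono.resolve_right fun h => ?_
    have h1 : max s α' < t := max_lt hst htI.1
    have hw : (max s α' + t) / 2 ∈ Ioo α' β' :=
      ⟨by linarith [le_max_right s α', htI.1], by linarith [htI.2]⟩
    have h2 := h hw htI (by linarith)
    simp only [Function.comp, hxt] at h2
    have h3 := hup _ (show (max s α' + t) / 2 ∈ Ioo s t from ⟨by linarith [le_max_left s α'], by linarith⟩)
    rw [happ' _ hw] at h3
    have h4 := hnup _ _ h3
    rcases max_cases 0 (1 - absc φ (g ((max s α' + t) / 2))) with ⟨h5, h6⟩ | ⟨h5, h6⟩ <;> rw [h5] at h4 <;>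
      linarith
  obtain ⟨a, haI, hxa⟩ : ∃ a ∈ Ioo α β, absc φ (g a) = -2 := by
    have : (-2 : ℝ) ∈ (absc φ ∘ g) '' Ioo α β := by
      rw [hS.image]; exact mem_leg_iff.2 (by norm_num)
    exact this
  obtain ⟨b, hbI, hxb⟩ : ∃ b ∈ Ioo α' β', absc φ (g b) = 2 := by
    have : (2 : ℝ) ∈ (absc φ ∘ g) '' Ioo α' β' := by
      rw [hS'.image]; exact mem_leg_iff.2 (by norm_num)
    exact this
  have has : a < s := (hmono.lt_iff_lt haI hsI).1 (by simp only [Function.comp, hxa, hxs]; norm_num)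
  have htb : t < b := (hmono'.lt_iff_lt htI hbI).1 (by simp only [Function.comp, hxb, hxt]; norm_num)
  have hleg : ∀ w ∈ Ico a s, w ∈ Ioo α β ∧ -2 ≤ absc φ (g w) ∧ absc φ (g w) < 0 := by
    intro w hw
    have hw' : w ∈ Ioo α β := ⟨haI.1.trans_le hw.1, hw.2.trans hsI.2⟩
    have h1 := hmono.monotoneOn haI hw' hw.1
    have h2 := hmono hw' hsI hw.2
    simp only [Function.comp, hxa, hxs] at h1 h2
    exact ⟨hw', h1, h2⟩
  have hleg' : ∀ w ∈ Ioc t b, w ∈ Ioo α' β' ∧ 0 < absc φ (g w) ∧ absc φ (g w) ≤ 2 := by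
    intro w hw
    have hw' : w ∈ Ioo α' β' := ⟨htI.1.trans hw.1, hw.2.trans_lt hbI.2⟩
    have h1 := hmono' htI hw' hw.1
    have h2 := hmono'.monotoneOn hw' hbI hw.2
    simp only [Function.comp, hxb, hxt] at h1 h2
    exact ⟨hw', h1, h2⟩
  -- Otherwise a translate of `a` would lie on the right leg beyond the vertex, or a translate of
  -- `t` on the left leg before it; the abscissas forbid both.
  have hba : b < a + 1 := by
    by_contra! hle
    have hga : absc φ (g (a + 1)) = -2 := by rw [hg.periodic, hxa]
    rcases lt_or_ge t (a + 1) with h | h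
    · have := (hleg' (a + 1) ⟨h, hle⟩).2.1
      linarith
    · have h1 := (hleg (t - 1) ⟨by linarith, by linarith⟩).2.2
      have h2 := hg.periodic (t - 1)
      rw [sub_add_cancel] at h2
      rw [← h2, hxt] at h1
      exact lt_irrefl _ h1
  -- Points above height `1` belong to the monogon. Below, the bound on the height selects the outer
  -- half of each leg, which is passed before `s` or after `t`.
  have hZ : ∀ u, g u ∈ φ '' box → u ∈ Zone a b := by
    rintro u ⟨z, hz, hzu⟩
    have hxu : absc φ (g u) = z.1 := by rw [← hzu, absc_apply hφ]
    by_cases hzup : z ∈ upper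
    · obtain ⟨k, hk⟩ := hcov u ⟨z, hzup, hzu⟩
      exact ⟨k, by linarith [hk.1], by linarith [hk.2]⟩
    have hz1 : z.2 ≤ 1 := not_lt.1 hzup
    have hzlow : z ∈ lower := lt_of_le_of_lt hz1 (by norm_num)
    rcases hexists u ⟨z, hzlow, hzu⟩ with h | h
    · obtain ⟨k, hk⟩ := hS.exists_mem hg (hline 0) hV (hro 0) (hsI.1.trans hsI.2) h
      have h1 := happ _ hk
      rw [hg.add_int, hxu, ← hzu] at h1
      have h2 : z.2 = max 0 (1 + z.1) := congrArg Prod.snd (hφ.injective h1)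
      have h3 : z.1 ≤ 0 := by linarith [le_max_right 0 (1 + z.1)]
      refine ⟨k, ?_, ?_⟩
      · refine (hmono.le_iff_le haI hk).1 ?_
        simp only [Function.comp, hg.add_int, hxu, hxa]; exact hz.1.1
      · refine ((hmono.le_iff_le hk hsI).1 ?_).trans (by linarith)
        simp only [Function.comp, hg.add_int, hxu, hxs]; exact h3
    · obtain ⟨k, hk⟩ := hS'.exists_mem hg (hline 1) hV (hro 1) (htI.1.trans htI.2) h
      have h1 := happ' _ hk
      rw [hg.add_int, hxu, ← hzu] at h1
      have h2 : z.2 = max 0 (1 - z.1) := congrArg Prod.snd (hφ.injective h1)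
      have h3 : 0 ≤ z.1 := by linarith [le_max_right 0 (1 - z.1)]
      refine ⟨k, ?_, ?_⟩
      · refine le_trans (by linarith) ((hmono'.le_iff_le htI hk).1 ?_)
        simp only [Function.comp, hg.add_int, hxu, hxt]; exact h3
      · refine (hmono'.le_iff_le hk hbI).1 ?_
        simp only [Function.comp, hg.add_int, hxu, hxb]; exact hz.1.2
  have hcases : ∀ u ∈ Icc a b, u ∈ Ico a s ∨ u = s ∨ u ∈ Ioo s t ∨ u = t ∨ u ∈ Ioc t b := by
    intro u hu
    rcases lt_trichotomy u s with h | h | h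
    · exact Or.inl ⟨hu.1, h⟩
    · exact Or.inr (Or.inl h)
    rcases lt_trichotomy u t with h' | h' | h'
    · exact Or.inr (Or.inr (Or.inl ⟨h, h'⟩))
    · exact Or.inr (Or.inr (Or.inr (Or.inl h')))
    · exact Or.inr (Or.inr (Or.inr (Or.inr ⟨h', hu.2⟩)))
  have hQ : ∀ u ∈ Icc a b, g u ∈ φ '' box := by
    intro u hu
    have hv : g u = φ (0, 1) → g u ∈ φ '' box := fun h =>
      ⟨_, ⟨⟨by norm_num, by norm_num⟩, by norm_num, by norm_num⟩, h.symm⟩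
    rcases hcases u hu with h | rfl | h | rfl | h
    · obtain ⟨h1, h2, h3⟩ := hleg u h
      have h4 := le_max_left 0 (1 + absc φ (g u))
      rw [happ u h1]
      exact mem_image_of_mem φ ⟨⟨h2, by linarith⟩, by linarith, max_le (by norm_num) (by linarith)⟩
    · exact hv hgs
    · obtain ⟨z, hz, hzu⟩ := hup u h
      refine ⟨z, ?_, hzu⟩
      obtain ⟨τ, rfl⟩ := exists_kinkPath ((hk z).1 ⟨u, hzu.symm⟩)
      have := kinkPath_mem_upper.1 hz
      exact (kinkPath_mem_box_iff τ).2 (abs_le.2 ⟨by linarith [this.1], by linarith [this.2]⟩)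
    · exact hv hgt
    · obtain ⟨h1, h2, h3⟩ := hleg' u h
      have h4 := le_max_left 0 (1 - absc φ (g u))
      rw [happ' u h1]
      exact mem_image_of_mem φ ⟨⟨by linarith, h3⟩, by linarith, max_le (by norm_num) (by linarith)⟩
  have hkinked : Kinked g a b s t := by
    refine ⟨has, hst, htb, hba, hgs.trans hgt.symm, fun u hu v huv => ?_⟩
    rcases hcases u hu with h | rfl | h | rfl | h
    · obtain ⟨h1, h2, h3⟩ := hleg u h
      have h4 := happ u h1
      have hlow : g v ∈ φ '' lower := huv ▸ image_mono (fun z hz => hz.1) (hS.mem u h1)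
      rcases hexists v hlow with h5 | h5
      · obtain ⟨k, hk⟩ := heq 0 u v (hruns u h1) h5 huv
        exact ⟨k, Or.inl hk⟩
      · obtain ⟨z, ⟨-, hz⟩, hzv⟩ := h5.self
        rw [← huv, h4] at hzv
        have := hφ.injective hzv
        subst this
        have hz' : max 0 (1 + absc φ (g u)) = max 0 (1 - absc φ (g u)) := hz
        have h6 : max 0 (1 + absc φ (g u)) ≤ 1 := max_le (by norm_num) (by linarith)
        linarith [le_max_right 0 (1 - absc φ (g u))]
    · obtain ⟨k, h | h⟩ := hvertex v (huv.symm.trans hgs)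
      · exact ⟨k, Or.inl h⟩
      · exact ⟨k, Or.inr (Or.inl ⟨rfl, h⟩)⟩
    · obtain ⟨k, hk⟩ := hcov v (huv ▸ hup u h)
      have := hinj h hk (by rw [hg.add_int, huv])
      exact ⟨-k, Or.inl (by rw [this]; push_cast; ring)⟩
    · obtain ⟨k, h | h⟩ := hvertex v (huv.symm.trans hgt)
      · exact ⟨k, Or.inr (Or.inr ⟨rfl, h⟩)⟩
      · exact ⟨k, Or.inl h⟩
    · obtain ⟨h1, h2, h3⟩ := hleg' u h
      have h4 := happ' u h1
      have hlow : g v ∈ φ '' lower := huv ▸ image_mono (fun z hz => hz.1) (hS'.mem u h1)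
      rcases hexists v hlow with h5 | h5
      · obtain ⟨z, ⟨-, hz⟩, hzv⟩ := h5.self
        rw [← huv, h4] at hzv
        have := hφ.injective hzv
        subst this
        have hz' : max 0 (1 - absc φ (g u)) = max 0 (1 + absc φ (g u)) := hz
        have h6 : max 0 (1 - absc φ (g u)) ≤ 1 := max_le (by norm_num) (by linarith)
        linarith [le_max_right 0 (1 + absc φ (g u))]
      · obtain ⟨k, hk⟩ := heq 1 u v (hruns' u h1) h5 huv
        exact ⟨k, Or.inl hk⟩
  have hab : a < b := by linarith
  -- The whole time from `a` to `b` is spent on running straight from `(-2, 0)` to `(2, 0)`, with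
  -- affine speed.
  let ξ : ℝ → ℝ := fun u => -2 + 4 * ((u - a) / (b - a))
  have hξc : Continuous ξ := by fun_prop
  have hξm : StrictMono ξ := by
    intro u v huv
    have := div_lt_div_of_pos_right (show u - a < v - a by linarith) (show 0 < b - a by linarith)
    simp only [ξ]; linarith
  have hξa : ξ a = -2 := by simp [ξ]
  have hξb : ξ b = 2 := by simp only [ξ]; rw [div_self (by linarith)]; norm_num
  have hga : g a = φ (-2, 0) := by rw [happ a haI, hxa]; norm_num
  have hgb : g b = φ (2, 0) := by rw [happ' b hbI, hxb]; norm_num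
  obtain ⟨g', hc', hper', hin, hoff⟩ := exists_replace hg.continuous hg.periodic
    (γ := fun u => φ (ξ u, 0)) hab.le hba
    (hφ.continuous.comp (hξc.prodMk continuous_const)).continuousOn
    (by rw [hga, hξa]) (by rw [hgb, hξb])
  have hp : Pass g' φ (fun _ => 0) ξ (-2) 2 a b :=
    ⟨hab, hξc.continuousOn, Or.inl ⟨hξm.strictMonoOn _, hξa, hξb⟩, hin⟩
  have h0 : (0 : ℝ) ∈ Icc (-2) 2 := by constructor <;> norm_num
  have hQ' : ∀ u ∈ Icc a b, g' u ∈ φ '' box := fun u hu =>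
    ⟨_, ⟨hp.mem_Icc hu, h0⟩, (hp.apply u hu).symm⟩
  have hZ' : ∀ u, g' u ∈ φ '' box → u ∈ Zone a b := fun u hu =>
    hZ u ((mem_iff_of_modify hg.periodic hper' hQ hQ' hoff u).2 hu)
  have hplain : Plain g' a b := by
    intro u hu v huv
    obtain ⟨k, hk⟩ := hZ' v (huv ▸ hQ' u hu)
    have h1 := hp.apply _ hk
    rw [add_int_of_periodic hper', ← huv, hp.apply u hu] at h1
    have h2 := hφ.injective h1
    rw [Prod.mk.injEq] at h2
    refine ⟨-k, ?_⟩
    rw [hp.injOn hu hk h2.1]; push_cast; ring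
  have hB : φ ⁻¹' range g = kink := by ext z; exact hk z
  have hrange : range g' = C' := by
    refine range_of_modify hg.periodic hper' hQ hQ' hoff
      (replaces_iff hB hA hd fun z hz => (strand_agree z hz).symm) ?_
    rintro _ ⟨z, hz, rfl⟩
    have hA' : φ z ∈ C' ↔ z ∈ strand := by rw [← hA]; rfl
    rw [hA']
    constructor
    · rintro ⟨u, hu⟩
      obtain ⟨k, hk⟩ := hZ' u (hu ▸ mem_image_of_mem φ hz)
      rw [← add_int_of_periodic hper' u k, hin _ hk] at hu
      rw [← hφ.injective hu]
      rfl
    · intro (hz0 : z.2 = 0)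
      obtain ⟨u, hu, hx⟩ := hp.exists_Icc hz.1
      exact ⟨u, by rw [hin u hu, hx, ← hz0]⟩
  have hg' : GenericLoop g' := by
    refine genericLoop_of_modify hg hc' hper' (isClosed_box hφ) hQ hQ' hoff finite_empty ?_
      (fun τ hτ => absurd hτ (notMem_empty τ))
    rintro u hu ⟨v, hv, hk⟩
    obtain ⟨m, hm⟩ := hZ' u hu
    obtain ⟨k, h⟩ := hplain _ hm v ((add_int_of_periodic hper' u m).trans hv.symm)
    exact absurd (by rw [h]; push_cast; ring) (hk (m + k))
  obtain ⟨L', hL'⟩ := hL.remove_kink hg.periodic hper' hkinked hplain hoff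
  exact ⟨g', L', hg', hrange, hL'⟩

/-- The monogon is entered along one of the two legs. Reflecting the disk in the vertical axis
exchanges them and preserves both pictures, so the left leg may be assumed. -/
theorem HasArcSystem.move1a {C C' : Set F} (h : HasArcSystem C) (hM : Move1a C C') :
    HasArcSystem C' := by
  obtain ⟨g, L, hg, rfl, hL⟩ := h
  obtain ⟨φ, hφ, hB, hA, hd⟩ := hM
  have hk : ∀ z, φ z ∈ range g ↔ z ∈ kink := fun z => iff_of_eq (congrArg (z ∈ ·) hB)
  have hout : ∃ u, g u ∉ range φ := by
    refine exists_notMem_range hg.continuous hg.periodic hφ fun B => ⟨(|B| + 1, 0), ?_, ?_⟩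
    · refine (hk _).2 (Or.inl ⟨?_, rfl⟩)
      rw [abs_of_nonneg (by positivity)]; linarith [abs_nonneg B]
    · simp only; linarith [le_abs_self B]
  obtain ⟨s, t, hst, hts, hgs, hgt, hup, hcov, hinj⟩ := exists_monogon hg hφ hk hout
  have h01 : ((0 : ℝ), (1 : ℝ)) ∈ lower := by norm_num [lower]
  obtain ⟨i, hi⟩ := graphPicture_leg.exists_runsOn hφ hg (fun z hz => (hk z).trans (mem_kink_iff hz))
    (u := s) ⟨_, h01, hgs.symm⟩
  have hi' : i = 0 ∨ i = 1 := by clear hi; revert i; decide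
  rcases hi' with rfl | rfl
  · exact HasArcSystem.remove_kink_of_left hg hL hφ hk hA hd hout hst hts hgs hgt hup hcov hinj hi
  · let μ : ℝ × ℝ ≃ₜ ℝ × ℝ := (Homeomorph.neg ℝ).prodCongr (Homeomorph.refl ℝ)
    have hμ : ∀ z, μ z = (-z.1, z.2) := fun z => rfl
    have hμμ : ∀ z, μ (μ z) = z := fun z => by rw [hμ, hμ]; simp
    have hr : range (φ ∘ μ) = range φ := μ.surjective.range_comp φ
    have himg : ∀ S S' : Set (ℝ × ℝ), (∀ z, μ z ∈ S' ↔ z ∈ S) → (φ ∘ μ) '' S = φ '' S' := by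
      intro S S' h
      ext q
      constructor
      · rintro ⟨z, hz, rfl⟩; exact ⟨μ z, (h z).2 hz, rfl⟩
      · rintro ⟨z, hz, rfl⟩
        exact ⟨μ z, (h _).1 (by rwa [hμμ]), by simp only [Function.comp, hμμ]⟩
    have hup' : (φ ∘ μ) '' upper = φ '' upper := himg _ _ fun z => by rw [hμ]; rfl
    have hleg : (φ ∘ μ) '' graphIn lower (legFun 0) = φ '' graphIn lower (legFun 1) := by
      refine himg _ _ fun z => ?_
      rw [hμ]
      simp only [graphIn, lower, legFun, mem_ofPred_eq, Matrix.cons_val, sub_neg_eq_add]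
    have hkink : ∀ z, μ z ∈ kink ↔ z ∈ kink := fun z => by
      rw [hμ]; simp only [kink, mem_ofPred_eq, abs_neg]
    have hμ01 : (φ ∘ μ) (0, 1) = φ (0, 1) := by simp only [Function.comp, hμ, neg_zero]
    refine HasArcSystem.remove_kink_of_left (φ := φ ∘ μ) hg hL (hφ.comp μ.isOpenEmbedding)
      (fun z => (hk _).trans (hkink z)) ?_ (by rwa [hr]) (by rwa [hr]) hst hts (by rwa [hμ01])
      (by rwa [hμ01]) (by rwa [hup']) (by rwa [hup']) hinj (by rwa [hleg])
    rw [preimage_comp, hA]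
    rfl

/-! ### The invariant obstructs simplification -/

variable {F : Type*} [TopologicalSpace F] [T2Space F]

/-- A homeomorphism of the surface changes no coincidence of times, so the same set of arcs serves.
-/
theorem HasArcSystem.image {C : Set F} (h : HasArcSystem C) (H : F ≃ₜ F) : HasArcSystem (H '' C) := by
  obtain ⟨g, L, hg, rfl, hL⟩ := h
  have hd : ∀ t, DoubleTime (H ∘ g) t ↔ DoubleTime g t := fun t => by
    simp only [DoubleTime, Function.comp, H.injective.eq_iff]
  refine ⟨H ∘ g, L, ⟨H.continuous.comp hg.continuous, fun x => congrArg H (hg.periodic x), ?_, ?_⟩,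
    range_comp H g, ?_⟩
  · simp only [hd]; exact hg.finite
  · intro t ht
    obtain ⟨O₁, O₂, h1, h2, hd', hl, hr, h3⟩ := hg.transverse t ((hd t).1 ht)
    refine ⟨H '' O₁, H '' O₂, H.isOpenMap _ h1, H.isOpenMap _ h2,
      (disjoint_image_iff H.injective).2 hd', hl.mono fun w hw => mem_image_of_mem H hw,
      hr.mono fun w hw => mem_image_of_mem H hw, ?_⟩
    rw [Function.comp, ← H.map_nhds_eq, eventually_map]
    filter_upwards [h3] with q hq hqr
    rw [← image_union]
    refine mem_image_of_mem H (hq fun ⟨w, hw⟩ => hqr ⟨w, congrArg H hw⟩)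
  · exact ⟨hL.lt, hL.lt_add_one, fun a ha => congrArg H (hL.eq a ha),
      fun s t h1 h2 h3 => hL.choice s t h1 h2 (H.injective h3), hL.cover, hL.not_cover⟩

/-- A generic loop on an embedded circle has no double points. -/
theorem eq_add_int_of_isEmbedding {f : C(Circle, F)} (hf : IsEmbedding f) {g : ℝ → F}
    (hg : GenericLoop g) (hfg : range f = range g) {s t : ℝ} (hst : g s = g t) :
    ∃ k : ℤ, t = s + k := by
  obtain ⟨ζ, hζ⟩ : g s ∈ range f := hfg ▸ mem_range_self s
  -- The circle without the antipode of the given point is a `Line`, with the argument as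
  -- coordinate. The loop `g` need not be related to the parametrization `f`, but it follows this
  -- line and does so only once.
  let p : F := f (-ζ)
  have hinv : ∀ z, Function.invFun f (f z) = z := Function.leftInverse_invFun hf.injective
  have hinvc : ContinuousOn (Function.invFun f) (range f) := by
    rintro _ ⟨z, rfl⟩
    rw [ContinuousWithinAt, hinv, ← hf.map_nhds_eq, tendsto_map'_iff]
    exact tendsto_id.congr fun z => (hinv z).symm
  have harg : ∀ q ∈ range f \ {p}, (ζ⁻¹ * Function.invFun f q : Circle) ≠ -1 := by
    rintro _ ⟨⟨z, rfl⟩, hz⟩ h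
    rw [hinv] at h
    refine hz (congrArg f ?_)
    rw [inv_mul_eq_iff_eq_mul] at h
    rw [h, mul_neg, mul_one]
  have hexp : Circle.exp Real.pi = -1 := Circle.ext (by
    rw [Circle.coe_exp, Complex.exp_pi_mul_I, Circle.coe_neg, Circle.coe_one])
  have hslit : ∀ z : Circle, z ≠ -1 → (z : ℂ) ∈ Complex.slitPlane := by
    intro z hz
    rw [Complex.mem_slitPlane_iff_arg]
    refine ⟨fun h => hz ?_, z.coe_ne_zero⟩
    rw [← Circle.exp_arg z, h]
    exact hexp
  have hL : Line ({p}ᶜ) (range f \ {p}) (fun q => Complex.arg (ζ⁻¹ * Function.invFun f q : Circle))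
      (fun τ => f (ζ * Circle.exp τ)) (Ioo (-Real.pi) Real.pi) :=
    { subset := fun q hq => hq.2
      closed := by
        intro q hq hcl
        have : IsClosed (range f) := (isCompact_range f.continuous).isClosed
        exact ⟨this.closure_subset_iff.2 sdiff_subset hcl, hq⟩
      contX := by
        intro q hq
        have h1 : ContinuousWithinAt (fun q => ((ζ⁻¹ * Function.invFun f q : Circle) : ℂ))
            (range f \ {p}) q :=
          continuous_subtype_val.continuousAt.comp_continuousWithinAt
            (continuousWithinAt_const.mul ((hinvc q hq.1).mono sdiff_subset))
        exact ContinuousAt.comp_continuousWithinAt (g := Complex.arg)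
          (Complex.continuousAt_arg (hslit _ (harg q hq))) h1
      openJ := isOpen_Ioo
      ordJ := ordConnected_Ioo
      contκ := (f.continuous.comp (continuous_const.mul Circle.exp.continuous)).continuousOn
      mapsκ := by
        intro τ hτ
        refine ⟨mem_range_self _, fun h => ?_⟩
        have h1 : ζ * Circle.exp τ = -ζ := hf.injective h
        have h2 : Circle.exp τ = Circle.exp Real.pi := by
          rw [hexp]
          rw [← mul_neg_one] at h1
          exact mul_left_cancel h1
        have h3 := Circle.arg_exp hτ.1 hτ.2.le
        rw [h2, Circle.arg_exp (by linarith [Real.pi_pos]) le_rfl] at h3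
        exact hτ.2.ne' h3
      mapsX := fun q hq => ⟨Complex.neg_pi_lt_arg _, lt_of_le_of_ne (Complex.arg_le_pi _)
        (Complex.slitPlane_arg_ne_pi (hslit _ (harg q hq)))⟩
      left_inv := by
        intro τ hτ
        simp only [hinv, inv_mul_cancel_left]
        exact Circle.arg_exp hτ.1 hτ.2.le
      right_inv := by
        rintro _ ⟨⟨z, rfl⟩, hz⟩
        simp only [hinv, Circle.exp_arg, mul_inv_cancel_left] }
  have hV : IsOpen ({p}ᶜ : Set F) := isOpen_compl_singleton
  have hruns : ∀ u, g u ∈ range f \ {p} → RunsOn g (range f \ {p}) u := fun u hu => by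
    filter_upwards [hg.continuous.continuousAt.eventually (hV.mem_nhds hu.2)] with w hw
    exact ⟨hfg ▸ mem_range_self w, hw⟩
  have hne : g s ≠ p := by
    rw [← hζ]
    intro h
    have h1 : ζ = -ζ := hf.injective h
    have h2 : (ζ : ℂ) = -ζ := congrArg Subtype.val h1
    exact ζ.coe_ne_zero (self_eq_neg.1 h2)
  have hs : g s ∈ range f \ {p} := ⟨hfg ▸ mem_range_self s, hne⟩
  refine hL.eq_add_int hg hV ?_ (fun u hu => Or.inl (hruns u hu)) (hruns s hs)
    (hruns t (hst ▸ hs)) hst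
  obtain ⟨u, hu⟩ : p ∈ range g := hfg ▸ mem_range_self _
  exact ⟨u, fun h => h hu⟩

/-- The arc that covers the time `0` has two ends with the same image, incongruent modulo `1`. -/
theorem HasArcSystem.not_isEmbeddedCircle {C : Set F} (h : HasArcSystem C) : ¬ IsEmbeddedCircle C := by
  rintro ⟨f, hf, rfl⟩
  obtain ⟨g, L, hg, hgf, hL⟩ := h
  obtain ⟨a, ha, -⟩ := hL.cover 0
  have h1 := hL.lt a ha
  have h2 := hL.lt_add_one a ha
  obtain ⟨k, hk⟩ := eq_add_int_of_isEmbedding hf hg hgf.symm (hL.eq a ha)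
  exact not_int_of_abs_lt h1.ne' (abs_lt.2 ⟨by linarith, by linarith⟩) k hk

/-- A curve with an arc system is not simplifiable. -/
theorem HasArcSystem.not_simplifiable {C : Set F} (h : HasArcSystem C) :
    ¬ IsOneThreeSimplifiable C := by
  rintro ⟨N, c, rfl, -, hstep, hend⟩
  have key : ∀ i ≤ N, HasArcSystem (c i) := by
    intro i
    induction i with
    | zero => exact fun _ => h
    | succ i ih =>
      intro hi
      have hc := ih (by omega)
      rcases hstep i (by omega) with hm | hm | hm | ⟨H, -, -, -, hm⟩
      · exact hc.move1a hm
      · exact hc.move1b hm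
      · exact hc.move3 hm
      · exact hm ▸ hc.image _
  exact (key N le_rfl).not_isEmbeddedCircle hend

/-! ### Immersed curves from local charts of a periodic loop -/

variable {F : Type*} [TopologicalSpace F] [T2Space F]

/-- Points of the loop near `p` are taken near the times at which `p` is taken. -/
theorem eventually_mem_of_apply_eq {g : ℝ → F} (hc : Continuous g) (hper : Function.Periodic g 1)
    {p : F} {N : Set ℝ} (hN : IsOpen N) (hN' : ∀ w ∈ N, ∀ k : ℤ, w + k ∈ N)
    (hp : ∀ w, g w = p → w ∈ N) : ∀ᶠ q in 𝓝 p, ∀ w, g w = q → w ∈ N := by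
  have hK : IsClosed (g '' (Icc 0 1 \ N)) := ((isCompact_Icc.diff hN).image hc).isClosed
  have hpK : p ∉ g '' (Icc 0 1 \ N) := by
    rintro ⟨w, hw, hwp⟩; exact hw.2 (hp w hwp)
  filter_upwards [hK.isOpen_compl.mem_nhds hpK] with q hq w hw
  by_contra hwN
  obtain ⟨k, h1, h2⟩ := exists_add_int_mem_Ico 0 w
  refine hq ⟨w + k, ⟨⟨h1, by linarith⟩, fun h => hwN ?_⟩, by rw [add_int_of_periodic hper, hw]⟩
  have := hN' _ h (-k)
  push_cast at this
  rwa [add_neg_cancel_right] at this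

/-- If a chart straightens all strands of a loop through a point, then it describes the loop near
this point. -/
theorem eventually_mem_range_iff {g : ℝ → F} (hc : Continuous g) (hper : Function.Periodic g 1)
    {ι : Type*} (E : OpenPartialHomeomorph (ℝ × ℝ) F) (h0 : 0 ∈ E.source) (t : ι → ℝ)
    (a : ι → ℝ → ℝ × ℝ) (ha : ∀ i, Continuous (a i)) (ha0 : ∀ i, a i 0 = 0)
    (hE : ∀ i x, a i x ∈ E.source → E (a i x) = g (t i + x))
    (ht : ∀ w, g w = E 0 → ∃ (i : ι) (k : ℤ), w = t i + k) :
    ∀ᶠ q in 𝓝 (E 0), q ∈ range g ↔ ∃ i x, E.symm q = a i x := by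
  have hN : IsOpen {w : ℝ | ∃ (i : ι) (k : ℤ), a i (w + k - t i) ∈ E.source} := by
    have : {w : ℝ | ∃ (i : ι) (k : ℤ), a i (w + k - t i) ∈ E.source} =
        ⋃ (i : ι) (k : ℤ), (fun w : ℝ => a i (w + k - t i)) ⁻¹' E.source := by
      ext w; simp only [mem_ofPred_eq, mem_iUnion, mem_preimage]
    rw [this]
    exact isOpen_iUnion fun i => isOpen_iUnion fun k =>
      E.open_source.preimage ((ha i).comp (by fun_prop))
  filter_upwards [E.open_target.mem_nhds (E.map_source h0), eventually_mem_of_apply_eq hc hper hN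
    (by
      rintro w ⟨i, k, h⟩ m
      refine ⟨i, k - m, ?_⟩
      push_cast
      rwa [show w + m + (k - m) - t i = w + k - t i by ring])
    (by
      intro w hw
      obtain ⟨i, k, rfl⟩ := ht w hw
      refine ⟨i, -k, ?_⟩
      push_cast
      rw [show t i + (k : ℝ) + -k - t i = 0 by ring, ha0]
      exact h0)] with q hq hqN
  constructor
  · rintro ⟨w, hw⟩
    obtain ⟨i, k, h⟩ := hqN w hw
    refine ⟨i, w + k - t i, ?_⟩
    have h1 := hE i _ h
    rw [add_sub_cancel, add_int_of_periodic hper, hw] at h1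
    rw [← h1, E.left_inv h]
  · rintro ⟨i, x, hx⟩
    have h1 := E.map_target hq
    rw [hx] at h1
    refine ⟨t i + x, ?_⟩
    rw [← hE i x h1, ← hx, E.right_inv hq]

/-- At time `t` the loop passes through a simple point, and it is straight in some chart. -/
def SimpleAt (g : ℝ → F) (t : ℝ) : Prop :=
  (∀ w, g w = g t → ∃ k : ℤ, w = t + k) ∧ ∃ E : OpenPartialHomeomorph (ℝ × ℝ) F, 0 ∈ E.source ∧
    ∀ x : ℝ, (x, 0) ∈ E.source → E (x, 0) = g (t + x)

/-- At the times `t` and `v` the loop passes through the same double point, and in some chart it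
runs along the coordinate axes. -/
def CrossingAt (g : ℝ → F) (t v : ℝ) : Prop :=
  (∀ k : ℤ, v ≠ t + k) ∧ (∀ w, g w = g t → ∃ k : ℤ, w = t + k ∨ w = v + k) ∧
    ∃ E : OpenPartialHomeomorph (ℝ × ℝ) F, 0 ∈ E.source ∧
      (∀ x : ℝ, (x, 0) ∈ E.source → E (x, 0) = g (t + x)) ∧
      ∀ y : ℝ, (0, y) ∈ E.source → E (0, y) = g (v + y)

section

variable {g : ℝ → F} {t v : ℝ} {E : OpenPartialHomeomorph (ℝ × ℝ) F}

theorem eventually_apply_eq_left (h0 : 0 ∈ E.source)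
    (h1 : ∀ x : ℝ, (x, 0) ∈ E.source → E (x, 0) = g (t + x)) :
    ∀ᶠ w in 𝓝 t, ((w - t, 0) : ℝ × ℝ) ∈ E.source ∧ g w = E (w - t, 0) := by
  have hc : Continuous fun w : ℝ => ((w - t, 0) : ℝ × ℝ) := by fun_prop
  have : ∀ᶠ w in 𝓝 t, ((w - t, 0) : ℝ × ℝ) ∈ E.source :=
    hc.continuousAt.eventually (E.open_source.mem_nhds (by simp only [sub_self]; exact h0))
  filter_upwards [this] with w hw
  exact ⟨hw, by rw [h1 _ hw]; congr 1; ring⟩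

theorem eventually_apply_eq_right (h0 : 0 ∈ E.source)
    (h1 : ∀ x : ℝ, (0, x) ∈ E.source → E (0, x) = g (v + x)) :
    ∀ᶠ w in 𝓝 v, ((0, w - v) : ℝ × ℝ) ∈ E.source ∧ g w = E (0, w - v) := by
  have hc : Continuous fun w : ℝ => ((0, w - v) : ℝ × ℝ) := by fun_prop
  have : ∀ᶠ w in 𝓝 v, ((0, w - v) : ℝ × ℝ) ∈ E.source :=
    hc.continuousAt.eventually (E.open_source.mem_nhds (by simp only [sub_self]; exact h0))
  filter_upwards [this] with w hw
  exact ⟨hw, by rw [h1 _ hw]; congr 1; ring⟩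

theorem SimpleAt.eventually_iff (hc : Continuous g) (hper : Function.Periodic g 1)
    (ht : ∀ w, g w = g t → ∃ k : ℤ, w = t + k) (h0 : 0 ∈ E.source)
    (h1 : ∀ x : ℝ, (x, 0) ∈ E.source → E (x, 0) = g (t + x)) :
    ∀ᶠ q in 𝓝 (g t), q ∈ range g ↔ (E.symm q).2 = 0 := by
  have hgt : E 0 = g t := by have := h1 0 h0; rwa [add_zero] at this
  rw [← hgt]
  filter_upwards [eventually_mem_range_iff hc hper E h0 (fun _ : Unit => t) (fun _ x => (x, 0))
    (fun _ => by fun_prop) (fun _ => rfl) (fun _ => h1) (fun w hw => by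
      obtain ⟨k, hk⟩ := ht w (hw.trans hgt); exact ⟨(), k, hk⟩)] with q hq
  rw [hq]
  exact ⟨fun ⟨_, x, h⟩ => by rw [h], fun h => ⟨(), (E.symm q).1, Prod.ext rfl h⟩⟩

theorem CrossingAt.eventually_iff (hc : Continuous g) (hper : Function.Periodic g 1)
    (ht : ∀ w, g w = g t → ∃ k : ℤ, w = t + k ∨ w = v + k) (h0 : 0 ∈ E.source)
    (h1 : ∀ x : ℝ, (x, 0) ∈ E.source → E (x, 0) = g (t + x))
    (h2 : ∀ y : ℝ, (0, y) ∈ E.source → E (0, y) = g (v + y)) :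
    ∀ᶠ q in 𝓝 (g t), q ∈ range g ↔ (E.symm q).1 = 0 ∨ (E.symm q).2 = 0 := by
  have hgt : E 0 = g t := by have := h1 0 h0; rwa [add_zero] at this
  rw [← hgt]
  filter_upwards [eventually_mem_range_iff hc hper E h0 (fun i : Bool => bif i then t else v)
    (fun i x => bif i then (x, 0) else (0, x))
    (fun i => by cases i <;> simp only [cond_true, cond_false] <;> fun_prop)
    (fun i => by cases i <;> rfl)
    (fun i => by cases i; exacts [h2, h1])
    (fun w hw => by
      obtain ⟨k, hk | hk⟩ := ht w (hw.trans hgt)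
      exacts [⟨true, k, hk⟩, ⟨false, k, hk⟩])] with q hq
  rw [hq]
  constructor
  · rintro ⟨i, x, h⟩
    cases i
    · left; rw [h]; rfl
    · right; rw [h]; rfl
  · rintro (h | h)
    · exact ⟨false, (E.symm q).2, Prod.ext h rfl⟩
    · exact ⟨true, (E.symm q).1, Prod.ext rfl h⟩

/-- In the chart, the strand at time `t` crosses the vertical axis, which belongs to the loop; the
two open half-planes beside this axis are the required pieces. -/
theorem CrossingAt.transverse (hc : Continuous g) (hper : Function.Periodic g 1)
    (h : CrossingAt g t v) : Transverse g t := by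
  obtain ⟨-, ht, E, h0, h1, h2⟩ := h
  have hgt : E 0 = g t := by have := h1 0 h0; rwa [add_zero] at this
  have hopen : ∀ S : Set (ℝ × ℝ), IsOpen S → IsOpen (E '' (E.source ∩ S)) := fun S hS =>
    E.isOpen_image_of_subset_source (E.open_source.inter hS) inter_subset_left
  have hmem := eventually_apply_eq_left h0 h1
  refine ⟨E '' (E.source ∩ {z | z.1 < 0}), E '' (E.source ∩ {z | 0 < z.1}),
    hopen _ (isOpen_lt continuous_fst continuous_const),
    hopen _ (isOpen_lt continuous_const continuous_fst), ?_, ?_, ?_, ?_⟩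
  · rw [disjoint_left]
    rintro _ ⟨z, ⟨hz, hz1⟩, rfl⟩ ⟨z', ⟨hz', hz2⟩, he⟩
    have := E.injOn hz' hz he
    subst this
    exact lt_asymm (show z'.1 < 0 from hz1) hz2
  · filter_upwards [hmem.filter_mono nhdsWithin_le_nhds, self_mem_nhdsWithin] with w hw (hwt : w < t)
    exact ⟨_, ⟨hw.1, sub_neg.2 hwt⟩, hw.2.symm⟩
  · filter_upwards [hmem.filter_mono nhdsWithin_le_nhds, self_mem_nhdsWithin] with w hw (hwt : t < w)
    exact ⟨_, ⟨hw.1, sub_pos.2 hwt⟩, hw.2.symm⟩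
  · filter_upwards [eventually_iff hc hper ht h0 h1 h2,
      E.open_target.mem_nhds (hgt ▸ E.map_source h0)] with q hq hqt hqr
    rw [hq, not_or] at hqr
    have h3 := E.right_inv hqt
    have h4 := E.map_target hqt
    rcases lt_or_gt_of_ne hqr.1 with h | h
    · exact Or.inl ⟨_, ⟨h4, h⟩, h3⟩
    · exact Or.inr ⟨_, ⟨h4, h⟩, h3⟩

end

theorem circle_exp_eq_iff (x y : ℝ) :
    Circle.exp (2 * Real.pi * x) = Circle.exp (2 * Real.pi * y) ↔ ∃ k : ℤ, x = y + k := by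
  rw [Circle.exp_eq_exp]
  have := Real.pi_pos
  constructor
  · rintro ⟨m, hm⟩
    refine ⟨m, ?_⟩
    have : 2 * Real.pi * x = 2 * Real.pi * (y + m) := by rw [hm]; ring
    exact mul_left_cancel₀ (by positivity) this
  · rintro ⟨k, rfl⟩
    exact ⟨k, by ring⟩

theorem exists_circle_exp (z : Circle) : ∃ x, Circle.exp (2 * Real.pi * x) = z := by
  refine ⟨Complex.arg z / (2 * Real.pi), ?_⟩
  have := Real.pi_pos
  rw [mul_div_cancel₀ _ (by positivity)]
  exact Circle.exp_arg z

theorem nhds_circle_exp (x : ℝ) :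
    𝓝 (Circle.exp (2 * Real.pi * x)) = map (fun x => Circle.exp (2 * Real.pi * x)) (𝓝 x) := by
  have h1 := isLocalHomeomorph_circleExp.map_nhds_eq (2 * Real.pi * x)
  have h2 := (Homeomorph.mulLeft₀ (2 * Real.pi) (by have := Real.pi_pos; positivity)).map_nhds_eq x
  rw [← h1]
  have h3 : 𝓝 (2 * Real.pi * x) = map (fun x => 2 * Real.pi * x) (𝓝 x) := h2.symm
  rw [h3, map_map]
  rfl

/-- A periodic function as a function on the circle. -/
theorem exists_circle_map {g : ℝ → F} (hc : Continuous g) (hper : Function.Periodic g 1) :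
    ∃ f : C(Circle, F), ∀ x, f (Circle.exp (2 * Real.pi * x)) = g x := by
  choose θ hθ using exists_circle_exp
  have hval : ∀ x, g (θ (Circle.exp (2 * Real.pi * x))) = g x := by
    intro x
    obtain ⟨k, hk⟩ := (circle_exp_eq_iff _ _).1 (hθ (Circle.exp (2 * Real.pi * x)))
    rw [hk, add_int_of_periodic hper]
  refine ⟨⟨fun z => g (θ z), ?_⟩, hval⟩
  rw [continuous_iff_continuousAt]
  intro z
  obtain ⟨x, rfl⟩ := exists_circle_exp z
  rw [ContinuousAt, nhds_circle_exp, tendsto_map'_iff, hval]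
  exact (hc.tendsto x).congr fun y => (hval y).symm

/-- The loop descends to the circle. The charts required by the definition are inverses of those in
`SimpleAt` and `CrossingAt`, restricted to where they describe the entire image. -/
theorem isImmersedCurve_of_charts {g : ℝ → F} (hc : Continuous g) (hper : Function.Periodic g 1)
    (h : ∀ t, SimpleAt g t ∨ ∃ v, CrossingAt g t v) : IsImmersedCurve (range g) := by
  obtain ⟨f, hf⟩ := exists_circle_map hc hper
  have hr : range f = range g := by
    ext q
    constructor
    · rintro ⟨z, rfl⟩
      obtain ⟨x, rfl⟩ := exists_circle_exp z
      exact ⟨x, (hf x).symm⟩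
    · rintro ⟨x, rfl⟩; exact ⟨_, hf x⟩
  refine ⟨f, ?_, hr⟩
  rw [IsGenericImmersion, hr]
  rintro _ ⟨t, rfl⟩
  have hchart : ∀ (E : OpenPartialHomeomorph (ℝ × ℝ) F) (P : ℝ × ℝ → Prop), 0 ∈ E.source →
      E 0 = g t → (∀ᶠ q in 𝓝 (g t), q ∈ range g ↔ P (E.symm q)) →
      ∃ e : OpenPartialHomeomorph F (ℝ × ℝ), g t ∈ e.source ∧ e (g t) = (0, 0) ∧
        (∀ q ∈ e.source, (q ∈ range g ↔ P (e q))) ∧ ∀ q, e q = E.symm q := by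
    intro E P h0 hgt hP
    obtain ⟨U, hU, hUo, htU⟩ := eventually_nhds_iff.1 hP
    refine ⟨E.symm.restrOpen U hUo, ⟨?_, htU⟩, ?_, fun q hq => hU q hq.2, fun q => rfl⟩
    · exact hgt ▸ E.map_source h0
    · exact hgt ▸ E.left_inv h0
  rcases h t with ⟨ht, E, h0, h1⟩ | ⟨v, hv, ht, E, h0, h1, h2⟩
  · left
    have hgt : E 0 = g t := by have := h1 0 h0; rwa [add_zero] at this
    refine ⟨Circle.exp (2 * Real.pi * t), ?_, ?_⟩
    · ext z
      obtain ⟨x, rfl⟩ := exists_circle_exp z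
      rw [mem_preimage, mem_singleton_iff, mem_singleton_iff, hf, circle_exp_eq_iff]
      exact ⟨ht x, fun ⟨k, hk⟩ => by rw [hk, add_int_of_periodic hper]⟩
    · obtain ⟨e, he, he0, hP, -⟩ := hchart E (fun z => z.2 = 0) h0 hgt
        (SimpleAt.eventually_iff hc hper ht h0 h1)
      exact ⟨e, he, he0, hP⟩
  · right
    have hgt : E 0 = g t := by have := h1 0 h0; rwa [add_zero] at this
    have hgv : E 0 = g v := by have := h2 0 h0; rwa [add_zero] at this
    refine ⟨Circle.exp (2 * Real.pi * t), Circle.exp (2 * Real.pi * v), ?_, ?_, ?_⟩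
    · intro h
      obtain ⟨k, hk⟩ := (circle_exp_eq_iff _ _).1 h.symm
      exact hv k hk
    · ext z
      obtain ⟨x, rfl⟩ := exists_circle_exp z
      rw [mem_preimage, mem_singleton_iff, mem_insert_iff, mem_singleton_iff, hf, circle_exp_eq_iff,
        circle_exp_eq_iff]
      constructor
      · intro hx
        obtain ⟨k, hk | hk⟩ := ht x hx
        exacts [Or.inl ⟨k, hk⟩, Or.inr ⟨k, hk⟩]
      · rintro (⟨k, hk⟩ | ⟨k, hk⟩)
        · rw [hk, add_int_of_periodic hper]
        · rw [hk, add_int_of_periodic hper, ← hgv, hgt]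
    · obtain ⟨e, he, he0, hP, hee⟩ := hchart E (fun z => z.1 = 0 ∨ z.2 = 0) h0 hgt
        (CrossingAt.eventually_iff hc hper ht h0 h1 h2)
      refine ⟨e, he, he0, hP, ?_, ?_⟩
      · rw [nhds_circle_exp, eventually_map]
        filter_upwards [eventually_apply_eq_left h0 h1] with w hw
        rw [hf, hee, hw.2, E.left_inv hw.1]
      · rw [nhds_circle_exp, eventually_map]
        filter_upwards [eventually_apply_eq_right h0 h2] with w hw
        rw [hf, hee, hw.2, E.left_inv hw.1]

/-! ### The curve in longitude and latitude -/

open Real in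
/-- The longitude of the curve, divided by `π / 4`. -/
noncomputable def lonFun (u : ℝ) : ℝ := u + sin (2 * π * u)

open Real in
/-- The curve in longitude and latitude. -/
noncomputable def lonLat (u : ℝ) : ℝ × ℝ := (π / 4 * lonFun u, cos (π * u))

section

open Real

theorem lonFun_int_add (k : ℤ) (u : ℝ) : lonFun (k + u) = k + lonFun u := by
  rw [lonFun, lonFun, show 2 * π * (k + u) = 2 * π * u + k * (2 * π) by ring, sin_add_int_mul_two_pi]
  ring

theorem lonFun_neg (u : ℝ) : lonFun (-u) = -lonFun u := by
  rw [lonFun, lonFun, mul_neg, sin_neg]; ring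

theorem lonFun_int_sub (k : ℤ) (u : ℝ) : lonFun (k - u) = k - lonFun u := by
  rw [sub_eq_add_neg, lonFun_int_add, lonFun_neg]; ring

theorem abs_lt_one_of_lonFun_eq_zero {δ : ℝ} (h : lonFun δ = 0) : |δ| < 1 := by
  have h1 : δ = -sin (2 * π * δ) := by unfold lonFun at h; linarith
  have h2 : |δ| ≤ 1 := by rw [h1, abs_neg]; exact abs_sin_le_one _
  refine lt_of_le_of_ne h2 fun h3 => ?_
  rcases (abs_eq zero_le_one).1 h3 with rfl | rfl
  · rw [mul_one, sin_two_pi] at h1; norm_num at h1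
  · rw [mul_neg, mul_one, sin_neg, sin_two_pi] at h1; norm_num at h1

/-- At a double zero with `δ ≥ 0`, the cosine would be `c = -1/(2π)` and `δ² = 1 - c²`, so that `1 -
δ ≤ c²`. But `δ = sin (2π(1 - δ)) ≤ 2π(1 - δ) ≤ 2πc² = -c < 4/25`, which is far from `δ² = 1 - c²`.
-/
theorem lonFun_slope_ne_zero {δ : ℝ} (h : lonFun δ = 0) : 1 + 2 * π * cos (2 * π * δ) ≠ 0 := by
  wlog hδ : 0 ≤ δ generalizing δ
  · have := this (δ := -δ) (by rw [lonFun_neg, h, neg_zero]) (by linarith)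
    rwa [mul_neg, cos_neg] at this
  intro hc
  have hpi := pi_gt_d2
  have h1 : sin (2 * π * δ) = -δ := by unfold lonFun at h; linarith
  have h2 := sin_sq_add_cos_sq (2 * π * δ)
  have h3 : sin (2 * π * (1 - δ)) = δ := by
    rw [show 2 * π * (1 - δ) = 2 * π - 2 * π * δ by ring, sin_two_pi_sub, h1, neg_neg]
  have h4 := (abs_lt.1 (abs_lt_one_of_lonFun_eq_zero h)).2
  have h5 : δ ≤ 2 * π * (1 - δ) := by
    rw [← h3]
    refine (sin_le (by nlinarith)).trans ?_
    rw [h3]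
  set c := cos (2 * π * δ) with hcdef
  have h6 : 2 * π * (-c) = 1 := by linarith
  have h7 : 0 < -c := by
    by_contra! h8
    nlinarith
  have h8 : -c < 4 / 25 := by nlinarith
  rw [h1] at h2
  have h9 : 1 - δ ≤ c ^ 2 := by nlinarith
  have h10 : 2 * π * (1 - δ) ≤ -c := by
    have : 2 * π * (1 - δ) ≤ 2 * π * c ^ 2 := by gcongr
    nlinarith
  nlinarith

/-- Reflecting the time in an integer `n` preserves the latitude and reflects the longitude; the two
agree where `lonFun δ = 0`. -/
theorem lonLat_int_add_sub (n : ℤ) {δ : ℝ} (h : lonFun δ = 0) : lonLat (n + δ) = lonLat (n - δ) := by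
  rw [lonLat, lonLat, lonFun_int_add, lonFun_int_sub, h, add_zero, sub_zero,
    show π * (n + δ) = n * (2 * π) - π * (n - δ) by ring, cos_int_mul_two_pi_sub]

theorem hasStrictDerivAt_lonLat (u : ℝ) :
    HasStrictDerivAt lonLat (π / 4 * (1 + 2 * π * cos (2 * π * u)), -(π * sin (π * u))) u := by
  have h1 : HasStrictDerivAt (fun u : ℝ => 2 * π * u) (2 * π) u := by
    simpa using (hasStrictDerivAt_id u).const_mul (2 * π)
  have h2 : HasStrictDerivAt (fun u : ℝ => π * u) π u := by
    simpa using (hasStrictDerivAt_id u).const_mul π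
  have h3 := ((hasStrictDerivAt_id u).add h1.sin).const_mul (π / 4)
  have h4 : HasStrictDerivAt lonLat _ u := h3.prodMk h2.cos
  have h5 : (π / 4 * (1 + 2 * π * cos (2 * π * u)), -(π * sin (π * u))) =
      (π / 4 * (1 + cos (2 * π * u) * (2 * π)), -sin (π * u) * π) := by
    rw [Prod.mk.injEq]
    constructor <;> ring
  rw [h5]
  exact h4

theorem continuous_lonLat : Continuous lonLat := by
  unfold lonLat lonFun; fun_prop

/-- The solutions of the equation for the double points are isolated. -/
theorem finite_zeros : {δ : ℝ | lonFun δ = 0}.Finite := by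
  by_contra hinf
  have hsub : {δ : ℝ | lonFun δ = 0} ⊆ Icc (-1) 1 := fun δ hδ => by
    obtain ⟨h1, h2⟩ := abs_lt.1 (abs_lt_one_of_lonFun_eq_zero hδ)
    exact ⟨h1.le, h2.le⟩
  -- An accumulation point of zeros would be a zero with vanishing derivative.
  obtain ⟨δ, -, hδ⟩ := Set.Infinite.exists_accPt_of_subset_isCompact hinf isCompact_Icc hsub
  have hc : Continuous lonFun := by unfold lonFun; fun_prop
  rw [accPt_iff_frequently] at hδ
  have h0 : lonFun δ = 0 := by
    have hcl : IsClosed {δ : ℝ | lonFun δ = 0} := isClosed_eq hc continuous_const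
    have : δ ∈ closure {δ : ℝ | lonFun δ = 0} :=
      mem_closure_iff_frequently.2 (hδ.mono fun y hy => hy.2)
    rwa [hcl.closure_eq] at this
  have hd : HasDerivAt lonFun (1 + 2 * π * cos (2 * π * δ)) δ := by
    have h1 : HasDerivAt (fun u : ℝ => 2 * π * u) (2 * π) δ := by
      simpa using (hasDerivAt_id δ).const_mul (2 * π)
    have h2 : HasDerivAt lonFun _ δ := (hasDerivAt_id δ).add h1.sin
    rwa [mul_comm (cos _)] at h2
  have := hd.eventually_ne (c := 0) (lonFun_slope_ne_zero h0)
  rw [eventually_nhdsWithin_iff] at this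
  obtain ⟨y, ⟨hy, hy'⟩, h⟩ := (hδ.and_eventually this).exists
  exact h hy hy'

/-- `lonFun` changes sign between `1/2` and `3/4`. That the zero exceeds `1/2` is what makes the
arcs of half-width `δ` around all integers cover the circle. -/
theorem exists_zero : ∃ δ, 1 / 2 < δ ∧ δ < 1 ∧ lonFun δ = 0 := by
  have hc : Continuous lonFun := by unfold lonFun; fun_prop
  have h1 : lonFun (1 / 2) = 1 / 2 := by
    rw [lonFun, show 2 * π * (1 / 2) = π by ring, sin_pi, add_zero]
  have h2 : lonFun (3 / 4) = -(1 / 4) := by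
    rw [lonFun, show 2 * π * (3 / 4) = π / 2 + π by ring, sin_add_pi, sin_pi_div_two]; norm_num
  obtain ⟨δ, hδ, h⟩ := intermediate_value_Icc' (show (1 / 2 : ℝ) ≤ 3 / 4 by norm_num) hc.continuousOn
    (show (0 : ℝ) ∈ Icc (lonFun (3 / 4)) (lonFun (1 / 2)) by rw [h1, h2]; constructor <;> norm_num)
  refine ⟨δ, lt_of_le_of_ne hδ.1 ?_, by linarith [hδ.2], h⟩
  rintro rfl
  rw [h1] at h; norm_num at h

/-- Coincidences of longitude and latitude along the curve. -/
theorem lonLat_cases {a b : ℝ} (h2 : cos (π * a) = cos (π * b)) {k : ℤ}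
    (h1 : lonFun b = lonFun a + 8 * k) : b = a + 8 * k ∨
      ∃ (n : ℤ) (δ : ℝ), lonFun δ = 0 ∧ a = n - δ ∧ b = n + δ + 8 * k := by
  have hpi := pi_pos
  -- Equal latitudes mean that `a` and `b`, modulo `2`, are equal or opposite. In the first case the
  -- longitude forces `b = a + 8k`; in the second it forces `a` to differ by a zero of `lonFun` from
  -- the centre of the reflection, up to the period.
  obtain ⟨m, hm | hm⟩ := cos_eq_cos_iff.1 h2
  · have hb : b = ((2 * m : ℤ) : ℝ) + a := by
      apply mul_left_cancel₀ hpi.ne'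
      push_cast; linarith
    rw [hb, lonFun_int_add] at h1
    left; rw [hb]; linarith
  · have hb : b = ((2 * m : ℤ) : ℝ) - a := by
      apply mul_left_cancel₀ hpi.ne'
      push_cast; linarith
    rw [hb, lonFun_int_sub] at h1
    right
    refine ⟨m - 4 * k, ((m - 4 * k : ℤ) : ℝ) - a, ?_, by ring, ?_⟩
    · rw [lonFun_int_sub]; push_cast at h1 ⊢; linarith
    · rw [hb]; push_cast; ring

/-- The two strands have the same longitudinal speed, nonzero because the zero is simple. Their
latitudinal speeds differ by a multiple of `sin (π δ)`, nonzero because `0 < |δ| < 1`. -/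
theorem crossing_det_ne_zero (n : ℤ) {δ : ℝ} (h : lonFun δ = 0) (hδ : δ ≠ 0) :
    (π / 4 * (1 + 2 * π * cos (2 * π * (n - δ)))) * -(π * sin (π * (n + δ))) -
      -(π * sin (π * (n - δ))) * (π / 4 * (1 + 2 * π * cos (2 * π * (n + δ)))) ≠ 0 := by
  have hpi := pi_pos
  have e1 : cos (2 * π * (n - δ)) = cos (2 * π * δ) := by
    rw [show 2 * π * (n - δ) = n * (2 * π) - 2 * π * δ by ring, cos_int_mul_two_pi_sub]
  have e2 : cos (2 * π * (n + δ)) = cos (2 * π * δ) := by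
    rw [show 2 * π * (n + δ) = 2 * π * δ + n * (2 * π) by ring, cos_add_int_mul_two_pi]
  have e3 : sin (π * (n + δ)) - sin (π * (n - δ)) = 2 * cos (n * π) * sin (π * δ) := by
    rw [show π * (n + δ) = n * π + π * δ by ring, show π * (n - δ) = n * π - π * δ by ring,
      sin_add, sin_sub]
    ring
  have e4 : cos (n * π) ≠ 0 := by
    rcases n.even_or_odd with hn | hn
    · obtain ⟨m, rfl⟩ := hn
      have : cos (((m + m : ℤ) : ℝ) * π) = 1 := by
        rw [← cos_int_mul_two_pi m]; congr 1; push_cast; ring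
      rw [this]; norm_num
    · obtain ⟨m, rfl⟩ := hn
      have : cos (((2 * m + 1 : ℤ) : ℝ) * π) = -1 := by
        rw [← cos_int_mul_two_pi_add_pi m]; congr 1; push_cast; ring
      rw [this]; norm_num
  have e5 : sin (π * δ) ≠ 0 := by
    intro h0
    obtain ⟨m, hm⟩ := sin_eq_zero_iff.1 h0
    have hm' : δ = 0 + (m : ℝ) := by
      apply mul_left_cancel₀ hpi.ne'; linarith
    exact not_int_of_abs_lt hδ (by simpa using abs_lt_one_of_lonFun_eq_zero h) m hm'
  rw [e1, e2]
  have : (π / 4 * (1 + 2 * π * cos (2 * π * δ))) * -(π * sin (π * (n + δ))) -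
      -(π * sin (π * (n - δ))) * (π / 4 * (1 + 2 * π * cos (2 * π * δ))) =
      -(π / 4) * (1 + 2 * π * cos (2 * π * δ)) * π * (2 * cos (n * π) * sin (π * δ)) := by
    rw [← e3]; ring
  rw [this]
  exact mul_ne_zero (mul_ne_zero (mul_ne_zero (by linarith) (lonFun_slope_ne_zero h)) hpi.ne')
    (mul_ne_zero (mul_ne_zero two_ne_zero e4) e5)

/-- Where the latitude is stationary, `cos (2πu) = 1`, and the longitude has positive speed. -/
theorem lonLat_deriv_ne_zero (u : ℝ) :
    π / 4 * (1 + 2 * π * cos (2 * π * u)) ≠ 0 ∨ -(π * sin (π * u)) ≠ 0 := by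
  have hpi := pi_pos
  by_contra! H
  obtain ⟨h1, h2⟩ := H
  have h3 : sin (π * u) = 0 := by
    rcases mul_eq_zero.1 (neg_eq_zero.1 h2) with h | h
    · exact absurd h hpi.ne'
    · exact h
  have h4 : cos (2 * π * u) = 1 := by
    rw [show 2 * π * u = 2 * (π * u) by ring, cos_two_mul, cos_sq', h3]; norm_num
  rw [h4] at h1
  nlinarith

end

/-! ### Charts from transverse velocities -/

/-- An invertible linear map of the plane, given by the images of the basis vectors. -/
theorem exists_equiv_of_det_ne_zero {p q : ℝ × ℝ} (h : p.1 * q.2 - p.2 * q.1 ≠ 0) :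
    ∃ T : (ℝ × ℝ) ≃L[ℝ] ℝ × ℝ, (T : ℝ × ℝ →L[ℝ] ℝ × ℝ) =
      (ContinuousLinearMap.toSpanSingleton ℝ p).comp (ContinuousLinearMap.fst ℝ ℝ ℝ) +
      (ContinuousLinearMap.toSpanSingleton ℝ q).comp (ContinuousLinearMap.snd ℝ ℝ ℝ) := by
  set S : ℝ × ℝ →L[ℝ] ℝ × ℝ :=
    (ContinuousLinearMap.toSpanSingleton ℝ p).comp (ContinuousLinearMap.fst ℝ ℝ ℝ) +
      (ContinuousLinearMap.toSpanSingleton ℝ q).comp (ContinuousLinearMap.snd ℝ ℝ ℝ) with hS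
  have hval : ∀ z, S z = (z.1 * p.1 + z.2 * q.1, z.1 * p.2 + z.2 * q.2) := fun z => by
    simp [hS, Prod.ext_iff]
  have hinj : Function.Injective (S : ℝ × ℝ →ₗ[ℝ] ℝ × ℝ) := by
    rw [← LinearMap.ker_eq_bot, LinearMap.ker_eq_bot']
    intro z hz
    have hz' : S z = 0 := hz
    rw [hval, Prod.mk_eq_zero] at hz'
    obtain ⟨h1, h2⟩ := hz'
    have e1 : z.1 * (p.1 * q.2 - p.2 * q.1) = 0 := by linear_combination q.2 * h1 - q.1 * h2
    have e2 : z.2 * (p.1 * q.2 - p.2 * q.1) = 0 := by linear_combination p.1 * h2 - p.2 * h1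
    exact Prod.ext ((mul_eq_zero.1 e1).resolve_right h) ((mul_eq_zero.1 e2).resolve_right h)
  refine ⟨(LinearEquiv.ofInjectiveEndo (S : ℝ × ℝ →ₗ[ℝ] ℝ × ℝ) hinj).toContinuousLinearEquiv, ?_⟩
  ext <;> simp

/-- Two transverse curves through a point are the coordinate axes of a chart. -/
theorem exists_chart {P Q : ℝ → ℝ × ℝ} {p q : ℝ × ℝ} (hP : HasStrictDerivAt P p 0)
    (hQ : HasStrictDerivAt Q q 0) (h : p.1 * q.2 - p.2 * q.1 ≠ 0) :
    ∃ E : OpenPartialHomeomorph (ℝ × ℝ) (ℝ × ℝ), 0 ∈ E.source ∧ ∀ z, E z = P z.1 + Q z.2 := by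
  obtain ⟨T, hT⟩ := exists_equiv_of_det_ne_zero h
  have h1 : HasStrictFDerivAt (fun z : ℝ × ℝ => P z.1 + Q z.2) (T : ℝ × ℝ →L[ℝ] ℝ × ℝ) 0 := by
    rw [hT]
    have hP' : HasStrictFDerivAt P (ContinuousLinearMap.toSpanSingleton ℝ p) (0 : ℝ × ℝ).1 :=
      hP.hasStrictFDerivAt
    have hQ' : HasStrictFDerivAt Q (ContinuousLinearMap.toSpanSingleton ℝ q) (0 : ℝ × ℝ).2 :=
      hQ.hasStrictFDerivAt
    exact (hP'.comp (0 : ℝ × ℝ) hasStrictFDerivAt_fst).add (hQ'.comp (0 : ℝ × ℝ) hasStrictFDerivAt_snd)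
  exact ⟨h1.toOpenPartialHomeomorph _, h1.mem_toOpenPartialHomeomorph_source, fun z => rfl⟩

/-! ### The curve on a surface with longitude and latitude, and its arc system -/

variable {F : Type*} [TopologicalSpace F]

/-- Coordinates of longitude and latitude on an annulus in the surface `F`. -/
structure LonLatCoord (Φ : ℝ × ℝ → F) : Prop where
  continuous : Continuous Φ
  period : ∀ l b, Φ (l + 2 * Real.pi, b) = Φ (l, b)
  inj : ∀ z z' : ℝ × ℝ, |z.2| ≤ 1 → |z'.2| ≤ 1 → Φ z = Φ z' →
    z.2 = z'.2 ∧ ∃ k : ℤ, z'.1 = z.1 + 2 * Real.pi * k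
  chart : ∀ z : ℝ × ℝ, |z.2| ≤ 1 → ∃ c : OpenPartialHomeomorph (ℝ × ℝ) F, z ∈ c.source ∧
    ∀ w ∈ c.source, c w = Φ w

namespace LonLatCoord

variable {Φ : ℝ × ℝ → F} (hΦ : LonLatCoord Φ)
include hΦ

theorem continuous_loop : Continuous fun x : ℝ => Φ (lonLat (8 * x)) :=
  hΦ.continuous.comp (continuous_lonLat.comp (by fun_prop))

theorem periodic_loop : Function.Periodic (fun x : ℝ => Φ (lonLat (8 * x))) 1 := by
  intro x
  have h : lonLat (8 * (x + 1)) = ((lonLat (8 * x)).1 + 2 * Real.pi, (lonLat (8 * x)).2) := by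
    rw [lonLat, lonLat, show 8 * (x + 1) = ((8 : ℤ) : ℝ) + 8 * x by push_cast; ring, lonFun_int_add,
      show Real.pi * (((8 : ℤ) : ℝ) + 8 * x) = Real.pi * (8 * x) + (4 : ℤ) * (2 * Real.pi) by push_cast; ring,
      Real.cos_add_int_mul_two_pi]
    congr 1
    push_cast; ring
  simp only [h, hΦ.period]

theorem loop_cases {x y : ℝ} (h : Φ (lonLat (8 * x)) = Φ (lonLat (8 * y))) : (∃ k : ℤ, y = x + k) ∨
    ∃ (n : ℤ) (δ : ℝ), lonFun δ = 0 ∧ δ ≠ 0 ∧ 8 * x = n - δ ∧ ∃ k : ℤ, 8 * y = n + δ + 8 * k := by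
  obtain ⟨h1, k, h2⟩ := hΦ.inj _ _ (Real.abs_cos_le_one _) (Real.abs_cos_le_one _) h
  have h3 : lonFun (8 * y) = lonFun (8 * x) + 8 * k := by
    have : Real.pi / 4 * lonFun (8 * y) = Real.pi / 4 * lonFun (8 * x) + 2 * Real.pi * k := h2
    have hpi := Real.pi_pos
    apply mul_left_cancel₀ (show Real.pi / 4 ≠ 0 by positivity)
    rw [this]; ring
  rcases lonLat_cases h1 h3 with h4 | ⟨n, δ, hδ, hx, hy⟩
  · exact Or.inl ⟨k, by linarith⟩
  · by_cases h0 : δ = 0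
    · subst h0
      exact Or.inl ⟨k, by linarith⟩
    · exact Or.inr ⟨n, δ, hδ, h0, hx, k, hy⟩

/-- There are no triple points: the centre `n` is recovered from the time `t` as `lonFun (8 * t)`,
so the partner of `t` is unique modulo the period. -/
theorem crossingAt {t v : ℝ} {n : ℤ} {δ : ℝ} (hδ : lonFun δ = 0) (h0 : δ ≠ 0) (ht : 8 * t = n - δ)
    (hv : 8 * v = n + δ) : CrossingAt (fun x : ℝ => Φ (lonLat (8 * x))) t v := by
  obtain ⟨b1, b2⟩ := abs_lt.1 (abs_lt_one_of_lonFun_eq_zero hδ)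
  have htv : lonLat (8 * v) = lonLat (8 * t) := by rw [hv, ht, lonLat_int_add_sub n hδ]
  refine ⟨?_, ?_, ?_⟩
  · refine not_int_of_abs_lt (fun h => h0 ?_) (abs_lt.2 ⟨by linarith, by linarith⟩)
    rw [h] at hv; linarith
  · intro w hw
    rcases hΦ.loop_cases hw.symm with ⟨k, hk⟩ | ⟨n', δ', hδ', -, ht', k, hk⟩
    · exact ⟨k, Or.inl hk⟩
    · have h1 : lonFun (8 * t) = n := by rw [ht, lonFun_int_sub, hδ, sub_zero]
      have h2 : lonFun (8 * t) = n' := by rw [ht', lonFun_int_sub, hδ', sub_zero]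
      exact ⟨k, Or.inr (by linarith)⟩
  · have hlin : ∀ t : ℝ, HasStrictDerivAt (fun x : ℝ => 8 * (t + x)) 8 0 := fun t => by
      simpa using ((hasStrictDerivAt_id (0 : ℝ)).const_add t).const_mul 8
    have hder : ∀ t : ℝ, HasStrictDerivAt (fun x : ℝ => lonLat (8 * (t + x)))
        ((8 : ℝ) • (Real.pi / 4 * (1 + 2 * Real.pi * Real.cos (2 * Real.pi * (8 * t))),
          -(Real.pi * Real.sin (Real.pi * (8 * t))))) 0 := fun t => by
      have h := (hasStrictDerivAt_lonLat (8 * (t + 0))).scomp (0 : ℝ) (hlin t)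
      rwa [add_zero] at h
    obtain ⟨E, hE0, hE⟩ := exists_chart (hder t) ((hder v).sub_const (lonLat (8 * v))) (by
      rw [ht, hv]
      simp only [Prod.smul_mk, smul_eq_mul]
      intro h
      refine crossing_det_ne_zero n hδ h0 ?_
      linear_combination h / 64)
    obtain ⟨c, hc0, hc⟩ := hΦ.chart (lonLat (8 * t)) (Real.abs_cos_le_one _)
    have hEt : E 0 = lonLat (8 * t) := by rw [hE]; simp
    refine ⟨E.trans c, ?_, fun x hx => ?_, fun y hy => ?_⟩
    · rw [OpenPartialHomeomorph.trans_source]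
      exact ⟨hE0, by rw [mem_preimage, hEt]; exact hc0⟩
    · rw [OpenPartialHomeomorph.trans_source] at hx
      rw [OpenPartialHomeomorph.trans_apply, hc _ hx.2, hE]
      simp
    · rw [OpenPartialHomeomorph.trans_source] at hy
      rw [OpenPartialHomeomorph.trans_apply, hc _ hy.2, hE]
      simp [htv]

theorem simpleAt {t : ℝ} (h : ∀ (n : ℤ) (δ : ℝ), lonFun δ = 0 → δ ≠ 0 → 8 * t ≠ n - δ) :
    SimpleAt (fun x : ℝ => Φ (lonLat (8 * x))) t := by
  refine ⟨fun w hw => ?_, ?_⟩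
  · rcases hΦ.loop_cases hw.symm with hk | ⟨n, δ, hδ, h0, ht, -⟩
    · exact hk
    · exact absurd ht (h n δ hδ h0)
  · have hlin : HasStrictDerivAt (fun x : ℝ => 8 * (t + x)) 8 0 := by
      simpa using ((hasStrictDerivAt_id (0 : ℝ)).const_add t).const_mul 8
    set A := Real.pi / 4 * (1 + 2 * Real.pi * Real.cos (2 * Real.pi * (8 * t))) with hA
    set B := -(Real.pi * Real.sin (Real.pi * (8 * t))) with hB
    have hder : HasStrictDerivAt (fun x : ℝ => lonLat (8 * (t + x))) ((8 : ℝ) • (A, B)) 0 := by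
      have h := (hasStrictDerivAt_lonLat (8 * (t + 0))).scomp (0 : ℝ) hlin
      rwa [add_zero] at h
    -- For a simple point any transverse curve can serve as second axis; the normal line is taken.
    have hder' : HasStrictDerivAt (fun y : ℝ => y • ((-B, A) : ℝ × ℝ)) (-B, A) 0 := by
      simpa using (hasStrictDerivAt_id (0 : ℝ)).smul_const ((-B, A) : ℝ × ℝ)
    obtain ⟨E, hE0, hE⟩ := exists_chart hder hder' (by
      simp only [Prod.smul_mk, smul_eq_mul]
      have : 0 < A ^ 2 + B ^ 2 := by
        rcases lonLat_deriv_ne_zero (8 * t) with h | h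
        · have : 0 < A ^ 2 := by rw [hA]; positivity
          positivity
        · have : 0 < B ^ 2 := by rw [hB]; positivity
          positivity
      nlinarith)
    obtain ⟨c, hc0, hc⟩ := hΦ.chart (lonLat (8 * t)) (Real.abs_cos_le_one _)
    have hEt : E 0 = lonLat (8 * t) := by rw [hE]; simp
    refine ⟨E.trans c, ?_, fun x hx => ?_⟩
    · rw [OpenPartialHomeomorph.trans_source]
      exact ⟨hE0, by rw [mem_preimage, hEt]; exact hc0⟩
    · rw [OpenPartialHomeomorph.trans_source] at hx
      rw [OpenPartialHomeomorph.trans_apply, hc _ hx.2, hE]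
      simp

theorem exists_crossing {t : ℝ} (h : DoubleTime (fun x : ℝ => Φ (lonLat (8 * x))) t) :
    ∃ (n : ℤ) (δ : ℝ), lonFun δ = 0 ∧ δ ≠ 0 ∧ 8 * t = n - δ := by
  obtain ⟨s, hs, hk⟩ := h
  rcases hΦ.loop_cases hs.symm with ⟨k, h⟩ | ⟨n, δ, hδ, h0, ht, -⟩
  · exact absurd h (hk k)
  · exact ⟨n, δ, hδ, h0, ht⟩

theorem range_loop : range (fun x : ℝ => Φ (lonLat (8 * x))) = range fun u => Φ (lonLat u) := by
  ext q
  constructor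
  · rintro ⟨x, rfl⟩; exact ⟨8 * x, rfl⟩
  · rintro ⟨u, rfl⟩; exact ⟨u / 8, by simp only; congr 2; ring⟩

theorem isImmersedCurve [T2Space F] : IsImmersedCurve (range fun u => Φ (lonLat u)) := by
  rw [← hΦ.range_loop]
  refine isImmersedCurve_of_charts hΦ.continuous_loop hΦ.periodic_loop fun t => ?_
  by_cases h : ∃ (n : ℤ) (δ : ℝ), lonFun δ = 0 ∧ δ ≠ 0 ∧ 8 * t = n - δ
  · obtain ⟨n, δ, hδ, h0, ht⟩ := h
    exact Or.inr ⟨(n + δ) / 8, hΦ.crossingAt hδ h0 ht (by ring)⟩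
  · push Not at h
    exact Or.inl (hΦ.simpleAt h)

theorem genericLoop [T2Space F] : GenericLoop fun x : ℝ => Φ (lonLat (8 * x)) where
  continuous := hΦ.continuous_loop
  periodic := hΦ.periodic_loop
  finite := by
    refine (((Set.finite_Icc (-1 : ℤ) 9).prod finite_zeros).image
      fun z : ℤ × ℝ => ((z.1 : ℝ) - z.2) / 8).subset ?_
    rintro t ⟨⟨ht0, ht1⟩, hd⟩
    obtain ⟨n, δ, hδ, -, ht⟩ := hΦ.exists_crossing hd
    obtain ⟨b1, b2⟩ := abs_lt.1 (abs_lt_one_of_lonFun_eq_zero hδ)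
    refine ⟨(n, δ), ⟨⟨?_, ?_⟩, hδ⟩, by simp only; linarith⟩
    · have : (-2 : ℤ) < n := int_lt_of_real (by push_cast; linarith)
      simp only; omega
    · have : n < 10 := int_lt_of_real (by push_cast; linarith)
      simp only; omega
  transverse := by
    intro t hd
    obtain ⟨n, δ, hδ, h0, ht⟩ := hΦ.exists_crossing hd
    exact (hΦ.crossingAt hδ h0 ht (v := (n + δ) / 8) (by ring)).transverse hΦ.continuous_loop
      hΦ.periodic_loop

/-- The short arcs at the double points, one for each of the eight clasps, in two nested families,
form an arc system, because an arc contains only one of the eight times `j / 8`. -/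
theorem arcSystem : ArcSystem (fun x : ℝ => Φ (lonLat (8 * x)))
    {a | ∃ (n : ℤ) (δ : ℝ), 0 < δ ∧ lonFun δ = 0 ∧ 8 * a.1 = n - δ ∧ 8 * a.2 = n + δ} where
  lt := by
    rintro a ⟨n, δ, h0, hδ, h1, h2⟩
    linarith
  lt_add_one := by
    rintro a ⟨n, δ, h0, hδ, h1, h2⟩
    have := (abs_lt.1 (abs_lt_one_of_lonFun_eq_zero hδ)).2
    linarith
  eq := by
    rintro a ⟨n, δ, h0, hδ, h1, h2⟩
    simp only [h1, h2, lonLat_int_add_sub n hδ]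
  choice := by
    intro s t hst hts h
    rcases hΦ.loop_cases h with ⟨k, hk⟩ | ⟨n, δ, hδ, h0, hs, k, ht⟩
    · exact absurd hk (not_int_of_abs_lt hst.ne' (abs_lt.2 ⟨by linarith, by linarith⟩) k)
    · obtain ⟨b1, b2⟩ := abs_lt.1 (abs_lt_one_of_lonFun_eq_zero hδ)
      have k1 : k < 2 := int_lt_of_real (by push_cast; linarith)
      have k2 : -1 < k := int_lt_of_real (by push_cast; linarith)
      have k3 : k = 0 ∨ k = 1 := by omega
      rcases k3 with rfl | rfl
      · left
        refine ⟨n, δ, ?_, hδ, hs, ?_⟩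
        · push_cast at ht; linarith
        · push_cast at ht; simp only; linarith
      · right
        -- For negative `δ` the pair is seen from the other end: the arc starts at `t` and ends at
        -- `s + 1`, a period of eight later.
        refine ⟨n + 8, -δ, ?_, by rw [lonFun_neg, hδ, neg_zero], ?_, ?_⟩
        · push_cast at ht; linarith
        · push_cast at ht ⊢; linarith
        · push_cast at ht ⊢; linarith
  cover := by
    intro x
    -- The nearest integer is at distance at most `1/2 < δ`.
    obtain ⟨δ, h1, h2, hδ⟩ := exists_zero
    have h3 := abs_le.1 (abs_sub_round (8 * x))
    refine ⟨((round (8 * x) - δ) / 8, (round (8 * x) + δ) / 8),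
      ⟨round (8 * x), δ, by linarith, hδ, by ring, by ring⟩, 0, ?_, ?_⟩
    · simp only [Int.cast_zero]; linarith [h3.1, h3.2]
    · simp only [Int.cast_zero]; linarith [h3.1, h3.2]
  not_cover := by
    intro w hw
    choose n δ h0 hδ h1 h2 using hw
    -- Six arcs have at most six centres modulo `8`. Since `δ < 1`, an integer time lies only in
    -- arcs centred at it, so an integer time in an unused class is not covered.
    obtain ⟨j, hj⟩ : ∃ j : ZMod 8, ∀ i, (n i : ZMod 8) ≠ j := by
      have : ¬ Function.Surjective fun i : Fin 6 => (n i : ZMod 8) := fun h => by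
        have := Fintype.card_le_of_surjective _ h
        simp [ZMod.card] at this
      simpa [Function.Surjective] using this
    obtain ⟨m, rfl⟩ := ZMod.intCast_surjective j
    refine ⟨m / 8, fun i ⟨k, hk1, hk2⟩ => hj i ?_⟩
    have hb := (abs_lt.1 (abs_lt_one_of_lonFun_eq_zero (hδ i))).2
    have e1 : m + 8 * k - n i < 1 := int_lt_of_real (by push_cast; linarith [h2 i])
    have e2 : -1 < m + 8 * k - n i := int_lt_of_real (by push_cast; linarith [h1 i])
    have e3 : n i = m + 8 * k := by omega
    rw [e3]
    push_cast
    rw [show (8 : ZMod 8) = 0 from rfl, zero_mul, add_zero]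

theorem hasArcSystem [T2Space F] : HasArcSystem (range fun u => Φ (lonLat u)) :=
  ⟨_, _, hΦ.genericLoop, hΦ.range_loop, hΦ.arcSystem⟩

end LonLatCoord

/-! ### Longitude and latitude in the plane and on the sphere -/

section

open Real

/-- Longitude and (shifted) Mercator latitude on the plane without the origin. -/
noncomputable def planePoint (z : ℝ × ℝ) : ℝ × ℝ :=
  Complex.equivRealProdCLM (Complex.exp (Complex.equivRealProdCLM.symm z.swap))

/-- The point with coordinates `(l, b)` goes to `exp (b + l * I)`; injectivity modulo the period and
local invertibility are those of the complex exponential. -/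
theorem lonLatCoord_planePoint : LonLatCoord planePoint where
  continuous := by unfold planePoint; fun_prop
  period := by
    intro l b
    unfold planePoint
    congr 1
    rw [Complex.exp_eq_exp_iff_exists_int]
    refine ⟨1, ?_⟩
    apply Complex.ext <;> simp
  inj := by
    intro z z' _ _ h
    obtain ⟨k, hk⟩ := Complex.exp_eq_exp_iff_exists_int.1 (Complex.equivRealProdCLM.injective h)
    have h1 := congrArg Complex.re hk
    have h2 := congrArg Complex.im hk
    simp at h1 h2
    refine ⟨h1, -k, ?_⟩
    push_cast; linarith
  chart := by
    intro z _
    let H : ℝ × ℝ ≃ₜ ℂ := (Homeomorph.prodComm ℝ ℝ).trans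
      Complex.equivRealProdCLM.symm.toHomeomorph
    have hd := (Complex.hasStrictDerivAt_exp (H z)).hasStrictFDerivAt_equiv (Complex.exp_ne_zero _)
    refine ⟨(H.toOpenPartialHomeomorph.trans (hd.toOpenPartialHomeomorph _)).trans
      Complex.equivRealProdCLM.toHomeomorph.toOpenPartialHomeomorph, ?_, fun w _ => rfl⟩
    simp only [OpenPartialHomeomorph.trans_source, Homeomorph.toOpenPartialHomeomorph_source,
      univ_inter, preimage_univ, inter_univ]
    exact hd.mem_toOpenPartialHomeomorph_source

theorem spherePoint_coords (l b : ℝ) : (spherePoint l b : EuclideanSpace ℝ (Fin 3)) 0 = cos b * cos l ∧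
    (spherePoint l b : EuclideanSpace ℝ (Fin 3)) 1 = cos b * sin l ∧
    (spherePoint l b : EuclideanSpace ℝ (Fin 3)) 2 = sin b := by
  simp [spherePoint]

theorem sphere_sq_add (q : Sphere2) : q.1 0 ^ 2 + q.1 1 ^ 2 + q.1 2 ^ 2 = 1 := by
  have h := q.2
  rw [mem_sphere_zero_iff_norm, EuclideanSpace.norm_eq, Real.sqrt_eq_one] at h
  simpa [Fin.sum_univ_three] using h

/-- The projection of the sphere to the equatorial plane, rotated by the angle `-l₀`. -/
noncomputable def equatorial (l₀ : ℝ) (q : Sphere2) : ℂ :=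
  (q.1 0 + q.1 1 * Complex.I) * Complex.exp (-(l₀ * Complex.I))

theorem continuous_equatorial (l₀ : ℝ) : Continuous (equatorial l₀) := by
  unfold equatorial; fun_prop

theorem equatorial_spherePoint (l₀ l b : ℝ) : equatorial l₀ (spherePoint l b) =
    (cos b : ℝ) * (Complex.cos ((l - l₀ : ℝ) : ℂ) + Complex.sin ((l - l₀ : ℝ) : ℂ) * Complex.I) := by
  obtain ⟨h0, h1, -⟩ := spherePoint_coords l b
  have h2 : ((cos b * cos l : ℝ) : ℂ) + ((cos b * sin l : ℝ) : ℂ) * Complex.I =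
      (cos b : ℝ) * Complex.exp (l * Complex.I) := by
    rw [Complex.exp_mul_I]; push_cast; ring
  rw [equatorial, h0, h1, h2, mul_assoc, ← Complex.exp_add, ← Complex.exp_mul_I]
  congr 2; push_cast; ring

theorem norm_equatorial (l₀ : ℝ) (q : Sphere2) : ‖equatorial l₀ q‖ = cos (arcsin (q.1 2)) := by
  have h1 : ‖Complex.exp (-(l₀ * Complex.I))‖ = 1 := by
    have := Complex.norm_exp_ofReal_mul_I (-l₀)
    push_cast at this
    rwa [neg_mul] at this
  rw [equatorial, norm_mul, h1, mul_one, cos_arcsin, Complex.norm_add_mul_I]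
  congr 1
  linarith [sphere_sq_add q]

theorem eq_of_add_mul_I {a b c x y : ℝ}
    (h : (a : ℂ) + b * Complex.I = c * (x + y * Complex.I)) : a = c * x ∧ b = c * y := by
  have hre := congrArg Complex.re h
  have him := congrArg Complex.im h
  simp at hre him
  exact ⟨hre, him⟩

theorem continuous_spherePoint : Continuous fun z : ℝ × ℝ => spherePoint z.1 z.2 := by
  unfold spherePoint
  refine Continuous.subtype_mk ((PiLp.continuous_toLp 2 _).comp (continuous_pi fun i => ?_)) _
  fin_cases i <;> simp <;> fun_prop

/-- Longitude and latitude as a chart of the sphere, away from the poles and from a meridian. -/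
noncomputable def sphereChart (l₀ : ℝ) : OpenPartialHomeomorph (ℝ × ℝ) Sphere2 where
  toFun z := spherePoint z.1 z.2
  invFun q := (l₀ + Complex.arg (equatorial l₀ q), arcsin (q.1 2))
  source := Ioo (l₀ - π) (l₀ + π) ×ˢ Ioo (-(π / 2)) (π / 2)
  target := equatorial l₀ ⁻¹' Complex.slitPlane
  map_source' := by
    rintro ⟨l, b⟩ ⟨hl, hb⟩
    rw [mem_preimage, equatorial_spherePoint, Complex.mem_slitPlane_iff_arg,
      Complex.arg_mul_cos_add_sin_mul_I (cos_pos_of_mem_Ioo hb) ⟨by linarith [hl.1], by linarith [hl.2]⟩]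
    refine ⟨fun h => ?_, ?_⟩
    · simp only at h; linarith [hl.2]
    · rw [← Complex.exp_mul_I]
      exact mul_ne_zero (Complex.ofReal_ne_zero.2 (cos_pos_of_mem_Ioo hb).ne') (Complex.exp_ne_zero _)
  map_target' := by
    intro q hq
    have hq' : equatorial l₀ q ∈ Complex.slitPlane := hq
    have h1 := Complex.neg_pi_lt_arg (equatorial l₀ q)
    have h2 := lt_of_le_of_ne (Complex.arg_le_pi (equatorial l₀ q)) (Complex.slitPlane_arg_ne_pi hq')
    have h3 : q.1 2 ^ 2 < 1 := by
      have h4 : 0 < ‖equatorial l₀ q‖ := norm_pos_iff.2 (Complex.slitPlane_ne_zero hq')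
      rw [norm_equatorial, cos_arcsin, sqrt_pos] at h4
      linarith
    obtain ⟨h5, h6⟩ := abs_lt.1 ((sq_lt_one_iff_abs_lt_one _).1 h3)
    refine ⟨⟨by simp only; linarith, by simp only; linarith⟩, ?_, ?_⟩
    · exact neg_pi_div_two_lt_arcsin.2 h5
    · exact arcsin_lt_pi_div_two.2 h6
  left_inv' := by
    rintro ⟨l, b⟩ ⟨hl, hb⟩
    refine Prod.ext ?_ ?_
    · simp only
      rw [equatorial_spherePoint,
        Complex.arg_mul_cos_add_sin_mul_I (cos_pos_of_mem_Ioo hb) ⟨by linarith [hl.1], by linarith [hl.2]⟩]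
      ring
    · simp only
      rw [(spherePoint_coords l b).2.2, arcsin_sin hb.1.le hb.2.le]
  right_inv' := by
    intro q hq
    have h1 := sphere_sq_add q
    obtain ⟨e0, e1, e2⟩ := spherePoint_coords (l₀ + Complex.arg (equatorial l₀ q)) (arcsin (q.1 2))
    have h2 : q.1 2 ^ 2 ≤ 1 := by linarith [sq_nonneg (q.1 0), sq_nonneg (q.1 1)]
    obtain ⟨h5, h6⟩ := abs_le.1 ((sq_le_one_iff_abs_le_one _).1 h2)
    -- The polar form of `equatorial l₀ q`, rotated back by the angle `l₀`; its real and imaginary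
    -- parts are the horizontal coordinates.
    have h7 : ((q.1 0 : ℝ) : ℂ) + ((q.1 1 : ℝ) : ℂ) * Complex.I =
        (cos (arcsin (q.1 2)) : ℝ) * Complex.exp (((l₀ + Complex.arg (equatorial l₀ q) : ℝ) : ℂ) * Complex.I) := by
      have h8 := Complex.norm_mul_exp_arg_mul_I (equatorial l₀ q)
      rw [norm_equatorial] at h8
      have h9 : equatorial l₀ q * Complex.exp (l₀ * Complex.I) =
          ((q.1 0 : ℝ) : ℂ) + ((q.1 1 : ℝ) : ℂ) * Complex.I := by
        rw [equatorial, mul_assoc, ← Complex.exp_add, neg_add_cancel, Complex.exp_zero, mul_one]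
      rw [← h9]
      nth_rewrite 1 [← h8]
      rw [mul_assoc, ← Complex.exp_add]
      congr 2; push_cast; ring
    rw [Complex.exp_mul_I, ← Complex.ofReal_cos, ← Complex.ofReal_sin] at h7
    obtain ⟨hre, him⟩ := eq_of_add_mul_I h7
    apply Subtype.ext
    ext i
    fin_cases i
    · exact e0.trans hre.symm
    · exact e1.trans him.symm
    · exact e2.trans (sin_arcsin h5 h6)
  open_source := isOpen_Ioo.prod isOpen_Ioo
  open_target := Complex.isOpen_slitPlane.preimage (continuous_equatorial l₀)
  continuousOn_toFun := continuous_spherePoint.continuousOn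
  continuousOn_invFun := by
    refine ContinuousOn.prodMk (continuousOn_const.add
      (Complex.continuousOn_arg.comp (continuous_equatorial l₀).continuousOn fun q hq => hq)) ?_
    exact (continuous_arcsin.comp (by fun_prop)).continuousOn

/-- Latitudes of absolute value at most `1` are smaller than `π / 2`, so the poles, where longitude
degenerates, are avoided. -/
theorem lonLatCoord_spherePoint : LonLatCoord fun z : ℝ × ℝ => spherePoint z.1 z.2 where
  continuous := continuous_spherePoint
  period := by
    intro l b
    simp only [spherePoint, cos_add_two_pi, sin_add_two_pi]
  inj := by
    rintro ⟨l, b⟩ ⟨l', b'⟩ hb hb' h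
    obtain ⟨e0, e1, e2⟩ := spherePoint_coords l b
    obtain ⟨e0', e1', e2'⟩ := spherePoint_coords l' b'
    simp only at h hb hb'
    rw [h] at e0 e1 e2
    have hpi := pi_gt_three
    obtain ⟨b1, b2⟩ := abs_le.1 hb
    obtain ⟨b1', b2'⟩ := abs_le.1 hb'
    have hbb : b = b' := injOn_sin ⟨by linarith, by linarith⟩ ⟨by linarith, by linarith⟩ (e2.symm.trans e2')
    subst hbb
    have hc : 0 < cos b := cos_pos_of_mem_Ioo ⟨by linarith, by linarith⟩
    have hcos := mul_left_cancel₀ hc.ne' (e0.symm.trans e0')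
    have hsin := mul_left_cancel₀ hc.ne' (e1.symm.trans e1')
    obtain ⟨k, hk⟩ := Real.Angle.angle_eq_iff_two_pi_dvd_sub.1 (Real.Angle.cos_sin_inj hcos hsin)
    refine ⟨rfl, -k, ?_⟩
    push_cast; linarith
  chart := by
    rintro ⟨l, b⟩ hb
    have hpi := pi_gt_three
    obtain ⟨b1, b2⟩ := abs_le.1 hb
    simp only at b1 b2
    exact ⟨sphereChart l, ⟨⟨by simp only; linarith, by simp only; linarith⟩,
      by simp only; linarith, by simp only; linarith⟩, fun w _ => rfl⟩

end

end ImmersedCurve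

/-- The curve `clasp8Curve` is an immersed curve in the sphere which is not (1,3)-simplifiable.
In particular not every immersed curve in the plane is (1,3)-simplifiable. -/
theorem theorem2p5 :
    (ImmersedCurve.IsImmersedCurve ImmersedCurve.clasp8Curve ∧
      ¬ ImmersedCurve.IsOneThreeSimplifiable ImmersedCurve.clasp8Curve) ∧
    ¬ (∀ C : Set (ℝ × ℝ), ImmersedCurve.IsImmersedCurve C →
        ImmersedCurve.IsOneThreeSimplifiable C) := by
  have hS := ImmersedCurve.lonLatCoord_spherePoint
  have hP := ImmersedCurve.lonLatCoord_planePoint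
  -- `clasp8` is by definition `spherePoint` evaluated along `lonLat`. For the plane, the image of
  -- the same `lonLat` under `planePoint` is the counterexample.
  exact ⟨⟨hS.isImmersedCurve, hS.hasArcSystem.not_simplifiable⟩,
    fun h => hP.hasArcSystem.not_simplifiable (h _ hP.isImmersedCurve)⟩
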